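/- Let $k$ be an algebraically closed field with a fixed linear order $\prec$ on its elements (no compatibility with the field operations is required). **Linear matrix problems.** Let $\Gamma\subset k^{t\times t}$ be a basic matrix algebra, i.e. a unital algebra of upper triangular matrices containing the diagonal part of each of its elements, and let $\mathcal M\subset k^{t\times t}$ be a vector space with $\Gamma\mathcal M\subset\mathcal M$ and $\mathcal M\Gamma\subset\mathcal M$. For $i,j\in T=\{1,\dots,t\}$ write $i\sim j$ if $a_{ii}=a_{jj}$ for all $[a_{ij}]\in\Gamma$. A step-sequence is a sequence $\underline n=(n_1,\dots,n_t)$ of nonnegative integers with $n_i=n_j$ whenever $i\sim j$. Let $\Gamma_{\underline n\times\underline n}$ (resp. $\mathcal M_{\underline n\times\underline n}$) be the space of all block matrices $[M_{ij}]_{i,j=1}^t$, $M_{ij}\in k^{n_i\times n_j}$, such that for all classes $\mathcal I,\mathcal J\in T/\!\sim$ every linear relation $\sum_{(i,j)\in\mathcal I\times\mathcal J}d_{ij}x_{ij}=0$ that holds for the entries of all matrices in $\Gamma$ (resp. $\mathcal M$) holds for the blocks $M_{ij}$. The space $\Gamma_{\underline n\times\underline n}$ is an algebra. Matrices $M,N\in\mathcal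 M_{\underline n\times\underline n}$ are equivalent, $M\simeq N$, if $S^{-1}MS=N$ for some nonsingular $S\in\Gamma_{\underline n\times\underline n}$. The block-direct sum of $M=[M_{ij}]\in\mathcal M_{\underline m\times\underline m}$ and $N=[N_{ij}]\in\mathcal M_{\underline n\times\underline n}$ is $M\uplus N=[M_{ij}\oplus N_{ij}]_{i,j=1}^t$, a matrix of block size $(\underline m+\underline n)\times(\underline m+\underline n)$. A matrix $M\in\mathcal M_{\underline n\times\underline n}$ is indecomposable if $\underline n\ne0$ and $M\simeq M_1\uplus M_2$ with $M_i\in\mathcal M_{\underline m_i\times\underline m_i}$ ($\underline m_i$ step-sequences) implies $\underline m_1=0$ or $\underline m_2=0$. **Canonical matrices.** A reduced algebra, with respect to a partition into $s$ strips and an equivalence relation $\approx$ on $\{1,\dots,s\}$ for which equivalent strips have the same size, is an algebra $\Lambda$ consisting of all upper block-triangular matrices $S=[S_{ij}]$ with $S_{ii}=S_{jj}$ for $i\approx j$ and with off-diagonal blocks satisfying, for each pair of classes $\mathcal I,\mathcal J$, a finite system of equations $\sum_{\mathcal I\ni i<j\in\mathcal J}c_{ij}S_{ij}=0$. (The nonempty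 strips and the relation $\approx$ on them are determined by $\Lambda$; the algebras $\Gamma_{\underline n\times\underline n}$ are reduced, with the given strips and the relation $\sim$.) Let $\Lambda^*$ be the set of nonsingular elements of $\Lambda$. A block $M_{ij}$ of $M$ is stable if it coincides with the $(i,j)$ block of $S^{-1}MS$ for all $S\in\Lambda^*$. Order the blocks by $M_{s1}<M_{s2}<\dots<M_{ss}<M_{s-1,1}<\cdots$. A step of Belitskii's algorithm replaces $(M,\Lambda)$, where $\Lambda$ is reduced and $M$ has a nonstable block, by $(M',\Lambda')$: let $M_{lr}$ be the first nonstable block and let $M'=S^{-1}MS$, where $S\in\Lambda^*$ is such that - (I) if $\sum_{j<r}M_{lj}R_{jr}\neq\sum_{i>l}R_{li}M_{ir}$ for some $R\in\Lambda$, then all diagonal blocks of $S$ are identity matrices and $M'_{lr}=0$; - (II) if there is no such $R$ and $l\not\approx r$, then $M'_{lr}=\begin{bmatrix}0&I\\0&0\end{bmatrix}$; - (III) if there is no such $R$ and $l\approx r$, then $M'_{lr}$ is a Weyr matrix $W_{\{\lambda_1\}}\oplus\dots\oplus W_{\{\lambda_q\}}$, $\lambda_1\prec\dots\prec\lambda_q$,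 where $W_{\{\lambda_i\}}$ has diagonal blocks $\lambda_iI_{m_{i1}},\dots,\lambda_iI_{m_{ik_i}}$ with $m_{i1}\ge\dots\ge m_{ik_i}$, blocks $\begin{bmatrix}I\\0\end{bmatrix}$ on the first block superdiagonal, and zeros elsewhere; and let $\Lambda'=\{R\in\Lambda\mid (RM')_{lr}=(M'R)_{lr}\}$. The algebra $\Lambda'$ is again reduced, with respect to a finer partition, which is used in the next step. The algorithm stops at a pair $(M^\infty,\Lambda^\infty)$ such that $S^{-1}M^\infty S=M^\infty$ for all nonsingular $S\in\Lambda^\infty$; then $M^\infty$ is the $\Lambda$-canonical form of $M$, and $M$ is $\Lambda$-canonical if $M^\infty=M$. The canonical matrices of the linear matrix problem $(\Gamma,\mathcal M)$ are the $\Gamma_{\underline n\times\underline n}$-canonical matrices $M\in\mathcal M_{\underline n\times\underline n}$, for all step-sequences $\underline n$. **Theorem.** For every canonical matrix $M\in\mathcal M_{\underline n\times\underline n}$ there exists a permutation matrix $P\in\Gamma_{\underline n\times\underline n}$ such that $$P^{-1}MP=\underbrace{M_1\uplus\dots\uplus M_1}_{q_1\text{ copies}}\uplus\dots\uplus\underbrace{M_l\uplus\dots\uplus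 M_l}_{q_l\text{ copies}},\qquad l\ge0,\ q_i\ge1,$$ where the $M_i$ are distinct indecomposable canonical matrices. The decomposition is unique up to permutation of summands: for any two such decompositions (with possibly different permutation matrices) the families of pairs $(M_i,q_i)$ coincide up to reindexing. **Corollary (Krull–Schmidt theorem).** For every step-sequence $\underline n$ and every $M\in\mathcal M_{\underline n\times\underline n}$ there is a decomposition $M\simeq M_1\uplus\dots\uplus M_r$ ($r\ge0$) with indecomposable $M_i\in\mathcal M_{\underline n_i\times\underline n_i}$. If also $M\simeq N_1\uplus\dots\uplus N_s$ with indecomposable $N_i$, then $r=s$ and, after a suitable reindexing, $M_1\simeq N_1,\dots,M_r\simeq N_r$. -/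

import Mathlib

namespace Belitskii

open Matrix

/-! Reduced matrix algebras -/

section Reduced

variable {k X : Type*} [Field k] [Fintype X] [LinearOrder X] {t : ℕ}

/-- A partition of the (linearly ordered) set `X` of row indices into `t` consecutive, possibly
empty, strips is given by a monotone function `b : X → Fin t`. This is the number of rows of the
`i`-th strip. -/
def stripSize (b : X → Fin t) (i : Fin t) : ℕ :=
  (Finset.univ.filter fun x => b x = i).card

/-- The position `0, 1, 2, …` of an index inside its strip. -/
def pos (b : X → Fin t) (x : X) : ℕ :=
  (Finset.univ.filter fun y => b y = b x ∧ y < x).card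

open Classical in
/-- `Λ` is a reduced algebra with respect to the partition into strips `b` and the equivalence
relation `rel` on the set of strips: it consists of all upper block-triangular matrices `S` with
`S_{ii} = S_{jj}` for equivalent `i, j` and with off-diagonal blocks that satisfy, for every pair
`(I, J)` of equivalence classes, a finite system of linear equations
`∑_{I ∋ i < j ∈ J} c_{ij} S_{ij} = 0`. The matrix equations are written entrywise: the `(p, p')`
entries of the blocks `S_{ij}` with `(i, j) ∈ I × J` are the `S x y` with `x` in position `p` of the
strip `i` and `y` in position `p'` of the strip `j`. -/
structure IsReducedAlgebra (b : X → Fin t) (rel : Setoid (Fin t))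
    (Λ : Subalgebra k (Matrix X X k)) : Prop where
  monotone : Monotone b
  size_eq : ∀ i j, rel i j → stripSize b i = stripSize b j
  system : ∃ (q : Quotient rel → Quotient rel → ℕ)
      (c : ∀ I J, Fin (q I J) → Fin t → Fin t → k),
    ∀ S : Matrix X X k, S ∈ Λ ↔
      (∀ x y, b y < b x → S x y = 0) ∧
      (∀ x y x' y', b x = b y → b x' = b y' → rel (b x) (b x') →
        pos b x = pos b x' → pos b y = pos b y' → S x y = S x' y') ∧
      (∀ (I J : Quotient rel) (l : Fin (q I J)) (p p' : ℕ),
        (∑ x with Quotient.mk rel (b x) = I ∧ pos b x = p,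
          ∑ y with Quotient.mk rel (b y) = J ∧ pos b y = p' ∧ b x < b y,
            c I J l (b x) (b y) * S x y) = 0)

/-- The block `M_{ij}`. -/
def block (b : X → Fin t) (M : Matrix X X k) (i j : Fin t) :
    Matrix {x // b x = i} {y // b y = j} k :=
  M.submatrix Subtype.val Subtype.val

/-- The block `M_{ij}` is stable: it is invariant under `Λ`-similarity transformations. -/
def IsStable (b : X → Fin t) (Λ : Subalgebra k (Matrix X X k)) (M : Matrix X X k)
    (i j : Fin t) : Prop :=
  ∀ S ∈ Λ, IsUnit S → block b (S⁻¹ * M * S) i j = block b M i j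

/-- The order of the blocks: `M_{t1} < M_{t2} < ⋯ < M_{tt} < M_{t-1,1} < ⋯`. -/
def BlockLT (i j l r : Fin t) : Prop := l < i ∨ (i = l ∧ j < r)

/-- There is a nonzero admissible addition to `M_{lr}` from other blocks: the equality
`∑_{j<r} M_{lj} S_{jr} = ∑_{i>l} S_{li} M_{ir}` fails for some `S ∈ Λ`. -/
def HasAddition (b : X → Fin t) (Λ : Subalgebra k (Matrix X X k)) (M : Matrix X X k)
    (l r : Fin t) : Prop :=
  ∃ S ∈ Λ, ∃ x y, b x = l ∧ b y = r ∧
    (∑ z with b z < r, M x z * S z y) ≠ ∑ z with l < b z, S x z * M z y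

end Reduced

/-! The shapes of the reduced blocks -/

section Shapes

variable {k α β : Type*} [Field k] [LE α] [LE β]

/-- The matrix has the form `[0 I; 0 0]`. -/
def IsZeroOneForm (A : Matrix α β k) : Prop :=
  ∃ (ρ m n : ℕ) (e : α ≃o (Fin ρ ⊕ₗ Fin m)) (f : β ≃o (Fin n ⊕ₗ Fin ρ)),
    ∀ x y, A x y = (fromBlocks 0 1 0 0 : Matrix (Fin ρ ⊕ Fin m) (Fin n ⊕ Fin ρ) k)
      (ofLex (e x)) (ofLex (f y))

/-- The rows of a Weyr matrix: the triple `(i, j, p)` is the `p`-th row in the `j`-th horizontal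
strip of the direct summand with number `i`. -/
abbrev WeyrIdx (s : ℕ) (κ : Fin s → ℕ) (m : ∀ i, Fin (κ i) → ℕ) : Type :=
  Σₗ i : Fin s, Σₗ j : Fin (κ i), Fin (m i j)

/-- The direct sum of the matrices `W_{λ_i}`, where `W_{λ_i}` has the diagonal blocks
`λ_i I_{m_{i1}}, …, λ_i I_{m_{iκ_i}}`, the blocks `[I; 0]` of size `m_{ij} × m_{i,j+1}` on the first
block superdiagonal, and zeros elsewhere. -/
def weyrMatrix {s : ℕ} (lam : Fin s → k) (κ : Fin s → ℕ) (m : ∀ i, Fin (κ i) → ℕ) :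
    Matrix (WeyrIdx s κ m) (WeyrIdx s κ m) k := fun x y =>
  if x = y then lam (ofLex x).1
  else if (ofLex x).1 = (ofLex y).1 ∧
      ((ofLex (ofLex x).2).1 : ℕ) + 1 = (ofLex (ofLex y).2).1 ∧
      ((ofLex (ofLex x).2).2 : ℕ) = (ofLex (ofLex y).2).2 then 1
  else 0

/-- `A` is a Weyr matrix with respect to the fixed linear order of the field (no compatibility of
this order with the operations is assumed). The rows and the columns of `A` are numbered by two
ordered sets of the same cardinality. Zero values `m_{ij} = 0` do not change the set of these
matrices. -/
def IsWeyr [LinearOrder k] (A : Matrix α β k) : Prop :=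
  ∃ (s : ℕ) (lam : Fin s → k) (κ : Fin s → ℕ) (m : ∀ i, Fin (κ i) → ℕ)
    (e : α ≃o WeyrIdx s κ m) (f : β ≃o WeyrIdx s κ m),
    StrictMono lam ∧ (∀ i, Antitone (m i)) ∧
      ∀ x y, A x y = weyrMatrix lam κ m (e x) (f y)

end Shapes

/-! Belitskii's algorithm -/

section Algorithm

variable {k X : Type*} [Field k] [LinearOrder k] [Fintype X] [LinearOrder X]

/-- One step `(M, Λ) ↦ (M', Λ')` of Belitskii's algorithm. The nonempty strips and the equivalence
relation on them are determined by the reduced algebra `Λ`, so it does not matter which `b` and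
`rel` are taken; in particular `(M', Λ')` is considered in the next step with the finer partition
of `Λ'`. The block `M_{lr}` is the first nonstable block. -/
def Step (A A' : Matrix X X k × Subalgebra k (Matrix X X k)) : Prop :=
  ∃ (t : ℕ) (b : X → Fin t) (rel : Setoid (Fin t)), IsReducedAlgebra b rel A.2 ∧
    ∃ l r : Fin t, ¬ IsStable b A.2 A.1 l r ∧
      (∀ i j, BlockLT i j l r → IsStable b A.2 A.1 i j) ∧
      (∃ S ∈ A.2, IsUnit S ∧ A'.1 = S⁻¹ * A.1 * S ∧
        -- there are additions from other blocks: make the block zero by a unitriangular `S`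
        ((HasAddition b A.2 A.1 l r ∧
            (∀ x y, b x = b y → S x y = (1 : Matrix X X k) x y) ∧ block b A'.1 l r = 0) ∨
        -- no additions, independent row and column transformations
          (¬ HasAddition b A.2 A.1 l r ∧ ¬ rel l r ∧ IsZeroOneForm (block b A'.1 l r)) ∨
        -- no additions, similarity transformations
          (¬ HasAddition b A.2 A.1 l r ∧ rel l r ∧ IsWeyr (block b A'.1 l r)))) ∧
      ∀ R, R ∈ A'.2 ↔ R ∈ A.2 ∧ block b (R * A'.1) l r = block b (A'.1 * R) l r

/-- `N` is the `Λ`-canonical form of `M`: Belitskii's algorithm, applied to `(M, Λ)`, terminates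
with the matrix `N`, that is, with a pair `(N, Λ')` such that `N` is `Λ'`-similar only to itself. -/
def IsCanonicalForm (Λ : Subalgebra k (Matrix X X k)) (M N : Matrix X X k) : Prop :=
  ∃ Λ' : Subalgebra k (Matrix X X k), Relation.ReflTransGen Step (M, Λ) (N, Λ') ∧
    ∀ S ∈ Λ', IsUnit S → S⁻¹ * N * S = N

/-- `M` is a `Λ`-canonical matrix: it is its own `Λ`-canonical form. -/
def IsCanonical (Λ : Subalgebra k (Matrix X X k)) (M : Matrix X X k) : Prop :=
  IsCanonicalForm Λ M M

end Algorithm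

/-! Linear matrix problems -/

/-- The index set of the rows of an `n × n` block matrix, `n = (n_1, …, n_t)`: pairs `(i, p)`, where
`i` is a strip and `p` is a row in it, ordered lexicographically. -/
def Idx {t : ℕ} (n : Fin t → ℕ) : Type := Σₗ i : Fin t, Fin (n i)

namespace Idx

variable {t : ℕ} {n : Fin t → ℕ}

instance : LinearOrder (Idx n) := inferInstanceAs (LinearOrder (Σₗ i : Fin t, Fin (n i)))

instance : Fintype (Idx n) := inferInstanceAs (Fintype (Σ i : Fin t, Fin (n i)))

/-- The index `(i, p)`. -/
def mk (i : Fin t) (p : Fin (n i)) : Idx n := toLex ⟨i, p⟩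

/-- The strip of an index. -/
def strip (x : Idx n) : Fin t := (ofLex x : Σ i : Fin t, Fin (n i)).1

/-- The row inside the strip. -/
def row (x : Idx n) : Fin (n x.strip) := (ofLex x : Σ i : Fin t, Fin (n i)).2

end Idx

/-- The data of a linear matrix problem: a basic matrix algebra `Γ` and a vector space `V` of
`t × t` matrices with `Γ V ⊆ V` and `V Γ ⊆ V`. A basic matrix algebra is an algebra of upper triangular
matrices that contains the diagonal part of each of its elements. -/
structure Problem (k : Type*) [Field k] (t : ℕ) where
  Γ : Subalgebra k (Matrix (Fin t) (Fin t) k)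
  upper : ∀ A ∈ Γ, ∀ i j, j < i → A i j = 0
  diag : ∀ A ∈ Γ, diagonal (fun i => A i i) ∈ Γ
  V : Submodule k (Matrix (Fin t) (Fin t) k)
  mul_left : ∀ A ∈ Γ, ∀ B ∈ V, A * B ∈ V
  mul_right : ∀ A ∈ Γ, ∀ B ∈ V, B * A ∈ V

/-- The entry in row `p` and column `q` of the block `N_{ij}` (and `0` if the block has no such
entry). -/
def entry {k : Type*} [Field k] {t : ℕ} {n : Fin t → ℕ} (N : Matrix (Idx n) (Idx n) k)
    (i j : Fin t) (p q : ℕ) : k :=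
  if h : p < n i ∧ q < n j then N (Idx.mk i ⟨p, h.1⟩) (Idx.mk j ⟨q, h.2⟩) else 0

namespace Problem

variable {k : Type*} [Field k] {t : ℕ} (P : Problem k t)

/-- The equivalence relation on the set of strips: all matrices in `Γ` have the same entries in the
diagonal places `i` and `j`. -/
def rel : Setoid (Fin t) where
  r i j := ∀ A ∈ P.Γ, A i i = A j j
  iseqv := ⟨fun _ _ _ => rfl, fun h A hA => (h A hA).symm,
    fun h h' A hA => (h A hA).trans (h' A hA)⟩

/-- A sequence of nonnegative integers with `n_i = n_j` for equivalent `i, j`. -/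
def IsStepSequence (n : Fin t → ℕ) : Prop := ∀ i j, P.rel i j → n i = n j

open Classical in
/-- The space of all `n × n` matrices whose blocks satisfy the same linear relations as the entries
of the `t × t` matrices from `W`, the relations being those between the entries in the places
`(i, j) ∈ I × J` for equivalence classes `I` and `J` (here `I` and `J` are the classes
of `a` and `b`). -/
def blowUp (W : Submodule k (Matrix (Fin t) (Fin t) k)) (n : Fin t → ℕ) :
    Submodule k (Matrix (Idx n) (Idx n) k) where
  carrier := {N | ∀ (a b : Fin t) (d : Matrix (Fin t) (Fin t) k),
    (∀ A ∈ W, ∑ i with P.rel a i, ∑ j with P.rel b j, d i j * A i j = 0) →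
      ∀ p q : ℕ, ∑ i with P.rel a i, ∑ j with P.rel b j, d i j * entry N i j p q = 0}
  zero_mem' := by
    intro a b d _ p q
    simp [entry]
  add_mem' := by
    intro M N hM hN a b d hd p q
    have h : ∀ i j, entry (M + N) i j p q = entry M i j p q + entry N i j p q := by
      intro i j
      unfold entry
      split_ifs <;> simp
    simp only [h, mul_add, Finset.sum_add_distrib, hM a b d hd p q, hN a b d hd p q, add_zero]
  smul_mem' := by
    intro c M hM a b d hd p q
    have h : ∀ i j, d i j * entry (c • M) i j p q = c * (d i j * entry M i j p q) := by
      intro i j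
      unfold entry
      split_ifs <;> simp [mul_left_comm]
    simp only [h, ← Finset.mul_sum, hM a b d hd p q, mul_zero]

variable {P}

theorem exists_idem (a : Fin t) (s : Finset (Fin t)) (hs : ∀ j ∈ s, ¬ P.rel a j) :
    ∃ f : Fin t → k, diagonal f ∈ P.Γ ∧ f a = 1 ∧ ∀ j ∈ s, f j = 0 := by
  classical
  induction s using Finset.induction_on with
  | empty => exact ⟨fun _ => 1, by simp, rfl, by simp⟩
  | insert j s _ ih =>
    obtain ⟨f, hf, hfa, hfs⟩ := ih fun i hi => hs i (Finset.mem_insert_of_mem hi)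
    have hj : ¬ ∀ A ∈ P.Γ, A a a = A j j := hs j (Finset.mem_insert_self j s)
    push Not at hj
    obtain ⟨A, hA, hne⟩ := hj
    have hne' : A a a - A j j ≠ 0 := sub_ne_zero.mpr hne
    have hg : diagonal (fun i => (A a a - A j j)⁻¹ * (A i i - A j j)) ∈ P.Γ := by
      have h := P.Γ.smul_mem (P.Γ.sub_mem (P.diag A hA) (P.Γ.smul_mem P.Γ.one_mem (A j j)))
        (A a a - A j j)⁻¹
      convert h using 1
      ext x y
      by_cases hxy : x = y
      · subst hxy; simp
      · simp [hxy]
    refine ⟨fun i => f i * ((A a a - A j j)⁻¹ * (A i i - A j j)), ?_, ?_, ?_⟩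
    · have h := P.Γ.mul_mem hf hg
      rwa [diagonal_mul_diagonal] at h
    · simp [hfa, hne']
    · intro i hi
      rcases Finset.mem_insert.mp hi with rfl | hi
      · simp
      · simp [hfs i hi]

open Classical in
/-- The diagonal idempotent that belongs to the equivalence class of `a` lies in `Γ`. -/
theorem idem_mem (a : Fin t) :
    diagonal (fun i => if P.rel a i then (1 : k) else 0) ∈ P.Γ := by
  obtain ⟨f, hf, hfa, hfs⟩ := exists_idem (P := P) a (Finset.univ.filter fun j => ¬ P.rel a j)
    (by simp)
  convert hf using 2
  ext i
  split_ifs with h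
  · have := h _ hf
    simp only [diagonal_apply_eq] at this
    rw [← this, hfa]
  · exact (hfs i (by simpa using h)).symm

variable (P) in
open Classical in
/-- The `t × t` matrix that is formed by the `(p, q)` entries of the blocks `N_{ij}` with `i`
equivalent to `a` and `j` equivalent to `b`. -/
noncomputable def slice {n : Fin t → ℕ} (N : Matrix (Idx n) (Idx n) k) (a b : Fin t) (p q : ℕ) :
    Matrix (Fin t) (Fin t) k :=
  Matrix.of fun i j => if P.rel a i ∧ P.rel b j then entry N i j p q else 0

theorem mem_blowUp_iff {W : Submodule k (Matrix (Fin t) (Fin t) k)}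
    (hW : ∀ A ∈ P.Γ, ∀ B ∈ P.Γ, ∀ C ∈ W, A * C * B ∈ W) {n : Fin t → ℕ}
    {N : Matrix (Idx n) (Idx n) k} :
    N ∈ P.blowUp W n ↔ ∀ a b p q, P.slice N a b p q ∈ W := by
  classical
  constructor
  · intro h a b p q
    by_contra hnot
    obtain ⟨f, hf, hle⟩ := Submodule.exists_le_ker_of_notMem hnot
    have key : ∀ A : Matrix (Fin t) (Fin t) k,
        f A = ∑ i, ∑ j, f (Matrix.single i j 1) * A i j := by
      intro A
      conv_lhs => rw [matrix_eq_sum_single A]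
      simp only [map_sum]
      refine Finset.sum_congr rfl fun i _ => Finset.sum_congr rfl fun j _ => ?_
      have : Matrix.single i j (A i j) = A i j • Matrix.single i j (1 : k) := by
        rw [smul_single, smul_eq_mul, mul_one]
      rw [this, map_smul, smul_eq_mul, mul_comm]
    have h1 := h a b (Matrix.of fun i j => f (Matrix.single i j 1)) (fun A hA => by
      have h2 := LinearMap.mem_ker.mp (hle (hW _ (idem_mem a) _ (idem_mem b) A hA))
      rw [key] at h2
      rw [← h2, Finset.sum_filter]
      refine Finset.sum_congr rfl fun i _ => ?_
      by_cases hi : P.rel a i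
      · rw [if_pos hi, Finset.sum_filter]
        refine Finset.sum_congr rfl fun j _ => ?_
        by_cases hj : P.rel b j <;> simp [hi, hj]
      · rw [if_neg hi]
        simp [hi]) p q
    apply hf
    rw [key, ← h1, Finset.sum_filter]
    refine Finset.sum_congr rfl fun i _ => ?_
    by_cases hi : P.rel a i
    · rw [if_pos hi, Finset.sum_filter]
      refine Finset.sum_congr rfl fun j _ => ?_
      by_cases hj : P.rel b j <;> simp [slice, hi, hj]
    · rw [if_neg hi]
      simp [slice, hi]
  · intro h a b d hd p q
    rw [← hd _ (h a b p q)]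
    refine Finset.sum_congr rfl fun i hi => Finset.sum_congr rfl fun j hj => ?_
    simp only [Finset.mem_filter, Finset.mem_univ, true_and] at hi hj
    simp [slice, hi, hj]

theorem entry_mul {n : Fin t → ℕ} (M N : Matrix (Idx n) (Idx n) k) (i j : Fin t) (p q : ℕ) :
    entry (M * N) i j p q =
      ∑ m, ∑ s ∈ Finset.range (∑ i, n i), entry M i m p s * entry N m j s q := by
  classical
  by_cases h : p < n i ∧ q < n j
  · have e1 : entry (M * N) i j p q = (M * N) (Idx.mk i ⟨p, h.1⟩) (Idx.mk j ⟨q, h.2⟩) := by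
      simp [entry, h]
    rw [e1, mul_apply]
    have e2 : ∀ g : Idx n → k, ∑ x, g x = ∑ m, ∑ s : Fin (n m), g (Idx.mk m s) := by
      intro g
      exact Fintype.sum_sigma (fun x : Σ i : Fin t, Fin (n i) => g (toLex x))
    rw [e2]
    refine Finset.sum_congr rfl fun m _ => ?_
    have hm : n m ≤ ∑ i, n i := Finset.single_le_sum (fun _ _ => Nat.zero_le _) (Finset.mem_univ m)
    rw [← Finset.sum_subset (Finset.range_subset_range.mpr hm)]
    · rw [Finset.sum_range]
      refine Finset.sum_congr rfl fun s _ => ?_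
      simp [entry, h]
    · intro s _ hs
      have : ¬ s < n m := by simpa using hs
      simp [entry, this]
  · have e1 : entry (M * N) i j p q = 0 := by simp [entry, h]
    rw [e1]
    symm
    refine Finset.sum_eq_zero fun m _ => Finset.sum_eq_zero fun s _ => ?_
    by_cases hp : p < n i
    · have hq : ¬ q < n j := fun hq => h ⟨hp, hq⟩
      simp [entry, hq]
    · simp [entry, hp]

open Classical in
theorem slice_mul {n : Fin t → ℕ} (M N : Matrix (Idx n) (Idx n) k) (a b : Fin t) (p q : ℕ) :
    P.slice (M * N) a b p q = ∑ c : Quotient P.rel, ∑ s ∈ Finset.range (∑ i, n i),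
      P.slice M a c.out p s * P.slice N c.out b s q := by
  ext i j
  have hout : ∀ (c : Quotient P.rel) (m : Fin t), P.rel c.out m ↔ Quotient.mk P.rel m = c := by
    intro c m
    constructor
    · intro h
      rw [← Quotient.out_eq c]
      exact (Quotient.sound h).symm
    · rintro rfl
      exact Quotient.mk_out (s := P.rel) m
  simp only [Matrix.sum_apply, mul_apply]
  by_cases h : P.rel a i ∧ P.rel b j
  · have h1 : ∀ (c : Quotient P.rel) (s : ℕ) (m : Fin t),
        P.slice M a c.out p s i m * P.slice N c.out b s q m j =
          if Quotient.mk P.rel m = c then entry M i m p s * entry N m j s q else 0 := by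
      intro c s m
      by_cases hc : Quotient.mk P.rel m = c
      · simp [slice, h, hout, hc]
      · simp [slice, h, hout, hc]
    simp only [h1]
    have h2 : P.slice (M * N) a b p q i j = entry (M * N) i j p q := by simp [slice, h]
    rw [h2, entry_mul, Finset.sum_comm]
    conv_rhs => rw [Finset.sum_comm]
    refine Finset.sum_congr rfl fun s _ => ?_
    rw [Finset.sum_comm]
    refine Finset.sum_congr rfl fun m _ => ?_
    simp
  · have h2 : P.slice (M * N) a b p q i j = 0 := by simp only [slice, of_apply, if_neg h]
    rw [h2]
    symm
    refine Finset.sum_eq_zero fun c _ => Finset.sum_eq_zero fun s _ =>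
      Finset.sum_eq_zero fun m _ => ?_
    by_cases hi : P.rel a i
    · have hj : ¬ P.rel b j := fun hj => h ⟨hi, hj⟩
      simp [slice, hj]
    · simp [slice, hi]

theorem gamma_sandwich : ∀ A ∈ P.Γ, ∀ B ∈ P.Γ, ∀ C ∈ Subalgebra.toSubmodule P.Γ,
    A * C * B ∈ Subalgebra.toSubmodule P.Γ :=
  fun _ hA _ hB _ hC => P.Γ.mul_mem (P.Γ.mul_mem hA hC) hB

variable (P) in
/-- The space `Γ_{n × n}`. -/
def gammaSpace (n : Fin t → ℕ) : Submodule k (Matrix (Idx n) (Idx n) k) :=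
  P.blowUp (Subalgebra.toSubmodule P.Γ) n

variable (P) in
/-- The space `Γ_{n × n}` as an algebra; here `n` is a step-sequence. -/
def gammaAlg (n : Fin t → ℕ) (hn : P.IsStepSequence n) :
    Subalgebra k (Matrix (Idx n) (Idx n) k) :=
  (P.gammaSpace n).toSubalgebra
    (by
      classical
      change (1 : Matrix (Idx n) (Idx n) k) ∈ P.blowUp _ n
      intro a b d hd p q
      have h := hd 1 P.Γ.one_mem
      by_cases hpq : p = q ∧ p < n a
      · rw [← h]
        refine Finset.sum_congr rfl fun i hi => Finset.sum_congr rfl fun j hj => ?_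
        obtain ⟨rfl, hp⟩ := hpq
        have hi' : n a = n i := hn a i (by simpa using hi)
        congr 1
        by_cases hij : i = j
        · subst hij
          simp [entry, ← hi', hp]
        · have : ∀ x y, Idx.mk (n := n) i x ≠ Idx.mk j y := fun x y hxy =>
            hij (congrArg (fun z : Idx n => z.strip) hxy)
          simp [entry, hij, this]
      · refine Finset.sum_eq_zero fun i hi => Finset.sum_eq_zero fun j hj => ?_
        have hi' : n a = n i := hn a i (by simpa using hi)
        have : entry (1 : Matrix (Idx n) (Idx n) k) i j p q = 0 := by
          unfold entry
          split_ifs with h0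
          · refine one_apply_ne fun hxy => hpq ⟨?_, hi' ▸ h0.1⟩
            exact congrArg (fun z : Idx n => (z.row : ℕ)) hxy
          · rfl
        rw [this, mul_zero])
    (by
      classical
      intro M N hM hN
      unfold gammaSpace at hM hN ⊢
      rw [mem_blowUp_iff gamma_sandwich] at hM hN ⊢
      intro a b p q
      rw [slice_mul]
      exact Submodule.sum_mem _ fun c _ => Submodule.sum_mem _ fun s _ =>
        P.Γ.mul_mem (hM _ _ _ _) (hN _ _ _ _))

end Problem

/-! Block matrices and block-direct sums -/

/-- An `n × n` block matrix together with the sequence `n = (n_1, …, n_t)`. -/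
structure BlockMatrix (k : Type*) (t : ℕ) where
  size : Fin t → ℕ
  mat : Matrix (Idx size) (Idx size) k

namespace BlockMatrix

variable {k : Type*} [Field k] {t : ℕ}

/-- The block with number `(i, j)`. -/
def blk (A : BlockMatrix k t) (i j : Fin t) : Matrix (Fin (A.size i)) (Fin (A.size j)) k :=
  Matrix.of fun p q => A.mat (Idx.mk i p) (Idx.mk j q)

/-- The block-direct sum: its `(i, j)` block is the direct sum of the `(i, j)` blocks. -/
def blockSum (A B : BlockMatrix k t) : BlockMatrix k t where
  size i := A.size i + B.size i
  mat := Matrix.of fun x y =>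
    fromBlocks (A.blk x.strip y.strip) 0 0 (B.blk x.strip y.strip)
      (finSumFinEquiv.symm x.row) (finSumFinEquiv.symm y.row)

/-- The empty matrix, of size `0 × 0`. -/
def empty : BlockMatrix k t where
  size _ := 0
  mat := 0

/-- The block-direct sum `A_1 ⊎ (A_2 ⊎ ⋯)` of the matrices in a list. -/
def listSum (L : List (BlockMatrix k t)) : BlockMatrix k t := L.foldr blockSum empty

/-- The matrix `S⁻¹ A S`. -/
noncomputable def conj (A : BlockMatrix k t) (S : Matrix (Idx A.size) (Idx A.size) k) :
    BlockMatrix k t where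
  size := A.size
  mat := S⁻¹ * A.mat * S

end BlockMatrix

namespace Problem

variable {k : Type*} [Field k] {t : ℕ} (P : Problem k t)

/-- `A` belongs to the space `V_{n × n}` for a step-sequence `n`. -/
def Mem (A : BlockMatrix k t) : Prop :=
  P.IsStepSequence A.size ∧ A.mat ∈ P.blowUp P.V A.size

/-- `A` and `B` have the same block size `n × n` and are `Γ_{n × n}`-similar. -/
def Equivalent (A B : BlockMatrix k t) : Prop :=
  ∃ S ∈ P.gammaSpace A.size, IsUnit S ∧ A.conj S = B

/-- `A` is an indecomposable matrix of the linear matrix problem. -/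
def IsIndecomposable (A : BlockMatrix k t) : Prop :=
  P.Mem A ∧ A.size ≠ 0 ∧ ∀ B C : BlockMatrix k t, P.Mem B → P.Mem C →
    P.Equivalent A (B.blockSum C) → B.size = 0 ∨ C.size = 0

/-- `A` is a canonical matrix of the linear matrix problem. -/
def IsCanonicalMatrix [LinearOrder k] (A : BlockMatrix k t) : Prop :=
  P.Mem A ∧ ∃ h : P.IsStepSequence A.size, IsCanonical (P.gammaAlg A.size h) A.mat

/-- There is a permutation matrix `Q ∈ Γ_{n × n}` such that `Q⁻¹ A Q` is the block-direct sum of `q 0`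
copies of `C 0`, then `q 1` copies of `C 1`, and so on, where the `C i` are distinct indecomposable
canonical matrices and all `q i` are positive. -/
def IsCanonicalDecomposition [LinearOrder k] (A : BlockMatrix k t) {l : ℕ}
    (C : Fin l → BlockMatrix k t) (q : Fin l → ℕ) : Prop :=
  (∀ i, P.IsIndecomposable (C i) ∧ P.IsCanonicalMatrix (C i)) ∧ Function.Injective C ∧
    (∀ i, 0 < q i) ∧
    ∃ σ : Equiv.Perm (Idx A.size), σ.permMatrix k ∈ P.gammaSpace A.size ∧
      A.conj (σ.permMatrix k) =
        BlockMatrix.listSum (List.ofFn fun i => List.replicate (q i) (C i)).flatten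

end Problem
end Belitskii

namespace Belitskii

open Matrix

set_option linter.unusedSectionVars false

/-! ### Subalgebras of matrix algebras -/

section Subalgebra

variable {k X : Type*} [Field k] [Fintype X] [LinearOrder X]

/-! Regard an element `S` of the rectangular space Γ_{m×n} with `A S = S B` as a morphism from `A`
to `B`. Equivalence of matrices is then isomorphism, the block-direct sum is a direct sum, and
idempotent endomorphisms split (`exists_split`). Hence a matrix of nonzero size is indecomposable
exactly when 0 and 1 are its only idempotent endomorphisms.

Canonical matrices: if the algorithm leads from `M` back to `M`, it can be run without changing `M`
at all. The final matrix is conjugate to every intermediate one by an element of the algebra reached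
there, and such a conjugation preserves everything that a step looks at (`Step.stepAt`,
`run_stepAt`). So a canonical `M` comes with a descending chain of reduced algebras from Λ to some
Λ₁. Each step imposes commutation with `M` at one block, and Λ₁ is the centralizer of `M` in Λ, that
is, the endomorphism algebra of `M`. Two such chains can be compared step by step: the first
nonstable block and its normal form are invariants (the form is zero, or is determined by a rank, or
by the ranks of the powers of `A - c`). Therefore similar canonical matrices are equal
(`IsCanonical.eq_of_similar`).

Decomposition: a nontrivial diagonal idempotent of Λ₁ selects rows and columns such that `M`, after
a permutation, is the sum of two principal submatrices. Both are canonical, because each step of the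
chain restricts either to a step or to no change of the algebra (`StepAt.restrict`), and one inducts
on the size. There remains the case that Λ₁ has no nontrivial diagonal idempotents. Consider the
last step, and join indices that have the same position in equivalent strips, or that are the row
and the column of a nonzero entry of the reduced block. Diagonal matrices that are constant on
joined indices lie in Λ₁, so all indices are connected. If the block is zero or [0 I; 0 0], a
connection never links two rows of one strip, so each strip has at most one row. If it is a Weyr
matrix, it is a single Jordan block, whose centralizer is triangular. In all cases Λ₁ consists of
triangular matrices with constant diagonal (`StepAt.isTriangular`). Its idempotents are 0 and 1, and
`M` is indecomposable.

Uniqueness: over an algebraically closed field the endomorphism algebra of an indecomposable `N` is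
local with residue field `k`; let ε be the residue map. The rank of the pairing `(a, b) ↦ ε (a * b)`
between the morphisms `N → A` and `A → N` is additive in `A` and invariant under isomorphism. It is
1 for `A = N` and 0 for an indecomposable `A` not isomorphic to `N`. So it counts the summands of
type `N` (`countP_iso_eq`), which is the Krull–Schmidt theorem. As isomorphic canonical matrices are
equal, the canonical decomposition is unique too. -/

theorem inv_mem_of_isUnit (Λ : Subalgebra k (Matrix X X k)) {S : Matrix X X k} (hS : S ∈ Λ)
    (hu : IsUnit S) : S⁻¹ ∈ Λ := by
  -- Left multiplication by `S` is injective on the finite-dimensional space `Λ`, hence onto, so 1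
  -- is attained inside `Λ`.
  let f : Λ →ₗ[k] Λ := LinearMap.mulLeft k (⟨S, hS⟩ : Λ)
  have hinj : Function.Injective f := by
    intro A B hAB
    have h1 : S * A.1 = S * B.1 := congrArg Subtype.val hAB
    exact Subtype.ext (hu.mul_left_cancel h1)
  obtain ⟨R, hR⟩ := (LinearMap.injective_iff_surjective.mp hinj) 1
  have h1 : S * R.1 = 1 := congrArg Subtype.val hR
  rw [Matrix.inv_eq_right_inv h1]
  exact R.2

/-- The determinant of `R + c` is the characteristic polynomial of `-R` at `c`, which has finitely
many roots. This carries linear statements from the nonsingular elements of an algebra to all of its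
elements. -/
theorem exists_isUnit_add_smul [Infinite k] (R : Matrix X X k) :
    ∃ c : k, IsUnit (R + c • (1 : Matrix X X k)) := by
  obtain ⟨c, hc⟩ := Polynomial.exists_eval_ne_zero_of_natDegree_lt_card (-R).charpoly
    (charpoly_monic _).ne_zero (by
      exact lt_of_lt_of_le (Cardinal.natCast_lt_aleph0) (Cardinal.infinite_iff.mp inferInstance))
  refine ⟨c, ?_⟩
  rw [Matrix.isUnit_iff_isUnit_det, isUnit_iff_ne_zero]
  rw [eval_charpoly] at hc
  convert hc using 2
  ext i j
  simp [Matrix.scalar_apply, add_comm, Matrix.diagonal_apply, Matrix.one_apply]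

theorem inv_mul_mul_eq_iff {S M N : Matrix X X k} (hu : IsUnit S) :
    S⁻¹ * M * S = N ↔ M * S = S * N := by
  have hd := (Matrix.isUnit_iff_isUnit_det S).mp hu
  constructor
  · rintro rfl
    rw [Matrix.mul_assoc, Matrix.mul_nonsing_inv_cancel_left _ _ hd]
  · intro h
    rw [Matrix.mul_assoc, h, Matrix.nonsing_inv_mul_cancel_left _ _ hd]

theorem isUnit_inv {S : Matrix X X k} (hu : IsUnit S) : IsUnit S⁻¹ :=
  (Matrix.isUnit_nonsing_inv_iff).mpr hu

end Subalgebra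

/-! ### Strips and positions -/

section Frames

variable {k X : Type*} [Field k] [Fintype X] [LinearOrder X] {t : ℕ}

theorem pos_lt_pos {b : X → Fin t} {x y : X} (h : b x = b y) (hlt : x < y) :
    pos b x < pos b y := by
  refine Finset.card_lt_card ?_
  rw [Finset.ssubset_iff_of_subset]
  · exact ⟨x, by simp [h, hlt], by simp⟩
  · intro z
    simp only [Finset.mem_filter, Finset.mem_univ, true_and]
    rintro ⟨h1, h2⟩
    exact ⟨h1.trans h, h2.trans hlt⟩

theorem pos_inj {b : X → Fin t} {x y : X} (h : b x = b y) (hp : pos b x = pos b y) : x = y := by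
  rcases lt_trichotomy x y with hlt | rfl | hlt
  · exact absurd hp (pos_lt_pos h hlt).ne
  · rfl
  · exact absurd hp (pos_lt_pos h.symm hlt).ne'

theorem pos_lt_pos_iff {b : X → Fin t} {x y : X} (h : b x = b y) :
    pos b x < pos b y ↔ x < y := by
  refine ⟨fun hp => ?_, pos_lt_pos h⟩
  by_contra hn
  rcases (not_lt.mp hn).eq_or_lt with rfl | hlt
  · exact lt_irrefl _ hp
  · exact lt_asymm hp (pos_lt_pos h.symm hlt)

theorem pos_lt_stripSize (b : X → Fin t) (x : X) : pos b x < stripSize b (b x) := by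
  refine Finset.card_lt_card ?_
  rw [Finset.ssubset_iff_of_subset]
  · exact ⟨x, by simp, by simp⟩
  · intro z
    simp only [Finset.mem_filter, Finset.mem_univ, true_and]
    exact And.left

/-- Positions are injective on a strip and smaller than its size, so by counting every smaller
number occurs. -/
theorem exists_pos {b : X → Fin t} {i : Fin t} {p : ℕ} (h : p < stripSize b i) :
    ∃ x, b x = i ∧ pos b x = p := by
  have hsub : (Finset.univ.filter fun x => b x = i).image (pos b) ⊆
      Finset.range (stripSize b i) := by
    intro p hp
    simp only [Finset.mem_image, Finset.mem_filter, Finset.mem_univ, true_and] at hp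
    obtain ⟨x, hx, rfl⟩ := hp
    rw [Finset.mem_range, ← hx]
    exact pos_lt_stripSize b x
  have heq := Finset.eq_of_subset_of_card_le hsub (by
    rw [Finset.card_range, Finset.card_image_of_injOn]
    · exact le_rfl
    · intro x hx y hy hxy
      simp only [Finset.coe_filter, Finset.mem_univ, true_and, Set.mem_ofPred_eq] at hx hy
      exact pos_inj (hx.trans hy.symm) hxy)
  have := Finset.mem_range.mpr h
  rw [← heq] at this
  simpa using this

/-- The indices `x`, `y` have the same position in equivalent strips. -/
def Match (b : X → Fin t) (rel : Setoid (Fin t)) (x y : X) : Prop :=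
  rel (b x) (b y) ∧ pos b x = pos b y

namespace Match

variable {b : X → Fin t} {rel : Setoid (Fin t)} {x y z : X}

theorem refl (x : X) : Match b rel x x := ⟨rel.refl' _, rfl⟩

theorem symm (h : Match b rel x y) : Match b rel y x := ⟨rel.symm' h.1, h.2.symm⟩

theorem trans (h : Match b rel x y) (h' : Match b rel y z) : Match b rel x z :=
  ⟨rel.trans' h.1 h'.1, h.2.trans h'.2⟩

theorem eq (h : Match b rel x y) (hb : b x = b y) : x = y := pos_inj hb h.2

end Match

/-- The properties of reduced algebras that do not involve their systems of linear equations. -/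
structure Frame (b : X → Fin t) (rel : Setoid (Fin t)) (Λ : Subalgebra k (Matrix X X k)) :
    Prop where
  monotone : Monotone b
  size_eq : ∀ i j, rel i j → stripSize b i = stripSize b j
  upper : ∀ S ∈ Λ, ∀ x y, b y < b x → S x y = 0
  diag_eq : ∀ S ∈ Λ, ∀ x y x' y', b x = b y → b x' = b y' → Match b rel x x' →
    Match b rel y y' → S x y = S x' y'
  mem : ∀ S : Matrix X X k, (∀ x y, b x ≠ b y → S x y = 0) →
    (∀ x y x' y', b x = b y → b x' = b y' → Match b rel x x' → Match b rel y y' →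
      S x y = S x' y') → S ∈ Λ

/-- The linear equations involve off-diagonal blocks only, so a block-diagonal matrix satisfies them
trivially. -/
theorem IsReducedAlgebra.frame {b : X → Fin t} {rel : Setoid (Fin t)}
    {Λ : Subalgebra k (Matrix X X k)} (h : IsReducedAlgebra b rel Λ) : Frame b rel Λ := by
  obtain ⟨q, c, hc⟩ := h.system
  refine ⟨h.monotone, h.size_eq, fun S hS => ((hc S).mp hS).1,
    fun S hS x y x' y' h1 h2 h3 h4 => ((hc S).mp hS).2.1 x y x' y' h1 h2 h3.1 h3.2 h4.2, ?_⟩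
  intro S h1 h2
  refine (hc S).mpr ⟨fun x y hxy => h1 x y hxy.ne', ?_, ?_⟩
  · intro x y x' y' e1 e2 e3 e4 e5
    exact h2 x y x' y' e1 e2 ⟨e3, e4⟩ ⟨e1 ▸ e2 ▸ e3, e5⟩
  · intro I J l p p'
    refine Finset.sum_eq_zero fun x _ => Finset.sum_eq_zero fun y hy => ?_
    simp only [Finset.mem_filter, Finset.mem_univ, true_and] at hy
    rw [h1 x y hy.2.2.ne, mul_zero]

namespace Frame

variable {b : X → Fin t} {rel : Setoid (Fin t)} {Λ : Subalgebra k (Matrix X X k)}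

theorem exists_match (h : Frame b rel Λ) {x : X} {j : Fin t} (hj : rel (b x) j) :
    ∃ y, b y = j ∧ Match b rel x y := by
  obtain ⟨y, hy, hp⟩ := exists_pos (b := b) (i := j) (p := pos b x)
    (by rw [← h.size_eq _ _ hj]; exact pos_lt_stripSize b x)
  exact ⟨y, hy, by rw [hy]; exact hj, hp.symm⟩

theorem diagonal_mem (h : Frame b rel Λ) {d : X → k}
    (hd : ∀ x y, Match b rel x y → d x = d y) : diagonal d ∈ Λ := by
  refine h.mem _ (fun x y hxy => diagonal_apply_ne _ fun e => hxy (e ▸ rfl)) ?_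
  intro x y x' y' h1 h2 h3 h4
  by_cases hxy : x = y
  · subst hxy
    have := (h3.symm.trans h4).eq h2
    subst this
    simp [hd _ _ h3]
  · rw [diagonal_apply_ne _ hxy, diagonal_apply_ne]
    rintro rfl
    exact hxy ((h3.trans h4.symm).eq h1)

open Classical in
-- A matrix unit inside a diagonal block, together with its copies in the equivalent strips. These
-- test matrices recover the strips and their equivalence from the algebra alone.
theorem unit_mem (h : Frame b rel Λ) (x y : X) :
    (Matrix.of fun u v => if b u = b v ∧ Match b rel x u ∧ Match b rel y v then (1 : k) else 0)
      ∈ Λ := by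
  refine h.mem _ (fun u v huv => by simp [huv]) ?_
  intro u v u' v' h1 h2 h3 h4
  have : (b u = b v ∧ Match b rel x u ∧ Match b rel y v) ↔
      (b u' = b v' ∧ Match b rel x u' ∧ Match b rel y v') :=
    ⟨fun e => ⟨h2, e.2.1.trans h3, e.2.2.trans h4⟩,
      fun e => ⟨h1, e.2.1.trans h3.symm, e.2.2.trans h4.symm⟩⟩
  simp only [of_apply, this]

theorem lt_iff (h : Frame b rel Λ) {x y : X} : b x < b y ↔ x < y ∧ b x ≠ b y := by
  constructor
  · intro hxy
    refine ⟨?_, hxy.ne⟩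
    by_contra hn
    exact absurd (h.monotone (not_lt.mp hn)) (not_le.mpr hxy)
  · rintro ⟨h1, h2⟩
    exact lt_of_le_of_ne (h.monotone h1.le) h2

/-! ### The strips and their equivalence are determined by the algebra -/

section Uniqueness

variable {t' : ℕ} {b' : X → Fin t'} {rel' : Setoid (Fin t')}

/-- If `b'` separated `x < y`, the test matrix of the place `(y, x)`, with entry 1 there, would
violate block-triangularity for `b`. -/
theorem strip_eq_of_lt (h : Frame b rel Λ) (h' : Frame b' rel' Λ) {x y : X} (hxy : x < y)
    (e : b x = b y) : b' x = b' y := by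
  classical
  by_contra hn
  have h0 := h'.upper _ (h.unit_mem y x) y x (h'.lt_iff.mpr ⟨hxy, hn⟩)
  simp [e, Match.refl] at h0

theorem strip_eq (h : Frame b rel Λ) (h' : Frame b' rel' Λ) {x y : X} (e : b x = b y) :
    b' x = b' y := by
  rcases lt_trichotomy x y with hlt | rfl | hlt
  · exact h.strip_eq_of_lt h' hlt e
  · rfl
  · exact (h.strip_eq_of_lt h' hlt e.symm).symm

theorem strip_iff (h : Frame b rel Λ) (h' : Frame b' rel' Λ) {x y : X} :
    b x = b y ↔ b' x = b' y := ⟨h.strip_eq h', h'.strip_eq h⟩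

theorem strip_lt_iff (h : Frame b rel Λ) (h' : Frame b' rel' Λ) {x y : X} :
    b x < b y ↔ b' x < b' y := by
  rw [h.lt_iff, h'.lt_iff, ne_eq, ne_eq, h.strip_iff h']

/-- Let `z` be the copy of `x` in the strip of `y`. The `b'`-test matrix at `(x, x)` has equal
diagonal entries at `x` and `z`, which forces `z` to match `x` for `b'` as well. -/
theorem rel_of (h : Frame b rel Λ) (h' : Frame b' rel' Λ) {x y : X} (e : rel (b x) (b y)) :
    rel' (b' x) (b' y) := by
  classical
  obtain ⟨z, hz, hm⟩ := h.exists_match e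
  have h1 := h.diag_eq _ (h'.unit_mem x x) x x z z rfl rfl hm hm
  have h2 : Match b' rel' x z := by
    by_contra hn
    simp [Match.refl, hn] at h1
  rw [← h.strip_eq h' hz]
  exact h2.1

theorem rel_iff (h : Frame b rel Λ) (h' : Frame b' rel' Λ) {x y : X} :
    rel (b x) (b y) ↔ rel' (b' x) (b' y) := ⟨h.rel_of h', h'.rel_of h⟩

end Uniqueness

end Frame

end Frames

/-! ### Blocks under similarity transformations -/

section Blocks

variable {k X : Type*} [Field k] [Fintype X] [LinearOrder X] {t : ℕ}
  {b : X → Fin t} {rel : Setoid (Fin t)} {Λ : Subalgebra k (Matrix X X k)}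

theorem block_eq_iff {M N : Matrix X X k} {l r : Fin t} :
    block b M l r = block b N l r ↔ ∀ x y, b x = l → b y = r → M x y = N x y := by
  constructor
  · intro h x y hx hy
    exact congrFun (congrFun h ⟨x, hx⟩) ⟨y, hy⟩
  · intro h
    ext x y
    exact h x y x.2 y.2

theorem sum_block {l : Fin t} (f : X → k) :
    ∑ z : {z // b z = l}, f z = ∑ z with b z = l, f z := by
  rw [Finset.sum_subtype (p := fun z => b z = l)]
  simp

/-- Since `S` is upper block-triangular, only the strips from `l` downwards contribute. The diagonal
term is separated from the additions coming from lower strips. -/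
theorem block_mul_left (h : Frame b rel Λ) {S : Matrix X X k} (hS : S ∈ Λ) (N : Matrix X X k)
    (l r : Fin t) :
    block b (S * N) l r = block b S l l * block b N l r +
      Matrix.of fun (x : {x // b x = l}) (y : {y // b y = r}) =>
        ∑ z with l < b z, S x z * N z y := by
  ext x y
  simp only [block, submatrix_apply, mul_apply, Matrix.add_apply, of_apply]
  rw [sum_block (fun z => S x z * N z y), ← Finset.sum_filter_add_sum_filter_not Finset.univ
    (fun z => l < b z), add_comm]
  congr 1
  symm
  refine Finset.sum_subset ?_ ?_
  · intro z
    simp only [Finset.mem_filter, Finset.mem_univ, true_and]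
    exact fun e => not_lt.mpr e.le
  · intro z h1 h2
    simp only [Finset.mem_filter, Finset.mem_univ, true_and, not_lt] at h1 h2
    rw [h.upper S hS x z (by rw [x.2]; exact lt_of_le_of_ne h1 h2), zero_mul]

theorem block_mul_right (h : Frame b rel Λ) {S : Matrix X X k} (hS : S ∈ Λ) (N : Matrix X X k)
    (l r : Fin t) :
    block b (N * S) l r = block b N l r * block b S r r +
      Matrix.of fun (x : {x // b x = l}) (y : {y // b y = r}) =>
        ∑ z with b z < r, N x z * S z y := by
  ext x y
  simp only [block, submatrix_apply, mul_apply, Matrix.add_apply, of_apply]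
  rw [sum_block (fun z => N x z * S z y), ← Finset.sum_filter_add_sum_filter_not Finset.univ
    (fun z => b z < r), add_comm]
  congr 1
  symm
  refine Finset.sum_subset ?_ ?_
  · intro z
    simp only [Finset.mem_filter, Finset.mem_univ, true_and]
    exact fun e => not_lt.mpr e.ge
  · intro z h1 h2
    simp only [Finset.mem_filter, Finset.mem_univ, true_and, not_lt] at h1 h2
    rw [h.upper S hS z y (by rw [y.2]; exact lt_of_le_of_ne h1 (Ne.symm h2)), mul_zero]

theorem block_diag_mul (h : Frame b rel Λ) {S T : Matrix X X k} (hS : S ∈ Λ) (hT : T ∈ Λ)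
    (l : Fin t) : block b (S * T) l l = block b S l l * block b T l l := by
  rw [block_mul_left h hS, add_eq_left]
  ext x y
  refine Finset.sum_eq_zero fun z hz => ?_
  simp only [Finset.mem_filter, Finset.mem_univ, true_and] at hz
  rw [h.upper T hT z y (by rw [y.2]; exact hz), mul_zero]

theorem isUnit_block (h : Frame b rel Λ) {S : Matrix X X k} (hS : S ∈ Λ) (hu : IsUnit S)
    (l : Fin t) : IsUnit (block b S l l) := by
  have h1 : block b (1 : Matrix X X k) l l = 1 := by
    ext x y
    simp [block, one_apply, Subtype.ext_iff]
  have hd := (Matrix.isUnit_iff_isUnit_det S).mp hu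
  exact IsUnit.of_mul_eq_one (block b S⁻¹ l l) (by
    rw [← block_diag_mul h hS (inv_mem_of_isUnit Λ hS hu), Matrix.mul_nonsing_inv _ hd, h1])

/-- The matrices have the same blocks before the block with number `(l, r)`. -/
def AgreeBefore (b : X → Fin t) (l r : Fin t) (M N : Matrix X X k) : Prop :=
  ∀ x y, BlockLT (b x) (b y) l r → M x y = N x y

theorem AgreeBefore.symm {l r : Fin t} {M N : Matrix X X k} (h : AgreeBefore b l r M N) :
    AgreeBefore b l r N M := fun x y hxy => (h x y hxy).symm

/-- Additions to the block `(l, r)` read only blocks of lower strips and blocks further left in the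
strip `l`; all of them precede it. -/
theorem AgreeBefore.hasAddition {l r : Fin t} {M N : Matrix X X k} (h : AgreeBefore b l r M N)
    (hM : HasAddition b Λ M l r) : HasAddition b Λ N l r := by
  obtain ⟨S, hS, x, y, hx, hy, hne⟩ := hM
  refine ⟨S, hS, x, y, hx, hy, ?_⟩
  convert hne using 1
  · refine Finset.sum_congr rfl fun z hz => ?_
    simp only [Finset.mem_filter, Finset.mem_univ, true_and] at hz
    rw [h x z (Or.inr ⟨hx, hz⟩)]
  · refine Finset.sum_congr rfl fun z hz => ?_
    simp only [Finset.mem_filter, Finset.mem_univ, true_and] at hz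
    rw [h z y (Or.inl hz)]

theorem AgreeBefore.hasAddition_iff {l r : Fin t} {M N : Matrix X X k}
    (h : AgreeBefore b l r M N) : HasAddition b Λ M l r ↔ HasAddition b Λ N l r :=
  ⟨h.hasAddition, h.symm.hasAddition⟩

theorem AgreeBefore.sum_left {l r : Fin t} {M N : Matrix X X k} (h : AgreeBefore b l r M N)
    (S : Matrix X X k) :
    (Matrix.of fun (x : {x // b x = l}) (y : {y // b y = r}) => ∑ z with l < b z, S x z * M z y) =
      Matrix.of fun (x : {x // b x = l}) (y : {y // b y = r}) =>
        ∑ z with l < b z, S x z * N z y := by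
  ext x y
  refine Finset.sum_congr rfl fun z hz => ?_
  simp only [Finset.mem_filter, Finset.mem_univ, true_and] at hz
  rw [h z y (Or.inl hz)]

theorem AgreeBefore.sum_right {l r : Fin t} {M N : Matrix X X k} (h : AgreeBefore b l r M N)
    (S : Matrix X X k) :
    (Matrix.of fun (x : {x // b x = l}) (y : {y // b y = r}) => ∑ z with b z < r, M x z * S z y) =
      Matrix.of fun (x : {x // b x = l}) (y : {y // b y = r}) =>
        ∑ z with b z < r, N x z * S z y := by
  ext x y
  refine Finset.sum_congr rfl fun z hz => ?_
  simp only [Finset.mem_filter, Finset.mem_univ, true_and] at hz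
  rw [h x z (Or.inr ⟨x.2, hz⟩)]

/-- The block `(SM)_{lr}` depends only on the blocks of `M` up to `M_{lr}`. -/
theorem AgreeBefore.block_mul_left {l r : Fin t} {M N : Matrix X X k} (h : AgreeBefore b l r M N)
    (hF : Frame b rel Λ) {S : Matrix X X k} (hS : S ∈ Λ) (hb : block b M l r = block b N l r) :
    block b (S * M) l r = block b (S * N) l r := by
  rw [Belitskii.block_mul_left hF hS, Belitskii.block_mul_left hF hS, h.sum_left, hb]

theorem AgreeBefore.block_mul_right {l r : Fin t} {M N : Matrix X X k}
    (h : AgreeBefore b l r M N)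
    (hF : Frame b rel Λ) {S : Matrix X X k} (hS : S ∈ Λ) (hb : block b M l r = block b N l r) :
    block b (M * S) l r = block b (N * S) l r := by
  rw [Belitskii.block_mul_right hF hS, Belitskii.block_mul_right hF hS, h.sum_right, hb]

/-- If there are no additions from other blocks, then the block with number `(l, r)` is transformed
by the diagonal blocks only. -/
theorem block_mul_block (hF : Frame b rel Λ) {l r : Fin t} {M N S : Matrix X X k} (hS : S ∈ Λ)
    (hSN : M * S = S * N) (h : AgreeBefore b l r M N) (hM : ¬ HasAddition b Λ M l r) :
    block b S l l * block b N l r = block b M l r * block b S r r := by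
  have h1 := block_mul_left hF hS N l r
  have h2 := block_mul_right hF hS M l r
  rw [hSN, h1, h.symm.sum_left] at h2
  -- In the absence of additions the contributions of the other blocks to the two products coincide
  -- and cancel.
  have h3 : (Matrix.of fun (x : {x // b x = l}) (y : {y // b y = r}) =>
      ∑ z with l < b z, S x z * M z y) = Matrix.of fun (x : {x // b x = l})
        (y : {y // b y = r}) => ∑ z with b z < r, M x z * S z y := by
    ext x y
    by_contra hne
    exact hM ⟨S, hS, x, y, x.2, y.2, Ne.symm hne⟩
  rw [h3] at h2
  exact add_right_cancel h2

/-- Conjugation by `T ∈ Λ` stays in the same orbit of `Λ`-similarity, on which a stable block is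
constant. -/
theorem IsStable.of_conj {M T : Matrix X X k} (hT : T ∈ Λ) (hTu : IsUnit T) {i j : Fin t}
    (h : IsStable b Λ M i j) : IsStable b Λ (T⁻¹ * M * T) i j := by
  intro S hS hSu
  have h1 := h (T * S) (Λ.mul_mem hT hS) (hTu.mul hSu)
  have h2 := h T hT hTu
  rw [Matrix.mul_inv_rev] at h1
  rw [h2, ← h1]
  simp only [Matrix.mul_assoc]

theorem IsStable.conj_iff {M T : Matrix X X k} (hT : T ∈ Λ) (hTu : IsUnit T) {i j : Fin t} :
    IsStable b Λ (T⁻¹ * M * T) i j ↔ IsStable b Λ M i j := by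
  refine ⟨fun h => ?_, fun h => h.of_conj hT hTu⟩
  have h1 := h.of_conj (inv_mem_of_isUnit Λ hT hTu) (isUnit_inv hTu)
  have hd := (Matrix.isUnit_iff_isUnit_det T).mp hTu
  rw [Matrix.nonsing_inv_nonsing_inv _ hd] at h1
  convert h1 using 1
  simp only [← Matrix.mul_assoc, Matrix.mul_nonsing_inv _ hd, Matrix.one_mul]
  simp only [Matrix.mul_assoc, Matrix.mul_nonsing_inv _ hd, Matrix.mul_one]

theorem agreeBefore_of_stable {M T : Matrix X X k} (hT : T ∈ Λ) (hTu : IsUnit T) {l r : Fin t}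
    (h : ∀ i j, BlockLT i j l r → IsStable b Λ M i j) : AgreeBefore b l r (T⁻¹ * M * T) M :=
  fun x y hxy => block_eq_iff.mp (h _ _ hxy T hT hTu) x y rfl rfl

end Blocks


/-! ### Matrices of the form `[0 I; 0 0]` -/

section ZeroOne

variable {k α β : Type*} [Field k] [Fintype α] [LinearOrder α] [Fintype β] [LinearOrder β]

/-- The nonzero entries of a matrix of the form `[0 I; 0 0]`: they are equal to `1` and form the
graph of an order isomorphism between a lower set of rows and an upper set of columns. -/
structure ZeroOneCoded (A : Matrix α β k) (U : α → Prop) (W : β → Prop) : Prop where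
  lower : ∀ x y, x < y → U y → U x
  upper : ∀ x y, x < y → W x → W y
  entry : ∀ x y, A x y = 0 ∨ A x y = 1
  mem : ∀ x y, A x y = 1 → U x ∧ W y
  exists_col : ∀ x, U x → ∃ y, A x y = 1
  exists_row : ∀ y, W y → ∃ x, A x y = 1
  lt_iff : ∀ x y x' y', A x y = 1 → A x' y' = 1 → (x < x' ↔ y < y')

/-- The coded description mentions no sizes, so it is inherited by suitable submatrices;
`ZeroOneCoded.isZeroOneForm` leads back. -/
theorem IsZeroOneForm.coded {A : Matrix α β k} (h : IsZeroOneForm A) :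
    ∃ U W, ZeroOneCoded A U W := by
  obtain ⟨ρ, m, n, e, f, h⟩ := h
  have key : ∀ x y, A x y = 1 ↔ ∃ p, e x = toLex (Sum.inl p) ∧ f y = toLex (Sum.inr p) := by
    intro x y
    rw [h]
    obtain ⟨a, ha⟩ : ∃ a, e x = toLex a := ⟨_, rfl⟩
    obtain ⟨c, hc⟩ : ∃ c, f y = toLex c := ⟨_, rfl⟩
    rw [ha, hc]
    rcases a with a | a <;> rcases c with c | c <;> simp [one_apply, eq_comm]
  have key0 : ∀ x y, A x y = 0 ∨ A x y = 1 := by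
    intro x y
    rw [h]
    rcases ofLex (e x) with a | a <;> rcases ofLex (f y) with c | c <;> simp [one_apply]
    exact (em _).symm
  refine ⟨fun x => ∃ p, e x = toLex (Sum.inl p), fun y => ∃ p, f y = toLex (Sum.inr p),
    ?_, ?_, key0, ?_, ?_, ?_, ?_⟩
  · rintro x y hxy ⟨p, hp⟩
    have h1 := e.lt_iff_lt.mpr hxy
    rw [hp] at h1
    obtain ⟨a, ha⟩ : ∃ a, e x = toLex a := ⟨_, rfl⟩
    rw [ha] at h1 ⊢
    rcases a with a | a
    · exact ⟨a, rfl⟩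
    · simp at h1
  · rintro x y hxy ⟨p, hp⟩
    have h1 := f.lt_iff_lt.mpr hxy
    rw [hp] at h1
    obtain ⟨a, ha⟩ : ∃ a, f y = toLex a := ⟨_, rfl⟩
    rw [ha] at h1 ⊢
    rcases a with a | a
    · simp at h1
    · exact ⟨a, rfl⟩
  · intro x y hxy
    obtain ⟨p, h1, h2⟩ := (key x y).mp hxy
    exact ⟨⟨p, h1⟩, ⟨p, h2⟩⟩
  · rintro x ⟨p, hp⟩
    exact ⟨f.symm (toLex (Sum.inr p)), (key _ _).mpr ⟨p, hp, by simp⟩⟩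
  · rintro y ⟨p, hp⟩
    exact ⟨e.symm (toLex (Sum.inl p)), (key _ _).mpr ⟨p, by simp, hp⟩⟩
  · intro x y x' y' h1 h2
    obtain ⟨p, h1, h1'⟩ := (key x y).mp h1
    obtain ⟨p', h2, h2'⟩ := (key x' y').mp h2
    rw [← e.lt_iff_lt, ← f.lt_iff_lt, h1, h1', h2, h2']
    simp

namespace ZeroOneCoded

variable {A : Matrix α β k} {U : α → Prop} {W : β → Prop}

theorem row_inj (h : ZeroOneCoded A U W) {x x' : α} {y : β} (h1 : A x y = 1) (h2 : A x' y = 1) :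
    x = x' := by
  rcases lt_trichotomy x x' with hlt | rfl | hlt
  · exact absurd ((h.lt_iff _ _ _ _ h1 h2).mp hlt) (lt_irrefl _)
  · rfl
  · exact absurd ((h.lt_iff _ _ _ _ h2 h1).mp hlt) (lt_irrefl _)

theorem col_inj (h : ZeroOneCoded A U W) {x : α} {y y' : β} (h1 : A x y = 1) (h2 : A x y' = 1) :
    y = y' := by
  rcases lt_trichotomy y y' with hlt | rfl | hlt
  · exact absurd ((h.lt_iff _ _ _ _ h1 h2).mpr hlt) (lt_irrefl _)
  · rfl
  · exact absurd ((h.lt_iff _ _ _ _ h2 h1).mpr hlt) (lt_irrefl _)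

open Classical in
/-- An order isomorphism of a finite linear order on `Fin p ⊕ₗ Fin q` that is determined by a lower
set. -/
theorem exists_orderIso {α : Type*} [Fintype α] [LinearOrder α] {U : α → Prop}
    (hU : ∀ x y, x < y → U y → U x) {p q : ℕ} (eU : {x // U x} ≃o Fin p)
    (eV : {x // ¬ U x} ≃o Fin q) :
    ∃ e : α ≃o (Fin p ⊕ₗ Fin q), (∀ x (hx : U x), e x = toLex (Sum.inl (eU ⟨x, hx⟩))) ∧
      (∀ x (hx : ¬ U x), e x = toLex (Sum.inr (eV ⟨x, hx⟩))) := by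
  let c : α → Fin p ⊕ₗ Fin q := fun x =>
    if h : U x then toLex (Sum.inl (eU ⟨x, h⟩)) else toLex (Sum.inr (eV ⟨x, h⟩))
  have h1 : ∀ x (hx : U x), c x = toLex (Sum.inl (eU ⟨x, hx⟩)) := fun x hx => by simp [c, hx]
  have h2 : ∀ x (hx : ¬ U x), c x = toLex (Sum.inr (eV ⟨x, hx⟩)) := fun x hx => by simp [c, hx]
  have hm : StrictMono c := by
    intro x y hxy
    by_cases hy : U y
    · rw [h1 y hy, h1 x (hU x y hxy hy)]
      simpa using hxy
    · by_cases hx : U x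
      · rw [h1 x hx, h2 y hy]
        simp
      · rw [h2 x hx, h2 y hy]
        simpa using hxy
  have hs : Function.Surjective c := by
    intro a
    obtain ⟨a, rfl⟩ : ∃ a', a = toLex a' := ⟨ofLex a, rfl⟩
    rcases a with a | a
    · exact ⟨eU.symm a, (h1 _ (eU.symm a).2).trans (by rw [Subtype.coe_eta, OrderIso.apply_symm_apply]; rfl)⟩
    · exact ⟨eV.symm a, (h2 _ (eV.symm a).2).trans (by rw [Subtype.coe_eta, OrderIso.apply_symm_apply]; rfl)⟩
  exact ⟨hm.orderIsoOfSurjective c hs, h1, h2⟩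

theorem isZeroOneForm (h : ZeroOneCoded A U W) : IsZeroOneForm A := by
  classical
  choose θ hθ using h.exists_col
  -- The target is written with `¬ ¬ W y` because the columns are split by the lower set `¬ W`,
  -- whose complement this is.
  let θ' : {x // U x} → {y // ¬ ¬ W y} :=
    fun x => ⟨θ x x.2, not_not.mpr (h.mem _ _ (hθ x x.2)).2⟩
  have hm : StrictMono θ' := fun x y hxy =>
    (h.lt_iff _ _ _ _ (hθ x x.2) (hθ y y.2)).mp hxy
  have hs : Function.Surjective θ' := by
    intro y
    obtain ⟨x, hx⟩ := h.exists_row y (not_not.mp y.2)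
    exact ⟨⟨x, (h.mem _ _ hx).1⟩, Subtype.ext (h.col_inj (hθ x _) hx)⟩
  let eU : {x // U x} ≃o Fin _ := (Fintype.orderIsoFinOfCardEq {x // U x} rfl).symm
  let eV : {x // ¬ U x} ≃o Fin _ := (Fintype.orderIsoFinOfCardEq {x // ¬ U x} rfl).symm
  let eN : {y // ¬ W y} ≃o Fin _ := (Fintype.orderIsoFinOfCardEq {y // ¬ W y} rfl).symm
  obtain ⟨e, he1, he2⟩ := exists_orderIso h.lower eU eV
  -- The columns of the upper set are numbered through the matching with the rows, so that the
  -- nonzero entries form an identity matrix.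
  obtain ⟨f, hf1, hf2⟩ := exists_orderIso (U := fun y => ¬ W y)
    (fun x y hxy hy hx => hy (h.upper x y hxy hx)) eN
    ((hm.orderIsoOfSurjective θ' hs).symm.trans eU)
  refine ⟨_, _, _, e, f, ?_⟩
  intro x y
  by_cases hx : U x
  · by_cases hy : W y
    · rw [he1 x hx, hf2 y (not_not.mpr hy)]
      have h1 : (hm.orderIsoOfSurjective θ' hs).symm ⟨y, not_not.mpr hy⟩ = ⟨x, hx⟩ ↔
          A x y = 1 := by
        rw [OrderIso.symm_apply_eq]
        constructor
        · intro e
          have : y = θ x hx := congrArg Subtype.val e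
          rw [this]
          exact hθ x hx
        · intro e
          exact Subtype.ext (h.col_inj e (hθ x hx))
      simp only [ofLex_toLex, fromBlocks_apply₁₂, OrderIso.trans_apply, one_apply,
        EmbeddingLike.apply_eq_iff_eq]
      rcases h.entry x y with h0 | h0
      · rw [h0, if_neg fun e => zero_ne_one (h0.symm.trans (h1.mp e.symm))]
      · rw [h0, if_pos (h1.mpr h0).symm]
    · rw [he1 x hx, hf1 y hy]
      rcases h.entry x y with h0 | h0
      · simp [h0]
      · exact absurd (h.mem _ _ h0).2 hy
  · have h0 : A x y = 0 := (h.entry x y).resolve_right fun h1 => hx (h.mem _ _ h1).1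
    rw [he2 x hx, h0]
    rcases ofLex (f y) with c | c <;> simp

/-- By `huv` a row and a column that meet in a nonzero entry are kept or deleted together, so the
partner of a kept row or column survives. -/
theorem submatrix {α' β' : Type*} [LinearOrder α'] [LinearOrder β']
    (h : ZeroOneCoded A U W) {u : α' → α} {v : β' → β} (hu : StrictMono u) (hv : StrictMono v)
    (huv : ∀ x y, A x y ≠ 0 → (x ∈ Set.range u ↔ y ∈ Set.range v)) :
    ZeroOneCoded (A.submatrix u v) (U ∘ u) (W ∘ v) := by
  refine ⟨fun x y hxy => h.lower _ _ (hu hxy), fun x y hxy => h.upper _ _ (hv hxy),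
    fun x y => h.entry _ _, fun x y => h.mem _ _, ?_, ?_, ?_⟩
  · intro x hx
    obtain ⟨y, hy⟩ := h.exists_col _ hx
    obtain ⟨y', rfl⟩ := (huv _ _ (by rw [hy]; exact one_ne_zero)).mp ⟨x, rfl⟩
    exact ⟨y', hy⟩
  · intro y hy
    obtain ⟨x, hx⟩ := h.exists_row _ hy
    obtain ⟨x', rfl⟩ := (huv _ _ (by rw [hx]; exact one_ne_zero)).mpr ⟨y, rfl⟩
    exact ⟨x', hx⟩
  · intro x y x' y' h1 h2
    rw [← hu.lt_iff_lt, ← hv.lt_iff_lt]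
    exact h.lt_iff _ _ _ _ h1 h2

/-- The entry at `(x, y)` is the only nonzero one in its row and in its column, so the `(x, y)`
entries of the two products are `P x x` and `Q y y`. -/
theorem diag_eq (h : ZeroOneCoded A U W) {P : Matrix α α k} {Q : Matrix β β k}
    (hPQ : P * A = A * Q) {x : α} {y : β} (hxy : A x y ≠ 0) : P x x = Q y y := by
  have h1 : A x y = 1 := (h.entry x y).resolve_left hxy
  have h2 := congrFun (congrFun hPQ x) y
  rw [mul_apply, mul_apply, Finset.sum_eq_single x, Finset.sum_eq_single y] at h2
  · simpa [h1] using h2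
  · intro z _ hz
    rw [(h.entry x z).resolve_right fun e => hz (h.col_inj e h1), zero_mul]
  · simp
  · intro z _ hz
    rw [(h.entry z y).resolve_right fun e => hz (h.row_inj e h1), mul_zero]
  · simp

end ZeroOneCoded

/-- The rows and the columns of a matrix of the form `[0 I; 0 0]` can be labelled such that the
nonzero entries are in the places with equal labels. -/
theorem IsZeroOneForm.exists_labels {A : Matrix α β k} (h : IsZeroOneForm A) :
    ∃ (F : α → ℤ) (G : β → ℤ), F.Injective ∧ G.Injective ∧ ∀ x y, A x y ≠ 0 → F x = G y := by
  obtain ⟨ρ, m, n, e, f, h⟩ := h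
  -- Matched rows and columns share the labels `0, …, ρ - 1`. The other rows continue from `ρ`, and
  -- the other columns get negative labels.
  let F : Fin ρ ⊕ Fin m → ℤ := Sum.elim (fun p => (p : ℤ)) (fun p => (ρ + p : ℤ))
  let G : Fin n ⊕ Fin ρ → ℤ := Sum.elim (fun p => (-1 - p : ℤ)) (fun p => (p : ℤ))
  have hF : F.Injective := by
    rintro (a | a) (c | c) hac <;> simp only [F, Sum.elim_inl, Sum.elim_inr] at hac
    · congr 1; ext; omega
    · omega
    · omega
    · congr 1; ext; omega
  have hG : G.Injective := by
    rintro (a | a) (c | c) hac <;> simp only [G, Sum.elim_inl, Sum.elim_inr] at hac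
    · congr 1; ext; omega
    · omega
    · omega
    · congr 1; ext; omega
  refine ⟨fun x => F (ofLex (e x)), fun y => G (ofLex (f y)),
    hF.comp (ofLex.injective.comp e.injective), hG.comp (ofLex.injective.comp f.injective), ?_⟩
  intro x y hxy
  rw [h] at hxy
  dsimp only
  generalize (ofLex (e x) : Fin ρ ⊕ Fin m) = a at *
  generalize (ofLex (f y) : Fin n ⊕ Fin ρ) = c at *
  rcases a with a | a <;> rcases c with c | c <;> simp [one_apply] at hxy
  simp [F, G, hxy]

theorem rank_fromBlocks_one (ρ m n : ℕ) :
    (fromBlocks 0 1 0 0 : Matrix (Fin ρ ⊕ Fin m) (Fin n ⊕ Fin ρ) k).rank = ρ := by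
  apply le_antisymm
  · have : (fromBlocks 0 1 0 0 : Matrix (Fin ρ ⊕ Fin m) (Fin n ⊕ Fin ρ) k) =
        (fromRows 1 0 : Matrix (Fin ρ ⊕ Fin m) (Fin ρ) k) *
          (fromCols 0 1 : Matrix (Fin ρ) (Fin n ⊕ Fin ρ) k) := by
      rw [fromRows_mul_fromCols]
      simp
    rw [this]
    refine (rank_mul_le_left _ _).trans ((rank_le_card_width _).trans (by simp))
  · have : (1 : Matrix (Fin ρ) (Fin ρ) k) =
        (fromCols 1 0 : Matrix (Fin ρ) (Fin ρ ⊕ Fin m) k) *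
        (fromBlocks 0 1 0 0 : Matrix (Fin ρ ⊕ Fin m) (Fin n ⊕ Fin ρ) k) *
        (fromRows 0 1 : Matrix (Fin n ⊕ Fin ρ) (Fin ρ) k) := by
      rw [fromCols_mul_fromBlocks, fromCols_mul_fromRows]
      simp
    calc ρ = (1 : Matrix (Fin ρ) (Fin ρ) k).rank := by rw [rank_one]; simp
      _ ≤ _ := by
        conv_lhs => rw [this]
        exact (rank_mul_le_left _ _).trans (rank_mul_le_right _ _)

theorem rank_eq_of_mul_eq {P : Matrix α α k} {Q : Matrix β β k} (hP : IsUnit P) (hQ : IsUnit Q)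
    {A A' : Matrix α β k} (h : P * A' = A * Q) : A.rank = A'.rank := by
  rw [← rank_mul_eq_left_of_isUnit_det Q A ((Matrix.isUnit_iff_isUnit_det Q).mp hQ), ← h,
    rank_mul_eq_right_of_isUnit_det P A' ((Matrix.isUnit_iff_isUnit_det P).mp hP)]

/-- The rank gives `ρ`, the numbers of rows and columns give `m` and `n`, and an order isomorphism
between finite linear orders is unique. -/
theorem IsZeroOneForm.eq_of_equiv {P : Matrix α α k} {Q : Matrix β β k} (hP : IsUnit P)
    (hQ : IsUnit Q) {A A' : Matrix α β k} (h : P * A' = A * Q) (hA : IsZeroOneForm A)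
    (hA' : IsZeroOneForm A') : A = A' := by
  have hr := rank_eq_of_mul_eq hP hQ h
  obtain ⟨ρ, m, n, e, f, hA⟩ := hA
  obtain ⟨ρ', m', n', e', f', hA'⟩ := hA'
  have h1 : A = (fromBlocks 0 1 0 0 : Matrix (Fin ρ ⊕ Fin m) (Fin n ⊕ Fin ρ) k).submatrix
      (e.toEquiv.trans ofLex) (f.toEquiv.trans ofLex) := by
    ext x y
    exact hA x y
  have h2 : A' = (fromBlocks 0 1 0 0 : Matrix (Fin ρ' ⊕ Fin m') (Fin n' ⊕ Fin ρ') k).submatrix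
      (e'.toEquiv.trans ofLex) (f'.toEquiv.trans ofLex) := by
    ext x y
    exact hA' x y
  have hρ : ρ = ρ' := by
    rw [h1, h2, rank_submatrix, rank_submatrix, rank_fromBlocks_one, rank_fromBlocks_one] at hr
    exact hr
  subst hρ
  have c1 : Fintype.card α = ρ + m := by
    rw [Fintype.card_congr (e.toEquiv.trans ofLex)]; simp
  have c1' : Fintype.card α = ρ + m' := by
    rw [Fintype.card_congr (e'.toEquiv.trans ofLex)]; simp
  have c2 : Fintype.card β = n + ρ := by
    rw [Fintype.card_congr (f.toEquiv.trans ofLex)]; simp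
  have c2' : Fintype.card β = n' + ρ := by
    rw [Fintype.card_congr (f'.toEquiv.trans ofLex)]; simp
  obtain rfl : m = m' := by omega
  obtain rfl : n = n' := by omega
  rw [h1, h2, Subsingleton.elim e e', Subsingleton.elim f f']

end ZeroOne

/-! ### Weyr matrices -/

/-- The codes of the rows of Weyr matrices: `(λ, j, p)` is the `p`-th row in the `j`-th strip of the
direct summand with eigenvalue `λ`. -/
abbrev Code (k : Type*) : Type _ := k ×ₗ (ℕ ×ₗ ℕ)

namespace Code

variable {k : Type*}

/-- The code `(a, j, p)`. -/
def mk (a : k) (j p : ℕ) : Code k := toLex (a, toLex (j, p))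

theorem exists_mk (c : Code k) : ∃ a j p, c = mk a j p := ⟨_, _, _, rfl⟩

theorem mk_inj {a a' : k} {j j' p p' : ℕ} :
    mk a j p = mk a' j' p' ↔ a = a' ∧ j = j' ∧ p = p' := by
  unfold mk
  rw [toLex_inj, Prod.mk.injEq, toLex_inj, Prod.mk.injEq]

theorem mk_lt_mk [LinearOrder k] {a a' : k} {j j' p p' : ℕ} :
    mk a j p < mk a' j' p' ↔ a < a' ∨ a = a' ∧ (j < j' ∨ j = j' ∧ p < p') := by
  unfold mk
  rw [Prod.Lex.toLex_lt_toLex]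
  dsimp only
  rw [Prod.Lex.toLex_lt_toLex]

end Code

open Classical in
/-- The entry of a Weyr matrix whose row and column have the given codes. -/
noncomputable def weyrEntry {k : Type*} [Field k] (c d : Code k) : k :=
  if c = d then (ofLex c).1
  else if ∃ a j p, c = Code.mk a j p ∧ d = Code.mk a (j + 1) p then 1 else 0

theorem weyrEntry_mk {k : Type*} [Field k] [DecidableEq k] (a a' : k) (j j' p p' : ℕ) :
    weyrEntry (Code.mk a j p) (Code.mk a' j' p') =
      if a = a' ∧ j = j' ∧ p = p' then a else if a = a' ∧ j + 1 = j' ∧ p = p' then 1 else 0 := by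
  classical
  unfold weyrEntry
  have h2 : (∃ b i q, Code.mk a j p = Code.mk b i q ∧ Code.mk a' j' p' = Code.mk b (i + 1) q) ↔
      (a = a' ∧ j + 1 = j' ∧ p = p') := by
    constructor
    · rintro ⟨b, i, q, h1, h2⟩
      rw [Code.mk_inj] at h1 h2
      obtain ⟨rfl, rfl, rfl⟩ := h1
      obtain ⟨rfl, rfl, rfl⟩ := h2
      simp
    · rintro ⟨rfl, rfl, rfl⟩
      exact ⟨_, _, _, rfl, rfl⟩
  simp only [h2]
  simp only [Code.mk_inj]
  congr

/-- An order isomorphism is compatible with strictly monotone functions that have the same range. -/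
theorem _root_.StrictMono.comp_orderIso {α β γ : Type*} [LinearOrder α] [LinearOrder β]
    [PartialOrder γ] [WellFoundedLT α] {g : α → γ} {h : β → γ} (hg : StrictMono g)
    (hh : StrictMono h) (hr : Set.range g = Set.range h) (θ : α ≃o β) : h ∘ θ = g :=
  ((hh.comp θ.strictMono).range_inj hg).mp (by rw [θ.surjective.range_comp, hr])

/-- Order isomorphism between linear orders with strictly monotone functions of the same range. -/
theorem _root_.StrictMono.exists_orderIso {α β γ : Type*} [LinearOrder α] [LinearOrder β]
    [LinearOrder γ] {g : α → γ} {h : β → γ} (hg : StrictMono g) (hh : StrictMono h)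
    (hr : Set.range g = Set.range h) : ∃ θ : α ≃o β, ∀ x, h (θ x) = g x := by
  have h1 : ∀ x, ∃ y, h y = g x := fun x => by
    have : g x ∈ Set.range h := hr ▸ ⟨x, rfl⟩
    exact this
  choose θ hθ using h1
  have hm : StrictMono θ := fun x y hxy => by
    rw [← hh.lt_iff_lt, hθ, hθ]
    exact hg hxy
  have hs : Function.Surjective θ := fun y => by
    have : h y ∈ Set.range g := hr ▸ ⟨y, rfl⟩
    obtain ⟨x, hx⟩ := this
    exact ⟨x, hh.injective ((hθ x).trans hx)⟩
  exact ⟨hm.orderIsoOfSurjective θ hs, hθ⟩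

section Weyr

variable {k α β : Type*} [Field k] [LinearOrder k] [Fintype α] [LinearOrder α] [Fintype β]
  [LinearOrder β]

/-- The rows and columns of the matrix `A` are coded by `g` and `h` such that `A` is a Weyr matrix. -/
structure WeyrCoded (A : Matrix α β k) (g : α → Code k) (h : β → Code k) : Prop where
  mono_row : StrictMono g
  mono_col : StrictMono h
  range_eq : Set.range g = Set.range h
  closed : ∀ a j p j' p', Code.mk a j p ∈ Set.range g → j' ≤ j → p' ≤ p →
    Code.mk a j' p' ∈ Set.range g
  entry : ∀ x y, A x y = weyrEntry (g x) (h y)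

/-- The code of an index of a Weyr matrix. -/
def weyrCode {s : ℕ} {κ : Fin s → ℕ} {m : ∀ i, Fin (κ i) → ℕ} (lam : Fin s → k)
    (z : WeyrIdx s κ m) : Code k :=
  Code.mk (lam (ofLex z).1) ((ofLex (ofLex z).2).1 : ℕ) ((ofLex (ofLex z).2).2 : ℕ)

theorem weyrCode_strictMono {s : ℕ} {κ : Fin s → ℕ} {m : ∀ i, Fin (κ i) → ℕ} {lam : Fin s → k}
    (hl : StrictMono lam) : StrictMono (weyrCode (κ := κ) (m := m) lam) := by
  intro x y hxy
  unfold weyrCode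
  rw [Code.mk_lt_mk]
  rcases hxy with ⟨_, _, h⟩ | ⟨_, _, h⟩
  · exact Or.inl (hl h)
  · rcases h with ⟨_, _, h⟩ | ⟨_, _, h⟩
    · exact Or.inr ⟨rfl, Or.inl h⟩
    · exact Or.inr ⟨rfl, Or.inr ⟨rfl, h⟩⟩

theorem weyrMatrix_eq {s : ℕ} {κ : Fin s → ℕ} {m : ∀ i, Fin (κ i) → ℕ} {lam : Fin s → k}
    (hl : StrictMono lam) (z w : WeyrIdx s κ m) :
    weyrMatrix lam κ m z w = weyrEntry (weyrCode lam z) (weyrCode lam w) := by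
  by_cases h : z = w
  · subst h
    simp [weyrMatrix, weyrEntry, weyrCode, Code.mk]
  · have h1 := (weyrCode_strictMono hl).injective.ne h
    rw [weyrCode, weyrCode, Ne, Code.mk_inj] at h1
    rw [weyrCode, weyrCode, weyrEntry_mk, if_neg h1, weyrMatrix, if_neg h]
    simp only [hl.injective.eq_iff]

/-- A Weyr matrix is recorded by the set of its codes `(λ, j, p)`. The inequalities between the
`m_{ij}` become closure of this set under decreasing `j` and `p`. -/
theorem IsWeyr.coded {A : Matrix α β k} (h : IsWeyr A) : ∃ g h, WeyrCoded A g h := by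
  classical
  obtain ⟨s, lam, κ, m, e, f, hl, hm, hA⟩ := h
  let c : WeyrIdx s κ m → Code k := weyrCode lam
  have hc : StrictMono c := weyrCode_strictMono hl
  have hr1 : Set.range (c ∘ e) = Set.range c := e.surjective.range_comp c
  have hr2 : Set.range (c ∘ f) = Set.range c := f.surjective.range_comp c
  refine ⟨c ∘ e, c ∘ f, hc.comp e.strictMono, hc.comp f.strictMono, hr1.trans hr2.symm, ?_, ?_⟩
  · rw [hr1]
    rintro a j p j' p' ⟨⟨i, ⟨q, w⟩⟩, hz⟩ hj hp
    have h1 := Code.mk_inj.mp hz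
    obtain ⟨rfl, rfl, rfl⟩ := h1
    have hw : p' < m i ⟨j', lt_of_le_of_lt hj q.2⟩ :=
      lt_of_le_of_lt hp (lt_of_lt_of_le w.2 (hm i (Fin.mk_le_of_le_val hj)))
    exact ⟨toLex ⟨i, toLex ⟨⟨j', lt_of_le_of_lt hj q.2⟩, ⟨p', hw⟩⟩⟩, rfl⟩
  · intro x y
    rw [hA, weyrMatrix_eq hl]
    rfl

/-- The counting function grows by at most one at each step, and only at elements of `s`, so it
skips no value. -/
theorem _root_.Nat.exists_count_eq {s : ℕ → Prop} [DecidablePred s] {p q : ℕ}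
    (h : q < Nat.count s p) : ∃ n < p, s n ∧ Nat.count s n = q := by
  induction p with
  | zero => simp at h
  | succ p ih =>
    rw [Nat.count_succ] at h
    by_cases hq : q < Nat.count s p
    · obtain ⟨n, h1, h2⟩ := ih hq
      exact ⟨n, h1.trans (Nat.lt_succ_self p), h2⟩
    · split_ifs at h with hs
      · exact ⟨p, Nat.lt_succ_self p, hs, by omega⟩
      · omega

theorem mem_iff_lt_card {S : Finset ℕ} (hS : ∀ p q, p ∈ S → q ≤ p → q ∈ S) (p : ℕ) :
    p ∈ S ↔ p < S.card := by
  have h : S = Finset.range S.card := by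
    refine Finset.eq_of_subset_of_card_le ?_ (by simp)
    intro q hq
    rw [Finset.mem_range]
    have : Finset.range (q + 1) ⊆ S := fun i hi =>
      hS q i hq (Nat.lt_succ_iff.mp (Finset.mem_range.mp hi))
    simpa using Finset.card_le_card this
  conv_lhs => rw [h]
  simp

namespace WeyrCoded

variable {A : Matrix α β k} {g : α → Code k} {h : β → Code k}

theorem isWeyr (hA : WeyrCoded A g h) : IsWeyr A := by
  classical
  let L : Finset k := Finset.univ.image fun x => (ofLex (g x)).1
  -- `N` exceeds all strip numbers. Every eigenvalue is given `N` strips, those past its last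
  -- nonempty one having size zero.
  let N : ℕ := Finset.univ.sup (fun x => (ofLex (ofLex (g x)).2).1) + 1
  let S : k → ℕ → Finset ℕ := fun a j =>
    (Finset.univ.image fun x => (ofLex (ofLex (g x)).2).2).filter
      fun p => Code.mk a j p ∈ Set.range g
  have hS : ∀ a j p, p ∈ S a j ↔ Code.mk a j p ∈ Set.range g := by
    intro a j p
    simp only [S, Finset.mem_filter, Finset.mem_image, Finset.mem_univ, true_and,
      and_iff_right_iff_imp]
    rintro ⟨x, hx⟩
    exact ⟨x, by rw [hx]; rfl⟩
  have hS' : ∀ a j p, p < (S a j).card ↔ Code.mk a j p ∈ Set.range g := by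
    intro a j p
    rw [← mem_iff_lt_card, hS]
    intro p q hp hq
    rw [hS] at hp ⊢
    exact hA.closed _ _ _ _ _ hp le_rfl hq
  let lam : Fin L.card → k := L.orderEmbOfFin rfl
  have hl : StrictMono lam := (L.orderEmbOfFin rfl).strictMono
  let m : ∀ _ : Fin L.card, Fin N → ℕ := fun i j => (S (lam i) j).card
  let c : WeyrIdx L.card (fun _ => N) m → Code k := weyrCode lam
  have hc : StrictMono c := weyrCode_strictMono hl
  have hr : Set.range g = Set.range c := by
    ext d
    constructor
    · rintro ⟨x, rfl⟩
      obtain ⟨a, j, p, hx⟩ := Code.exists_mk (g x)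
      have ha : a ∈ Set.range lam := by
        rw [Finset.range_orderEmbOfFin]
        exact Finset.mem_image.mpr ⟨x, Finset.mem_univ _, by rw [hx]; rfl⟩
      obtain ⟨i, rfl⟩ := ha
      have hj : j < N := by
        refine Nat.lt_succ_of_le ?_
        have := Finset.le_sup (f := fun x => (ofLex (ofLex (g x)).2).1) (Finset.mem_univ x)
        rw [hx] at this
        exact this
      have hp : p < m i ⟨j, hj⟩ := (hS' _ _ _).mpr ⟨x, hx⟩
      exact ⟨toLex ⟨i, toLex ⟨⟨j, hj⟩, ⟨p, hp⟩⟩⟩, hx.symm⟩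
    · rintro ⟨⟨i, ⟨j, p⟩⟩, rfl⟩
      exact (hS' _ _ _).mp p.2
  obtain ⟨e, he⟩ := hA.mono_row.exists_orderIso hc hr
  obtain ⟨f, hf⟩ := hA.mono_col.exists_orderIso hc (hA.range_eq.symm.trans hr)
  refine ⟨L.card, lam, fun _ => N, m, e, f, hl, ?_, ?_⟩
  · intro i j j' hj
    refine Finset.card_le_card fun p hp => ?_
    rw [hS] at hp ⊢
    exact hA.closed _ _ _ _ _ hp hj le_rfl
  · intro x y
    rw [hA.entry, ← he, ← hf, weyrMatrix_eq hl]

/-- The code sets of rows and columns coincide, so after identifying columns with rows along the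
order isomorphism one coding serves both. -/
theorem submatrix_iso (hA : WeyrCoded A g h) (θ : α ≃o β) :
    WeyrCoded (A.submatrix id θ) g g := by
  have h1 := hA.mono_row.comp_orderIso hA.mono_col hA.range_eq θ
  refine ⟨hA.mono_row, hA.mono_row, rfl, hA.closed, fun x y => ?_⟩
  rw [submatrix_apply, hA.entry, ← congrFun h1 y]
  rfl

theorem entry_ne_zero (hA : WeyrCoded A g h) {x : α} {y : β} (hxy : A x y ≠ 0) :
    g x = h y ∨ ∃ a j p, g x = Code.mk a j p ∧ h y = Code.mk a (j + 1) p := by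
  rw [hA.entry, weyrEntry] at hxy
  by_contra hn
  rw [not_or] at hn
  rw [if_neg hn.1, if_neg hn.2] at hxy
  exact hxy rfl

/-- The codes `(a, 0, p), (a, 1, p), …` form a Jordan chain. The two hypotheses together force whole
chains to be kept or deleted, and the kept chains of each eigenvalue are renumbered. The condition
on equal codes is needed separately because the diagonal entries vanish for the eigenvalue 0. -/
theorem submatrix {α' β' : Type*} [LinearOrder α'] [LinearOrder β'] (hA : WeyrCoded A g h)
    {u : α' → α} {v : β' → β} (hu : StrictMono u) (hv : StrictMono v)
    (huv : ∀ x y, g x = h y → (x ∈ Set.range u ↔ y ∈ Set.range v))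
    (huv' : ∀ x y, A x y ≠ 0 → (x ∈ Set.range u ↔ y ∈ Set.range v)) :
    ∃ g' h', WeyrCoded (A.submatrix u v) g' h' := by
  classical
  let sel : k → ℕ → Prop := fun a p => ∃ x ∈ Set.range u, g x = Code.mk a 0 p
  have hsel : ∀ j a p x, g x = Code.mk a j p → (x ∈ Set.range u ↔ sel a p) := by
    intro j
    induction j with
    | zero =>
      intro a p x hx
      refine ⟨fun h => ⟨x, h, hx⟩, ?_⟩
      rintro ⟨x', h1, h2⟩
      rwa [hA.mono_row.injective (hx.trans h2.symm)]
    | succ j ih =>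
      intro a p x hx
      obtain ⟨x', hx'⟩ := hA.closed a (j + 1) p j p ⟨x, hx⟩ (Nat.le_succ j) le_rfl
      obtain ⟨y, hy⟩ : Code.mk a (j + 1) p ∈ Set.range h := hA.range_eq ▸ ⟨x, hx⟩
      -- The row `x'` precedes `x` in its chain, and its entry in the column `y` with the code of
      -- `x` is 1.
      rw [huv x y (hx.trans hy.symm), ← ih a p x' hx', huv' x' y]
      rw [hA.entry, hx', hy, weyrEntry_mk]
      simp
  have hsel' : ∀ j a p y, h y = Code.mk a j p → (y ∈ Set.range v ↔ sel a p) := by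
    intro j a p y hy
    obtain ⟨x, hx⟩ : Code.mk a j p ∈ Set.range g := hA.range_eq ▸ ⟨y, hy⟩
    rw [← huv x y (hx.trans hy.symm), hsel j a p x hx]
  -- The chain number `p` becomes the number of kept chains before it; eigenvalue and strip number
  -- stay.
  let T : Code k → Code k := fun c =>
    Code.mk (ofLex c).1 (ofLex (ofLex c).2).1
      (Nat.count (sel (ofLex c).1) (ofLex (ofLex c).2).2)
  have hT : ∀ a j p, T (Code.mk a j p) = Code.mk a j (Nat.count (sel a) p) := fun _ _ _ => rfl
  have hTlt : ∀ a j p a' j' p', sel a p → Code.mk a j p < Code.mk a' j' p' →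
      T (Code.mk a j p) < T (Code.mk a' j' p') := by
    intro a j p a' j' p' hs hlt
    rw [hT, hT, Code.mk_lt_mk]
    rw [Code.mk_lt_mk] at hlt
    rcases hlt with hlt | ⟨rfl, hlt | ⟨rfl, hlt⟩⟩
    · exact Or.inl hlt
    · exact Or.inr ⟨rfl, Or.inl hlt⟩
    · exact Or.inr ⟨rfl, Or.inr ⟨rfl, Nat.count_strict_mono hs hlt⟩⟩
  have hmu : StrictMono (T ∘ g ∘ u) := by
    intro x y hxy
    have h1 := hA.mono_row (hu hxy)
    obtain ⟨a, j, p, e1⟩ := Code.exists_mk (g (u x))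
    obtain ⟨a', j', p', e2⟩ := Code.exists_mk (g (u y))
    simp only [Function.comp]
    rw [e1, e2] at h1 ⊢
    exact hTlt _ _ _ _ _ _ ((hsel _ _ _ _ e1).mp ⟨x, rfl⟩) h1
  have hmv : StrictMono (T ∘ h ∘ v) := by
    intro x y hxy
    have h1 := hA.mono_col (hv hxy)
    obtain ⟨a, j, p, e1⟩ := Code.exists_mk (h (v x))
    obtain ⟨a', j', p', e2⟩ := Code.exists_mk (h (v y))
    simp only [Function.comp]
    rw [e1, e2] at h1 ⊢
    exact hTlt _ _ _ _ _ _ ((hsel' _ _ _ _ e1).mp ⟨x, rfl⟩) h1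
  refine ⟨T ∘ g ∘ u, T ∘ h ∘ v, hmu, hmv, ?_, ?_, ?_⟩
  · ext c
    constructor
    · rintro ⟨x, rfl⟩
      have h1 : g (u x) ∈ Set.range h := hA.range_eq ▸ ⟨u x, rfl⟩
      obtain ⟨y, hy⟩ := h1
      obtain ⟨y', rfl⟩ := (huv _ _ hy.symm).mp ⟨x, rfl⟩
      exact ⟨y', by simp only [Function.comp, hy]⟩
    · rintro ⟨y, rfl⟩
      have h1 : h (v y) ∈ Set.range g := hA.range_eq ▸ ⟨v y, rfl⟩
      obtain ⟨x, hx⟩ := h1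
      obtain ⟨x', rfl⟩ := (huv _ _ hx).mpr ⟨y, rfl⟩
      exact ⟨x', by simp only [Function.comp, hx]⟩
  · rintro a j p j' p' ⟨x, hx⟩ hj hp
    obtain ⟨a₀, j₀, p₀, e⟩ := Code.exists_mk (g (u x))
    simp only [Function.comp] at hx
    rw [e, hT, Code.mk_inj] at hx
    obtain ⟨rfl, rfl, rfl⟩ := hx
    have hs : sel a₀ p₀ := (hsel _ _ _ _ e).mp ⟨x, rfl⟩
    -- Here `q` is the old number of the kept chain whose new number is `p'`.
    obtain ⟨q, hq1, hq2, hq3⟩ : ∃ q, q ≤ p₀ ∧ sel a₀ q ∧ Nat.count (sel a₀) q = p' := by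
      rcases hp.eq_or_lt with rfl | hlt
      · exact ⟨p₀, le_rfl, hs, rfl⟩
      · obtain ⟨q, hq, hq'⟩ := Nat.exists_count_eq hlt
        exact ⟨q, hq.le, hq'⟩
    obtain ⟨x₁, hx₁⟩ := hA.closed a₀ j₀ p₀ j' q ⟨_, e⟩ hj hq1
    obtain ⟨x₂, rfl⟩ := (hsel _ _ _ _ hx₁).mpr hq2
    exact ⟨x₂, by simp only [Function.comp]; rw [hx₁, hT, hq3]⟩
  · intro x y
    obtain ⟨a, j, p, e1⟩ := Code.exists_mk (g (u x))
    obtain ⟨a', j', p', e2⟩ := Code.exists_mk (h (v y))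
    have hs := (hsel _ _ _ _ e1).mp ⟨x, rfl⟩
    have hs' := (hsel' _ _ _ _ e2).mp ⟨y, rfl⟩
    rw [submatrix_apply, hA.entry]
    simp only [Function.comp]
    rw [e1, e2, hT, hT, weyrEntry_mk, weyrEntry_mk]
    by_cases ha : a = a'
    · subst ha
      have : Nat.count (sel a) p = Nat.count (sel a) p' ↔ p = p' :=
        ⟨fun h => Nat.count_injective hs hs' h, fun h => h ▸ rfl⟩
      simp only [this]
    · simp [ha]

end WeyrCoded
end Weyr

/-! ### Similar Weyr matrices are equal; their centralizers -/

section WeyrUniqueness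

variable {k α β : Type*} [Field k] [LinearOrder k] [Fintype α] [LinearOrder α] [Fintype β]
  [LinearOrder β]

/-- The extension by zero of a vector to the set of all codes. -/
def codeLift (g : α → Code k) (v : α → k) (c : Code k) : k := ∑ x, if g x = c then v x else 0

theorem codeLift_apply {g : α → Code k} (hg : g.Injective) (v : α → k) (x : α) :
    codeLift g v (g x) = v x := by
  unfold codeLift
  rw [Finset.sum_eq_single x]
  · simp
  · intro y _ hy
    rw [if_neg (hg.ne hy)]
  · simp

theorem codeLift_eq_zero {g : α → Code k} {v : α → k} {c : Code k}
    (h : ∀ x, g x = c → v x = 0) : codeLift g v c = 0 :=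
  Finset.sum_eq_zero fun x _ => by
    split_ifs with hx
    · exact h x hx
    · rfl

theorem weyrEntry_mk_left (a : k) (j p : ℕ) (c : Code k) :
    weyrEntry (Code.mk a j p) c =
      (if c = Code.mk a j p then a else 0) + if c = Code.mk a (j + 1) p then 1 else 0 := by
  obtain ⟨a', j', p', rfl⟩ := Code.exists_mk c
  rw [weyrEntry_mk]
  simp only [Code.mk_inj]
  by_cases h : a = a' ∧ j = j' ∧ p = p'
  · obtain ⟨rfl, rfl, rfl⟩ := h
    simp
  · rw [if_neg h, if_neg (c := a' = a ∧ j' = j ∧ p' = p)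
      (fun e => h ⟨e.1.symm, e.2.1.symm, e.2.2.symm⟩), zero_add]
    congr 1
    simp only [eq_comm]

namespace WeyrCoded

variable {A A' : Matrix α α k} {g g' : α → Code k}

/-- In codes, `A` is the eigenvalue plus a shift of `j`. The formula also holds off the range of
`g`, because by closure a missing `(a, j, p)` entails a missing `(a, j + 1, p)`. -/
theorem codeLift_mulVec (hA : WeyrCoded A g g) (v : α → k) (a : k) (j p : ℕ) :
    codeLift g (A *ᵥ v) (Code.mk a j p) =
      a * codeLift g v (Code.mk a j p) + codeLift g v (Code.mk a (j + 1) p) := by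
  by_cases h : Code.mk a j p ∈ Set.range g
  · obtain ⟨x, hx⟩ := h
    rw [← hx, codeLift_apply hA.mono_row.injective, mulVec, dotProduct]
    simp only [codeLift, Finset.mul_sum]
    rw [← Finset.sum_add_distrib]
    refine Finset.sum_congr rfl fun y _ => ?_
    rw [hA.entry, hx, weyrEntry_mk_left]
    simp only [add_mul, ite_mul, mul_ite, zero_mul, one_mul, mul_zero]
  · rw [codeLift_eq_zero fun x hx => absurd ⟨x, hx⟩ h,
      codeLift_eq_zero fun x hx => absurd ⟨x, hx⟩ h, codeLift_eq_zero, mul_zero, add_zero]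
    intro x hx
    exact absurd (hA.closed a (j + 1) p j p ⟨x, hx⟩ (Nat.le_succ j) le_rfl) h

theorem codeLift_sub_mulVec (hA : WeyrCoded A g g) (v : α → k) (c a : k) (j p : ℕ) :
    codeLift g ((A - c • (1 : Matrix α α k)) *ᵥ v) (Code.mk a j p) =
      (a - c) * codeLift g v (Code.mk a j p) + codeLift g v (Code.mk a (j + 1) p) := by
  have h1 : codeLift g ((A - c • (1 : Matrix α α k)) *ᵥ v) (Code.mk a j p) =
      codeLift g (A *ᵥ v) (Code.mk a j p) - c * codeLift g v (Code.mk a j p) := by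
    simp only [codeLift, Finset.mul_sum]
    rw [← Finset.sum_sub_distrib]
    refine Finset.sum_congr rfl fun y _ => ?_
    rw [sub_mulVec, smul_mulVec, one_mulVec]
    split_ifs <;> simp
  rw [h1, hA.codeLift_mulVec]
  ring

theorem codeLift_pow_self (hA : WeyrCoded A g g) (v : α → k) (c : k) (d j p : ℕ) :
    codeLift g ((A - c • (1 : Matrix α α k)) ^ d *ᵥ v) (Code.mk c j p) =
      codeLift g v (Code.mk c (j + d) p) := by
  induction d generalizing j with
  | zero => simp
  | succ d ih =>
    rw [pow_succ', ← mulVec_mulVec, hA.codeLift_sub_mulVec, ih, ih, sub_self, zero_mul, zero_add]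
    congr 2
    omega

/-- For `a ≠ c` the matrix `A - c` is invertible on the part with eigenvalue `a`: back substitution
starts at a strip number `N` beyond all occurring ones. -/
theorem codeLift_sub_eq_zero_iff (hA : WeyrCoded A g g) (v : α → k) {c a : k} (hac : a ≠ c) :
    (∀ j p, codeLift g ((A - c • (1 : Matrix α α k)) *ᵥ v) (Code.mk a j p) = 0) ↔
      ∀ j p, codeLift g v (Code.mk a j p) = 0 := by
  constructor
  · intro h
    let N : ℕ := Finset.univ.sup (fun x => (ofLex (ofLex (g x)).2).1) + 1
    have key : ∀ n j p, N ≤ j + n → codeLift g v (Code.mk a j p) = 0 := by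
      intro n
      induction n with
      | zero =>
        intro j p hj
        refine codeLift_eq_zero fun x hx => absurd hj ?_
        have := Finset.le_sup (f := fun x => (ofLex (ofLex (g x)).2).1) (Finset.mem_univ x)
        rw [hx] at this
        exact not_le.mpr (Nat.lt_succ_of_le this)
      | succ n ih =>
        intro j p hj
        have h1 := h j p
        rw [hA.codeLift_sub_mulVec, ih (j + 1) p (by omega), add_zero] at h1
        exact (mul_eq_zero.mp h1).resolve_left (sub_ne_zero.mpr hac)
    exact fun j p => key N j p (by omega)
  · intro h j p
    rw [hA.codeLift_sub_mulVec, h, h, mul_zero, add_zero]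

theorem codeLift_pow_eq_zero_iff (hA : WeyrCoded A g g) (v : α → k) {c a : k} (hac : a ≠ c)
    (d : ℕ) : (∀ j p, codeLift g ((A - c • (1 : Matrix α α k)) ^ d *ᵥ v) (Code.mk a j p) = 0) ↔
      ∀ j p, codeLift g v (Code.mk a j p) = 0 := by
  induction d with
  | zero => simp
  | succ d ih => rw [← ih, pow_succ', ← mulVec_mulVec, hA.codeLift_sub_eq_zero_iff _ hac]

/-- On the eigenvalue `c` the power shifts `j` by `d`, and on the others it is injective. Hence its
kernel is the coordinate subspace of the codes with eigenvalue `c` and `j < d`. -/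
theorem pow_mulVec_eq_zero_iff (hA : WeyrCoded A g g) (c : k) (d : ℕ) (v : α → k) :
    (A - c • (1 : Matrix α α k)) ^ d *ᵥ v = 0 ↔
      ∀ x, ¬ ((ofLex (g x)).1 = c ∧ (ofLex (ofLex (g x)).2).1 < d) → v x = 0 := by
  have hinj := hA.mono_row.injective
  constructor
  · intro h x hx
    obtain ⟨a, j, p, e⟩ := Code.exists_mk (g x)
    rw [e] at hx
    have h0 : ∀ a j p, codeLift g ((A - c • (1 : Matrix α α k)) ^ d *ᵥ v) (Code.mk a j p) = 0 :=
      fun a j p => by rw [h]; exact codeLift_eq_zero fun _ _ => rfl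
    rw [← codeLift_apply hinj v x, e]
    by_cases hac : a = c
    · subst hac
      have hd : d ≤ j := not_lt.mp fun hlt => hx ⟨rfl, hlt⟩
      have h1 := h0 a (j - d) p
      rwa [hA.codeLift_pow_self, Nat.sub_add_cancel hd] at h1
    · exact (hA.codeLift_pow_eq_zero_iff v hac d).mp (h0 a) j p
  · intro h
    ext x
    obtain ⟨a, j, p, e⟩ := Code.exists_mk (g x)
    rw [← codeLift_apply hinj ((A - c • (1 : Matrix α α k)) ^ d *ᵥ v) x, e, Pi.zero_apply]
    by_cases hac : a = c
    · subst hac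
      rw [hA.codeLift_pow_self]
      refine codeLift_eq_zero fun y hy => h y ?_
      rw [hy]
      exact fun hlt => absurd hlt.2 (not_lt.mpr (Nat.le_add_left d j))
    · refine (hA.codeLift_pow_eq_zero_iff v hac d).mpr ?_ j p
      intro j p
      refine codeLift_eq_zero fun y hy => h y ?_
      rw [hy]
      exact fun hlt => hac hlt.1

open Classical in
theorem card_eq_sub_rank (hA : WeyrCoded A g g) (c : k) (d : ℕ) :
    Fintype.card {x // (ofLex (g x)).1 = c ∧ (ofLex (ofLex (g x)).2).1 < d} =
      Fintype.card α - ((A - c • (1 : Matrix α α k)) ^ d).rank := by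
  let T : Set α := {x | (ofLex (g x)).1 = c ∧ (ofLex (ofLex (g x)).2).1 < d}
  have hker : LinearMap.ker ((A - c • (1 : Matrix α α k)) ^ d).mulVecLin =
      ⨅ i ∈ Tᶜ, LinearMap.ker (LinearMap.proj i : (α → k) →ₗ[k] k) := by
    ext v
    simp only [LinearMap.mem_ker, mulVecLin_apply, Submodule.mem_iInf, LinearMap.proj_apply]
    exact hA.pow_mulVec_eq_zero_iff c d v
  have h1 := LinearMap.finrank_range_add_finrank_ker
    ((A - c • (1 : Matrix α α k)) ^ d).mulVecLin
  rw [hker, (LinearMap.iInfKerProjEquiv k (fun _ : α => k) (I := T) (J := Tᶜ)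
    disjoint_compl_right (by simp)).finrank_eq] at h1
  simp only [Module.finrank_fintype_fun_eq_card] at h1
  rw [Matrix.rank, ← h1, Nat.add_sub_cancel_left]
  rfl

open Classical in
-- For fixed `a` and `j` the numbers `p` form an initial segment of ℕ, whose length is the
-- difference of two consecutive kernel dimensions.
theorem mem_range_iff (hA : WeyrCoded A g g) (a : k) (j p : ℕ) :
    Code.mk a j p ∈ Set.range g ↔
      p < Fintype.card {x // (ofLex (g x)).1 = a ∧ (ofLex (ofLex (g x)).2).1 < j + 1} -
        Fintype.card {x // (ofLex (g x)).1 = a ∧ (ofLex (ofLex (g x)).2).1 < j} := by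
  let R : Finset α := Finset.univ.filter fun x =>
    (ofLex (g x)).1 = a ∧ (ofLex (ofLex (g x)).2).1 = j
  let S : Finset ℕ := R.image fun x => (ofLex (ofLex (g x)).2).2
  have hS : ∀ p, p ∈ S ↔ Code.mk a j p ∈ Set.range g := by
    intro p
    simp only [S, R, Finset.mem_image, Finset.mem_filter, Finset.mem_univ, true_and]
    constructor
    · rintro ⟨x, ⟨rfl, rfl⟩, rfl⟩
      exact ⟨x, rfl⟩
    · rintro ⟨x, hx⟩
      exact ⟨x, by rw [hx]; exact ⟨⟨rfl, rfl⟩, rfl⟩⟩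
  have hcard : S.card = R.card := by
    refine Finset.card_image_of_injOn ?_
    intro x hx y hy hxy
    dsimp only at hxy
    simp only [R, Finset.coe_filter, Finset.mem_univ, true_and, Set.mem_ofPred_eq] at hx hy
    apply hA.mono_row.injective
    obtain ⟨a₁, j₁, p₁, e⟩ := Code.exists_mk (g x)
    obtain ⟨a₂, j₂, p₂, e'⟩ := Code.exists_mk (g y)
    rw [e] at hx hxy ⊢
    rw [e'] at hy hxy ⊢
    exact Code.mk_inj.mpr ⟨hx.1.trans hy.1.symm, hx.2.trans hy.2.symm, hxy⟩
  rw [← hS, mem_iff_lt_card (fun p q hp hq => by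
    rw [hS] at hp ⊢
    exact hA.closed _ _ _ _ _ hp le_rfl hq), hcard]
  simp only [Fintype.card_subtype]
  have h2 : (Finset.univ.filter fun x =>
      (ofLex (g x)).1 = a ∧ (ofLex (ofLex (g x)).2).1 < j + 1) =
      (Finset.univ.filter fun x => (ofLex (g x)).1 = a ∧ (ofLex (ofLex (g x)).2).1 < j).disjUnion
        R (by
          rw [Finset.disjoint_filter]
          exact fun x _ h1 h2 => absurd h1.2 (not_lt.mpr h2.2.ge)) := by
    ext x
    simp only [R, Finset.mem_disjUnion, Finset.mem_filter, Finset.mem_univ, true_and]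
    rw [Nat.lt_succ_iff_lt_or_eq]
    tauto
  rw [h2, Finset.card_disjUnion, Nat.add_sub_cancel_left]

/-- The ranks of the powers of `A - c` are similarity invariants. They determine the set of codes,
and the order of the rows then determines the coding. -/
theorem eq_of_similar (hA : WeyrCoded A g g) (hA' : WeyrCoded A' g' g') {P : Matrix α α k}
    (hP : IsUnit P) (h : P * A' = A * P) : A = A' := by
  classical
  have hrank : ∀ (c : k) (d : ℕ), ((A - c • (1 : Matrix α α k)) ^ d).rank =
      ((A' - c • (1 : Matrix α α k)) ^ d).rank := by
    intro c d
    have h1 : SemiconjBy P (A' - c • (1 : Matrix α α k)) (A - c • (1 : Matrix α α k)) := by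
      unfold SemiconjBy
      rw [Matrix.mul_sub, Matrix.sub_mul, h]
      simp
    exact rank_eq_of_mul_eq hP hP (h1.pow_right d)
  have hr : Set.range g = Set.range g' := by
    ext c
    obtain ⟨a, j, p, rfl⟩ := Code.exists_mk c
    rw [hA.mem_range_iff, hA'.mem_range_iff]
    simp only [hA.card_eq_sub_rank, hA'.card_eq_sub_rank, hrank]
  have hg : g = g' := (hA.mono_row.range_inj hA'.mono_row).mp hr
  subst hg
  ext x y
  rw [hA.entry, hA'.entry]

end WeyrCoded

/-- Rows and columns of a block lie in different but equivalent strips. The identification `θ` makes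
`Q` a copy of `P` and turns the relation into a similarity of square matrices. -/
theorem IsWeyr.eq_of_similar {A A' : Matrix α β k} (hA : IsWeyr A) (hA' : IsWeyr A')
    (θ : α ≃o β) {P : Matrix α α k} {Q : Matrix β β k} (hP : IsUnit P)
    (hQ : ∀ x y, Q (θ x) (θ y) = P x y) (h : P * A' = A * Q) : A = A' := by
  obtain ⟨g, h₁, hA⟩ := hA.coded
  obtain ⟨g', h₂, hA'⟩ := hA'.coded
  have h3 := (hA.submatrix_iso θ).eq_of_similar (hA'.submatrix_iso θ) hP (by
    have hQ' : P = Q.submatrix θ θ := by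
      ext x y
      exact (hQ x y).symm
    conv_rhs => rw [hQ']
    have e1 := Matrix.submatrix_mul_equiv P A' id (Equiv.refl α) θ
    have e2 := Matrix.submatrix_mul_equiv A Q id θ.toEquiv θ
    rw [Equiv.coe_refl] at e1
    rw [submatrix_id_id] at e1
    rw [e1, h, ← e2]
    rfl)
  ext x y
  have := congrFun (congrFun h3 x) (θ.symm y)
  simpa using this

namespace WeyrCoded

variable {A : Matrix α α k} {g : α → Code k}

theorem mul_apply_mk (hA : WeyrCoded A g g) (P : Matrix α α k) {x : α} {a : k} {j p : ℕ}
    (hx : g x = Code.mk a j p) (y : α) :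
    (A * P) x y = a * P x y + ∑ z, if g z = Code.mk a (j + 1) p then P z y else 0 := by
  have h1 : a * P x y = ∑ z, if g z = Code.mk a j p then a * P z y else 0 := by
    rw [Finset.sum_eq_single x]
    · rw [if_pos hx]
    · intro z _ hz
      rw [if_neg]
      rw [← hx]
      exact hA.mono_row.injective.ne hz
    · simp
  rw [h1, ← Finset.sum_add_distrib, mul_apply]
  refine Finset.sum_congr rfl fun z _ => ?_
  rw [hA.entry, hx, weyrEntry_mk_left]
  simp only [add_mul, ite_mul, zero_mul, one_mul]

open Classical in
-- The predecessor in the chain is described by `i + 1 = j` rather than `j - 1`, so that the sum is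
-- zero for `j = 0`.
theorem mul_apply_mk_right (hA : WeyrCoded A g g) (P : Matrix α α k) {y : α} {a : k} {j p : ℕ}
    (hy : g y = Code.mk a j p) (x : α) :
    (P * A) x y = a * P x y +
      ∑ z, if ∃ i, g z = Code.mk a i p ∧ i + 1 = j then P x z else 0 := by
  have h1 : a * P x y = ∑ z, if g z = Code.mk a j p then a * P x z else 0 := by
    rw [Finset.sum_eq_single y]
    · rw [if_pos hy]
    · intro z _ hz
      rw [if_neg]
      rw [← hy]
      exact hA.mono_row.injective.ne hz
    · simp
  rw [h1, ← Finset.sum_add_distrib, mul_apply]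
  refine Finset.sum_congr rfl fun z _ => ?_
  obtain ⟨a', j', p', e⟩ := Code.exists_mk (g z)
  rw [hA.entry, hy, e, weyrEntry_mk]
  simp only [Code.mk_inj]
  by_cases h2 : a' = a ∧ j' = j ∧ p' = p
  · obtain ⟨rfl, rfl, rfl⟩ := h2
    have : ¬ ∃ i, (a' = a' ∧ j' = i ∧ p' = p') ∧ i + 1 = j' := by
      rintro ⟨i, ⟨_, rfl, _⟩, h⟩
      omega
    simp [mul_comm]
  · rw [if_neg h2, if_neg h2, zero_add]
    have : (∃ i, (a' = a ∧ j' = i ∧ p' = p) ∧ i + 1 = j) ↔ (a' = a ∧ j' + 1 = j ∧ p' = p) := by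
      constructor
      · rintro ⟨i, ⟨rfl, rfl, rfl⟩, rfl⟩
        simp
      · rintro ⟨rfl, rfl, rfl⟩
        exact ⟨_, ⟨rfl, rfl, rfl⟩, rfl⟩
    simp only [this]
    split_ifs <;> simp

/-- For an entry off the diagonal, `y` is the successor of `x` in a chain. In the `(x, y)` entries
of the two products the eigenvalue terms cancel, leaving `P x x` and `P y y`. -/
theorem diag_eq (hA : WeyrCoded A g g) {P : Matrix α α k} (hP : P * A = A * P) {x y : α}
    (hxy : A x y ≠ 0) : P x x = P y y := by
  classical
  rcases hA.entry_ne_zero hxy with h | ⟨a, j, p, hx, hy⟩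
  · rw [hA.mono_row.injective h]
  · have h1 := congrFun (congrFun hP x) y
    rw [hA.mul_apply_mk P hx, hA.mul_apply_mk_right P hy, add_right_inj,
      Finset.sum_eq_single x, Finset.sum_eq_single y] at h1
    · rwa [if_pos ⟨j, hx, rfl⟩, if_pos hy] at h1
    · intro z _ hz
      rw [if_neg]
      rw [← hy]
      exact hA.mono_row.injective.ne hz
    · simp
    · intro z _ hz
      rw [if_neg]
      rintro ⟨i, hi, hij⟩
      obtain rfl : i = j := by omega
      exact hz (hA.mono_row.injective (hi.trans hx.symm))
    · simp

/-- A matrix that commutes with a Jordan block is upper triangular. -/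
theorem upper (hA : WeyrCoded A g g) {P : Matrix α α k} (hP : P * A = A * P) {a : k} {p : ℕ}
    (hg : ∀ x, ∃ j, g x = Code.mk a j p) {x y : α} (hxy : y < x) : P x y = 0 := by
  classical
  -- Induction on the strip of the column: comparing entries at the predecessor `x'` of `x`
  -- expresses `P x y` through the column preceding `y`, and for `j = 0` there is none.
  have key : ∀ j x y i, g y = Code.mk a j p → g x = Code.mk a i p → j < i → P x y = 0 := by
    intro j
    induction j with
    | zero =>
      intro x y i hy hx hij
      obtain ⟨i, rfl⟩ : ∃ i', i = i' + 1 := ⟨i - 1, by omega⟩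
      obtain ⟨x', hx'⟩ := hA.closed a (i + 1) p i p ⟨x, hx⟩ (Nat.le_succ i) le_rfl
      have h1 := congrFun (congrFun hP x') y
      rw [hA.mul_apply_mk P hx', hA.mul_apply_mk_right P hy, add_right_inj,
        Finset.sum_eq_single (f := fun z => if g z = Code.mk a (i + 1) p then P z y else 0) x]
        at h1
      · rw [if_pos hx] at h1
        rw [← h1]
        refine Finset.sum_eq_zero fun z _ => if_neg ?_
        rintro ⟨i, _, h⟩
        omega
      · intro z _ hz
        rw [if_neg]
        rw [← hx]
        exact hA.mono_row.injective.ne hz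
      · simp
    | succ j ih =>
      intro x y i hy hx hij
      obtain ⟨i, rfl⟩ : ∃ i', i = i' + 1 := ⟨i - 1, by omega⟩
      obtain ⟨x', hx'⟩ := hA.closed a (i + 1) p i p ⟨x, hx⟩ (Nat.le_succ i) le_rfl
      have h1 := congrFun (congrFun hP x') y
      rw [hA.mul_apply_mk P hx', hA.mul_apply_mk_right P hy, add_right_inj,
        Finset.sum_eq_single (f := fun z => if g z = Code.mk a (i + 1) p then P z y else 0) x]
        at h1
      · rw [if_pos hx] at h1
        rw [← h1]
        refine Finset.sum_eq_zero fun z _ => ?_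
        split_ifs with hz
        · obtain ⟨i', hz, hz'⟩ := hz
          obtain rfl : i' = j := by omega
          exact ih x' z i hz hx' (by omega)
        · rfl
      · intro z _ hz
        rw [if_neg]
        rw [← hx]
        exact hA.mono_row.injective.ne hz
      · simp
  obtain ⟨i, hi⟩ := hg x
  obtain ⟨j, hj⟩ := hg y
  refine key j x y i hj hi ?_
  have := hA.mono_row hxy
  rw [hi, hj, Code.mk_lt_mk] at this
  simpa using this

end WeyrCoded
end WeyrUniqueness

/-! ### Uniqueness of canonical matrices -/

section Steps

variable {k X : Type*} [Field k] [LinearOrder k] [Fintype X] [LinearOrder X] {t : ℕ}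
  {b : X → Fin t} {rel : Setoid (Fin t)} {Λ Λ' : Subalgebra k (Matrix X X k)}
  {M N : Matrix X X k} {l r : Fin t}

/-- Equivalent strips have equal size, hence the same set of positions, and the position identifies
their rows. This supplies the common numbering behind similarity transformations of a block. -/
theorem Frame.exists_orderIso (hF : Frame b rel Λ) (h : rel l r) :
    ∃ θ : {x // b x = l} ≃o {y // b y = r}, ∀ x : {x // b x = l}, Match b rel x.1 (θ x).1 := by
  have hm : ∀ i, StrictMono fun x : {x // b x = i} => pos b x :=
    fun i x y hxy => pos_lt_pos (x.2.trans y.2.symm) hxy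
  have hr : ∀ i, Set.range (fun x : {x // b x = i} => pos b x) = Set.Iio (stripSize b i) := by
    intro i
    ext p
    constructor
    · rintro ⟨x, rfl⟩
      exact lt_of_lt_of_eq (pos_lt_stripSize b x) (congrArg _ x.2)
    · intro hp
      obtain ⟨x, hx, hxp⟩ := exists_pos (b := b) (i := i) hp
      exact ⟨⟨x, hx⟩, hxp⟩
  obtain ⟨θ, hθ⟩ := (hm l).exists_orderIso (hm r) (by rw [hr, hr, hF.size_eq _ _ h])
  exact ⟨θ, fun x => ⟨by rw [x.2, (θ x).2]; exact h, (hθ x).symm⟩⟩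

/-- The block `N_{lr}` has the form that is prescribed by Belitskii's algorithm. -/
def Reduces (b : X → Fin t) (rel : Setoid (Fin t)) (Λ : Subalgebra k (Matrix X X k))
    (N : Matrix X X k) (l r : Fin t) : Prop :=
  (HasAddition b Λ N l r ∧ block b N l r = 0) ∨
  (¬ HasAddition b Λ N l r ∧ ¬ rel l r ∧ IsZeroOneForm (block b N l r)) ∨
  (¬ HasAddition b Λ N l r ∧ rel l r ∧ IsWeyr (block b N l r))

/-- Whether additions exist depends on the earlier blocks only, so both matrices fall under the same
case. Without additions the block is transformed by two diagonal blocks of `S`, equal copies of each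
other if `l` and `r` are equivalent, and the normal form under such transformations is unique. -/
theorem Reduces.block_eq (hF : Frame b rel Λ) (hM : Reduces b rel Λ M l r)
    (hN : Reduces b rel Λ N l r) (h : AgreeBefore b l r M N) {S : Matrix X X k} (hS : S ∈ Λ)
    (hu : IsUnit S) (hSN : M * S = S * N) : block b M l r = block b N l r := by
  have hadd := h.hasAddition_iff (Λ := Λ)
  have hl := isUnit_block hF hS hu l
  have hr := isUnit_block hF hS hu r
  rcases hM with ⟨hM, hM0⟩ | ⟨hM, hM1, hM2⟩ | ⟨hM, hM1, hM2⟩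
  · rcases hN with ⟨_, hN0⟩ | ⟨hN, _⟩ | ⟨hN, _⟩
    · rw [hM0, hN0]
    · exact absurd (hadd.mp hM) hN
    · exact absurd (hadd.mp hM) hN
  · rcases hN with ⟨hN, _⟩ | ⟨_, _, hN2⟩ | ⟨_, hN1, _⟩
    · exact absurd (hadd.mpr hN) hM
    · exact hM2.eq_of_equiv hl hr (block_mul_block hF hS hSN h hM) hN2
    · exact absurd hN1 hM1
  · rcases hN with ⟨hN, _⟩ | ⟨_, hN1, _⟩ | ⟨_, _, hN2⟩
    · exact absurd (hadd.mpr hN) hM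
    · exact absurd hM1 hN1
    · obtain ⟨θ, hθ⟩ := hF.exists_orderIso hM1
      refine hM2.eq_of_similar hN2 θ hl ?_ (block_mul_block hF hS hSN h hM)
      intro x y
      exact (hF.diag_eq S hS x y (θ x) (θ y) (x.2.trans y.2.symm)
        ((θ x).2.trans (θ y).2.symm) (hθ x) (hθ y)).symm

/-- A step of Belitskii's algorithm that does not change the matrix. -/
def StepAt (M : Matrix X X k) (Λ Λ' : Subalgebra k (Matrix X X k)) : Prop :=
  ∃ (t : ℕ) (b : X → Fin t) (rel : Setoid (Fin t)), IsReducedAlgebra b rel Λ ∧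
    ∃ l r : Fin t, ¬ IsStable b Λ M l r ∧ (∀ i j, BlockLT i j l r → IsStable b Λ M i j) ∧
      Reduces b rel Λ M l r ∧
      ∀ R, R ∈ Λ' ↔ R ∈ Λ ∧ block b (R * M) l r = block b (M * R) l r

theorem StepAt.le (h : StepAt M Λ Λ') : Λ' ≤ Λ := by
  obtain ⟨t, b, rel, hred, l, r, _, _, _, hR⟩ := h
  exact fun R hR' => ((hR R).mp hR').1

theorem StepAt.step (h : StepAt M Λ Λ') : Step (M, Λ) (M, Λ') := by
  obtain ⟨t, b, rel, hred, l, r, hns, hst, hr, hR⟩ := h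
  refine ⟨t, b, rel, hred, l, r, hns, hst, ⟨1, Λ.one_mem, isUnit_one, by simp, ?_⟩, hR⟩
  rcases hr with ⟨h1, h2⟩ | h | h
  · exact Or.inl ⟨h1, fun _ _ _ => rfl, h2⟩
  · exact Or.inr (Or.inl h)
  · exact Or.inr (Or.inr h)

theorem _root_.Matrix.mul_left_cancel_of_isUnit {α β : Type*} [Fintype α] [DecidableEq α]
    {P : Matrix α α k} (hP : IsUnit P) {A B : Matrix α β k} (h : P * A = P * B) : A = B := by
  have hd := (Matrix.isUnit_iff_isUnit_det P).mp hP
  rw [← Matrix.nonsing_inv_mul_cancel_left _ A hd, h, Matrix.nonsing_inv_mul_cancel_left _ _ hd]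

/-- The first part of the result of a step can be replaced by any matrix that is obtained from it
by later steps. -/
theorem Step.stepAt {M₁ T : Matrix X X k} (h : Step (M, Λ) (M₁, Λ')) (hT : T ∈ Λ')
    (hu : IsUnit T) (hN : M₁ * T = T * N) :
    StepAt N Λ Λ' ∧ ∃ S ∈ Λ, IsUnit S ∧ M * S = S * N := by
  obtain ⟨t, b, rel, hred, l, r, hns, hst, ⟨S, hS, hSu, hSM, hform⟩, hR⟩ := h
  dsimp only at hred hns hst hS hSM hform hR
  have hF := hred.frame
  have hTΛ : T ∈ Λ := ((hR T).mp hT).1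
  have hMS : M * S = S * M₁ := (inv_mul_mul_eq_iff hSu).mp hSM.symm
  have hMST : M * (S * T) = S * T * N := by
    rw [← Matrix.mul_assoc, hMS, Matrix.mul_assoc, hN, Matrix.mul_assoc]
  have hST : S * T ∈ Λ := Λ.mul_mem hS hTΛ
  have hSTu : IsUnit (S * T) := hSu.mul hu
  have hN' : (S * T)⁻¹ * M * (S * T) = N := (inv_mul_mul_eq_iff hSTu).mpr hMST
  refine ⟨?_, S * T, hST, hSTu, hMST⟩
  have hagM₁ : AgreeBefore b l r M₁ M := by
    rw [hSM]
    exact agreeBefore_of_stable hS hSu hst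
  have hagN : AgreeBefore b l r N M := by
    rw [← hN']
    exact agreeBefore_of_stable hST hSTu hst
  have hag : AgreeBefore b l r M₁ N := fun x y hxy => (hagM₁ x y hxy).trans (hagN x y hxy).symm
  -- Membership of `T` in `Λ'` gives equal blocks of `T * M₁` and `M₁ * T = T * N`. The earlier
  -- blocks agree, so the invertible diagonal block of `T` can be cancelled.
  have hblock : block b M₁ l r = block b N l r := by
    have h1 := ((hR T).mp hT).2
    rw [hN, block_mul_left hF hTΛ, block_mul_left hF hTΛ, hag.sum_left, add_left_inj] at h1
    exact Matrix.mul_left_cancel_of_isUnit (isUnit_block hF hTΛ hu l) h1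
  refine ⟨t, b, rel, hred, l, r, ?_, ?_, ?_, ?_⟩
  · rwa [← hN', IsStable.conj_iff hST hSTu]
  · intro i j hij
    rw [← hN']
    exact (hst i j hij).of_conj hST hSTu
  · unfold Reduces
    rw [← hblock, hagN.hasAddition_iff]
    rcases hform with ⟨h1, _, h2⟩ | h | h
    · exact Or.inl ⟨h1, h2⟩
    · exact Or.inr (Or.inl h)
    · exact Or.inr (Or.inr h)
  · intro R
    rw [hR]
    refine and_congr_right fun hRΛ => ?_
    rw [hag.block_mul_left hF hRΛ hblock, hag.block_mul_right hF hRΛ hblock]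

/-- Induction from the end of the run: the final matrix is conjugate to each intermediate matrix by
an element of the algebra reached there, so by `Step.stepAt` it may take its place throughout. -/
theorem run_stepAt {p q : Matrix X X k × Subalgebra k (Matrix X X k)}
    (h : Relation.ReflTransGen Step p q) :
    Relation.ReflTransGen (StepAt q.1) p.2 q.2 ∧ ∃ S ∈ p.2, IsUnit S ∧ p.1 * S = S * q.1 := by
  induction h using Relation.ReflTransGen.head_induction_on with
  | refl => exact ⟨.refl, 1, q.2.one_mem, isUnit_one, by simp⟩
  | head h _ ih =>
    obtain ⟨h1, T, hT, hu, hTq⟩ := ih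
    have h2 := Step.stepAt h hT hu hTq
    exact ⟨.head h2.1 h1, h2.2⟩

/-- Belitskii's algorithm does not change a canonical matrix. -/
theorem isCanonical_iff : IsCanonical Λ M ↔ ∃ Λ', Relation.ReflTransGen (StepAt M) Λ Λ' ∧
    ∀ S ∈ Λ', IsUnit S → M * S = S * M := by
  constructor
  · rintro ⟨Λ', h, hfix⟩
    exact ⟨Λ', (run_stepAt h).1, fun S hS hu => (inv_mul_mul_eq_iff hu).mp (hfix S hS hu)⟩
  · rintro ⟨Λ', h, hfix⟩
    refine ⟨Λ', ?_, fun S hS hu => (inv_mul_mul_eq_iff hu).mpr (hfix S hS hu)⟩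
    exact h.lift (fun Λ => (M, Λ)) fun _ _ => StepAt.step

theorem exists_of_not_isStable (h : ¬ IsStable b Λ M l r) : ∃ x y, b x = l ∧ b y = r := by
  by_contra hn
  push Not at hn
  exact h fun S _ _ => block_eq_iff.mpr fun x y hx hy => absurd hy (hn x y hx)

/-! ### Steps do not depend on the presentation of the algebra -/

section TwoFrames

variable {t' : ℕ} {b' : X → Fin t'} {rel' : Setoid (Fin t')} {l' r' : Fin t'}

theorem Frame.isStable_iff (hF : Frame b rel Λ) (hF' : Frame b' rel' Λ) (x y : X) :
    IsStable b Λ M (b x) (b y) ↔ IsStable b' Λ M (b' x) (b' y) := by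
  unfold IsStable
  simp only [block_eq_iff, hF.strip_iff hF']

theorem Frame.blockLT_iff (hF : Frame b rel Λ) (hF' : Frame b' rel' Λ) (x y u v : X) :
    BlockLT (b x) (b y) (b u) (b v) ↔ BlockLT (b' x) (b' y) (b' u) (b' v) := by
  unfold BlockLT
  rw [hF.strip_lt_iff hF', hF.strip_iff hF', hF.strip_lt_iff hF']

theorem blockLT_trichotomy (i j l r : Fin t) :
    BlockLT i j l r ∨ (i = l ∧ j = r) ∨ BlockLT l r i j := by
  unfold BlockLT
  rcases lt_trichotomy i l with h | h | h <;> rcases lt_trichotomy j r with h' | h' | h' <;>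
    simp [h, h']

/-- The first nonstable block does not depend on the presentation of the reduced algebra. -/
theorem Frame.first_nonstable (hF : Frame b rel Λ) (hF' : Frame b' rel' Λ)
    (hns : ¬ IsStable b Λ M l r) (hst : ∀ i j, BlockLT i j l r → IsStable b Λ M i j)
    (hns' : ¬ IsStable b' Λ M l' r') (hst' : ∀ i j, BlockLT i j l' r' → IsStable b' Λ M i j) :
    ∃ x y, (b x = l ∧ b' x = l') ∧ b y = r ∧ b' y = r' := by
  obtain ⟨x, y, rfl, rfl⟩ := exists_of_not_isStable hns
  obtain ⟨x', y', rfl, rfl⟩ := exists_of_not_isStable hns'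
  have h1 : ¬ BlockLT (b x') (b y') (b x) (b y) := fun h =>
    hns' ((hF.isStable_iff hF' x' y').mp (hst _ _ h))
  have h2 : ¬ BlockLT (b x) (b y) (b x') (b y') := fun h =>
    hns ((hF.isStable_iff hF' x y).mpr (hst' _ _ ((hF.blockLT_iff hF' x y x' y').mp h)))
  rcases blockLT_trichotomy (b x') (b y') (b x) (b y) with h | ⟨h, h'⟩ | h
  · exact absurd h h1
  · exact ⟨x', y', ⟨h, rfl⟩, h', rfl⟩
  · exact absurd h h2

theorem isZeroOneForm_congr {p p' q q' : X → Prop} (hp : ∀ z, p z ↔ p' z) (hq : ∀ z, q z ↔ q' z)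
    (h : IsZeroOneForm (M.submatrix (Subtype.val : {x // p x} → X)
      (Subtype.val : {y // q y} → X))) :
    IsZeroOneForm (M.submatrix (Subtype.val : {x // p' x} → X)
      (Subtype.val : {y // q' y} → X)) := by
  obtain rfl : p = p' := funext fun z => propext (hp z)
  obtain rfl : q = q' := funext fun z => propext (hq z)
  exact h

theorem isWeyr_congr {p p' q q' : X → Prop} (hp : ∀ z, p z ↔ p' z) (hq : ∀ z, q z ↔ q' z)
    (h : IsWeyr (M.submatrix (Subtype.val : {x // p x} → X)
      (Subtype.val : {y // q y} → X))) :
    IsWeyr (M.submatrix (Subtype.val : {x // p' x} → X)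
      (Subtype.val : {y // q' y} → X)) := by
  obtain rfl : p = p' := funext fun z => propext (hp z)
  obtain rfl : q = q' := funext fun z => propext (hq z)
  exact h

theorem Frame.hasAddition_iff (hF : Frame b rel Λ) (hF' : Frame b' rel' Λ) (u v : X) :
    HasAddition b Λ M (b u) (b v) ↔ HasAddition b' Λ M (b' u) (b' v) := by
  unfold HasAddition
  simp only [hF.strip_iff hF', hF.strip_lt_iff hF']

theorem Frame.reduces_of (hF : Frame b rel Λ) (hF' : Frame b' rel' Λ) (u v : X)
    (h : Reduces b rel Λ M (b u) (b v)) : Reduces b' rel' Λ M (b' u) (b' v) := by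
  unfold Reduces at h ⊢
  rw [← hF.hasAddition_iff hF', ← hF.rel_iff hF']
  rcases h with ⟨h1, h2⟩ | ⟨h1, h2, h3⟩ | ⟨h1, h2, h3⟩
  · refine Or.inl ⟨h1, ?_⟩
    ext x y
    exact congrFun (congrFun h2 ⟨x, (hF.strip_iff hF').mpr x.2⟩) ⟨y, (hF.strip_iff hF').mpr y.2⟩
  · exact Or.inr (Or.inl ⟨h1, h2, isZeroOneForm_congr (fun z => hF.strip_iff hF')
      (fun z => hF.strip_iff hF') h3⟩)
  · exact Or.inr (Or.inr ⟨h1, h2, isWeyr_congr (fun z => hF.strip_iff hF')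
      (fun z => hF.strip_iff hF') h3⟩)

end TwoFrames

/-- The two runs stay parallel. The first nonstable blocks have the same place and, by
`Reduces.block_eq`, the same value, so both runs pass to the same algebra; `S` belongs to it, and
the comparison goes on until one run stops. -/
theorem eq_of_runs {Λ₁ Λ₂ : Subalgebra k (Matrix X X k)}
    (h₁ : Relation.ReflTransGen (StepAt M) Λ Λ₁) (f₁ : ∀ S ∈ Λ₁, IsUnit S → M * S = S * M)
    (h₂ : Relation.ReflTransGen (StepAt N) Λ Λ₂) (f₂ : ∀ S ∈ Λ₂, IsUnit S → N * S = S * N)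
    {S : Matrix X X k} (hS : S ∈ Λ) (hu : IsUnit S) (hMN : M * S = S * N) : M = N := by
  induction h₁ using Relation.ReflTransGen.head_induction_on with
  | refl =>
    rw [f₁ S hS hu] at hMN
    exact Matrix.mul_left_cancel_of_isUnit hu hMN
  | @head Λ Λ' h _ ih =>
    -- If the second run stops here, then `S` already commutes with `N` and can be cancelled.
    rcases h₂.cases_head with rfl | ⟨Λ'', h', h₂'⟩
    · rw [← f₂ S hS hu] at hMN
      exact hu.mul_right_cancel hMN
    · have hN : S⁻¹ * M * S = N := (inv_mul_mul_eq_iff hu).mpr hMN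
      obtain ⟨t, b, rel, hred, l, r, hns, hst, hr, hR⟩ := h
      obtain ⟨t', b', rel', hred', l', r', hns', hst', hr', hR'⟩ := h'
      have hF := hred.frame
      have hF' := hred'.frame
      have hns'' : ¬ IsStable b' Λ M l' r' := by rwa [← IsStable.conj_iff hS hu, hN]
      have hst'' : ∀ i j, BlockLT i j l' r' → IsStable b' Λ M i j := fun i j hij => by
        rw [← IsStable.conj_iff hS hu, hN]
        exact hst' i j hij
      obtain ⟨x, y, ⟨rfl, rfl⟩, rfl, rfl⟩ := hF.first_nonstable hF' hns hst hns'' hst''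
      have hag : AgreeBefore b (b x) (b y) M N := by
        rw [← hN]
        exact (agreeBefore_of_stable hS hu hst).symm
      have hblock := hr.block_eq hF (hF'.reduces_of hF x y hr') hag hS hu hMN
      have hΛ : Λ'' = Λ' := by
        ext R
        rw [hR, hR']
        refine and_congr_right fun hRΛ => ?_
        rw [hag.block_mul_left hF hRΛ hblock, hag.block_mul_right hF hRΛ hblock]
        simp only [block_eq_iff, hF.strip_iff hF']
      subst hΛ
      -- `S` satisfies the new condition: at this block `S * M` agrees with `S * N = M * S`.
      refine ih h₂' ?_
      rw [hR]
      exact ⟨hS, by rw [hag.block_mul_left hF hS hblock, hMN]⟩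

/-- Similar canonical matrices are equal. -/
theorem IsCanonical.eq_of_similar (hM : IsCanonical Λ M) (hN : IsCanonical Λ N)
    {S : Matrix X X k} (hS : S ∈ Λ) (hu : IsUnit S) (h : M * S = S * N) : M = N := by
  obtain ⟨Λ₁, h₁, f₁⟩ := isCanonical_iff.mp hM
  obtain ⟨Λ₂, h₂, f₂⟩ := isCanonical_iff.mp hN
  exact eq_of_runs h₁ f₁ h₂ f₂ hS hu h

end Steps

/-! ### Restriction of canonical matrices to direct summands -/

section Restriction

variable {k X Y : Type*} [Field k] [Fintype X] [LinearOrder X] [Fintype Y] [LinearOrder Y]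

/-- The matrix of the restriction of vectors along `φ`. -/
def incl (k : Type*) [Field k] (φ : Y ↪o X) : Matrix Y X k := (1 : Matrix X X k).submatrix φ id

theorem incl_mul (φ : Y ↪o X) {Z : Type*} (N : Matrix X Z k) :
    incl k φ * N = N.submatrix φ id := by
  ext x y
  simp [incl, mul_apply, one_apply]

theorem mul_incl_transpose (φ : Y ↪o X) {Z : Type*} (N : Matrix Z X k) :
    N * (incl k φ)ᵀ = N.submatrix id φ := by
  ext x y
  simp [incl, mul_apply, one_apply]

theorem incl_mul_transpose (φ : Y ↪o X) : incl k φ * (incl k φ)ᵀ = 1 := by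
  rw [incl_mul]
  ext x y
  simp [incl, one_apply]

theorem incl_mul_transpose_mul (φ : Y ↪o X) {Z : Type*} (N : Matrix Y Z k) :
    incl k φ * ((incl k φ)ᵀ * N) = N := by
  rw [← Matrix.mul_assoc, incl_mul_transpose, Matrix.one_mul]

/-- The extension of a matrix by zero. -/
def extend (φ : Y ↪o X) (S : Matrix Y Y k) : Matrix X X k := (incl k φ)ᵀ * (S * incl k φ)

theorem extend_apply (φ : Y ↪o X) (S : Matrix Y Y k) (x y : Y) :
    extend φ S (φ x) (φ y) = S x y := by
  have h : incl k φ * extend φ S * (incl k φ)ᵀ = S := by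
    rw [extend, incl_mul_transpose_mul, Matrix.mul_assoc, incl_mul_transpose, Matrix.mul_one]
  conv_rhs => rw [← h, mul_incl_transpose, incl_mul]
  rfl

theorem extend_apply_of_left (φ : Y ↪o X) (S : Matrix Y Y k) {u : X} (hu : u ∉ Set.range φ)
    (v : X) : extend φ S u v = 0 := by
  rw [extend, mul_apply]
  refine Finset.sum_eq_zero fun x _ => ?_
  have : (incl k φ)ᵀ u x = 0 := by
    simp only [incl, transpose_apply, submatrix_apply]
    exact one_apply_ne fun e => hu ⟨x, e⟩
  rw [this, zero_mul]

theorem extend_apply_of_right (φ : Y ↪o X) (S : Matrix Y Y k) (u : X) {v : X}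
    (hv : v ∉ Set.range φ) : extend φ S u v = 0 := by
  rw [extend, ← Matrix.mul_assoc, mul_apply]
  refine Finset.sum_eq_zero fun x _ => ?_
  have : incl k φ x v = 0 := by
    simp only [incl, submatrix_apply]
    exact one_apply_ne fun e => hv ⟨x, e⟩
  rw [this, mul_zero]

theorem extend_mul (φ : Y ↪o X) (S T : Matrix Y Y k) :
    extend φ S * extend φ T = extend φ (S * T) := by
  unfold extend
  simp only [Matrix.mul_assoc, incl_mul_transpose_mul]

theorem extend_add (φ : Y ↪o X) (S T : Matrix Y Y k) :
    extend φ (S + T) = extend φ S + extend φ T := by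
  unfold extend
  rw [Matrix.add_mul, Matrix.mul_add]

theorem extend_smul (φ : Y ↪o X) (c : k) (S : Matrix Y Y k) :
    extend φ (c • S) = c • extend φ S := by
  unfold extend
  rw [Matrix.smul_mul, Matrix.mul_smul]

theorem extend_mul_one_sub (φ : Y ↪o X) (S : Matrix Y Y k) :
    extend φ S * (1 - extend φ 1) = 0 := by
  rw [Matrix.mul_sub, Matrix.mul_one, extend_mul, Matrix.mul_one, sub_self]

theorem one_sub_mul_extend (φ : Y ↪o X) (S : Matrix Y Y k) :
    (1 - extend φ 1) * extend φ S = 0 := by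
  rw [Matrix.sub_mul, Matrix.one_mul, extend_mul, Matrix.one_mul, sub_self]

theorem extend_one_apply_self (φ : Y ↪o X) (u : X) [Decidable (u ∈ Set.range φ)] :
    extend φ (1 : Matrix Y Y k) u u = if u ∈ Set.range φ then 1 else 0 := by
  split_ifs with h
  · obtain ⟨x, rfl⟩ := h
    rw [extend_apply, one_apply_eq]
  · exact extend_apply_of_left φ 1 h u

theorem extend_one_eq_diagonal (φ : Y ↪o X) [∀ u, Decidable (u ∈ Set.range φ)] :
    extend φ (1 : Matrix Y Y k) = diagonal fun u => if u ∈ Set.range φ then 1 else 0 := by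
  ext u v
  by_cases huv : u = v
  · subst huv
    rw [extend_one_apply_self, diagonal_apply_eq]
  · rw [diagonal_apply_ne _ huv]
    by_cases hu : u ∈ Set.range φ
    · by_cases hv : v ∈ Set.range φ
      · obtain ⟨x, rfl⟩ := hu
        obtain ⟨y, rfl⟩ := hv
        rw [extend_apply, one_apply_ne]
        rintro rfl
        exact huv rfl
      · exact extend_apply_of_right φ 1 u hv
    · exact extend_apply_of_left φ 1 hu v

/-- The extension of a matrix by the identity matrix. -/
def extendOne (φ : Y ↪o X) (S : Matrix Y Y k) : Matrix X X k := extend φ S + (1 - extend φ 1)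

theorem extendOne_one (φ : Y ↪o X) : extendOne φ (1 : Matrix Y Y k) = 1 := by simp [extendOne]

theorem extendOne_mul (φ : Y ↪o X) (S T : Matrix Y Y k) :
    extendOne φ S * extendOne φ T = extendOne φ (S * T) := by
  unfold extendOne
  have h : (1 - extend φ (1 : Matrix Y Y k)) * (1 - extend φ 1) = 1 - extend φ 1 := by
    rw [Matrix.mul_sub, one_sub_mul_extend, Matrix.mul_one, sub_zero]
  rw [Matrix.add_mul, Matrix.mul_add, Matrix.mul_add, extend_mul, extend_mul_one_sub,
    one_sub_mul_extend, h, add_zero, zero_add]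

theorem isUnit_extendOne (φ : Y ↪o X) {S : Matrix Y Y k} (hu : IsUnit S) :
    IsUnit (extendOne φ S) := by
  obtain ⟨T, hT⟩ := hu.exists_right_inv
  exact IsUnit.of_mul_eq_one (extendOne φ T) (by rw [extendOne_mul, hT, extendOne_one])

theorem extendOne_inv (φ : Y ↪o X) {S : Matrix Y Y k} (hu : IsUnit S) :
    (extendOne φ S)⁻¹ = extendOne φ S⁻¹ := by
  refine Matrix.inv_eq_right_inv ?_
  rw [extendOne_mul, Matrix.mul_nonsing_inv _ ((Matrix.isUnit_iff_isUnit_det S).mp hu),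
    extendOne_one]

theorem incl_mul_extendOne (φ : Y ↪o X) (S : Matrix Y Y k) :
    incl k φ * extendOne φ S = S * incl k φ := by
  unfold extendOne extend
  rw [Matrix.mul_add, incl_mul_transpose_mul, Matrix.mul_sub, incl_mul_transpose_mul,
    Matrix.one_mul, Matrix.mul_one, sub_self, add_zero]

theorem extendOne_mul_incl (φ : Y ↪o X) (S : Matrix Y Y k) :
    extendOne φ S * (incl k φ)ᵀ = (incl k φ)ᵀ * S := by
  unfold extendOne extend
  rw [Matrix.add_mul, Matrix.sub_mul, Matrix.one_mul, Matrix.one_mul, Matrix.mul_assoc,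
    Matrix.mul_assoc, Matrix.mul_assoc, incl_mul_transpose, Matrix.mul_one, Matrix.mul_one,
    sub_self, add_zero]

theorem submatrix_eq_incl (φ : Y ↪o X) (M : Matrix X X k) :
    M.submatrix φ φ = incl k φ * M * (incl k φ)ᵀ := by
  rw [mul_incl_transpose, incl_mul]
  rfl

/-- Conjugation by `S ⊕ 1` acts on the selected principal submatrix as conjugation by `S`, whatever
the rest of `M` is. -/
theorem submatrix_conj (φ : Y ↪o X) (M : Matrix X X k) {S : Matrix Y Y k} (hu : IsUnit S) :
    ((extendOne φ S)⁻¹ * M * extendOne φ S).submatrix φ φ = S⁻¹ * M.submatrix φ φ * S := by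
  rw [submatrix_eq_incl, submatrix_eq_incl, extendOne_inv φ hu]
  calc incl k φ * (extendOne φ S⁻¹ * M * extendOne φ S) * (incl k φ)ᵀ
      = incl k φ * extendOne φ S⁻¹ * M * (extendOne φ S * (incl k φ)ᵀ) := by
        simp only [Matrix.mul_assoc]
    _ = _ := by
        rw [incl_mul_extendOne, extendOne_mul_incl]
        simp only [Matrix.mul_assoc]

/-- The subalgebra of the matrices whose extensions by zero belong to `Λ`. -/
def restrictAlg (φ : Y ↪o X) (Λ : Subalgebra k (Matrix X X k))
    (he : extend φ (1 : Matrix Y Y k) ∈ Λ) : Subalgebra k (Matrix Y Y k) where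
  carrier := {S | extend φ S ∈ Λ}
  mul_mem' := by
    intro S T hS hT
    have := Λ.mul_mem hS hT
    rwa [extend_mul] at this
  add_mem' := by
    intro S T hS hT
    have := Λ.add_mem hS hT
    rwa [← extend_add] at this
  algebraMap_mem' := by
    intro c
    have := Λ.smul_mem he c
    rw [← extend_smul] at this
    rwa [Algebra.algebraMap_eq_smul_one]

theorem mem_restrictAlg {φ : Y ↪o X} {Λ : Subalgebra k (Matrix X X k)}
    {he : extend φ (1 : Matrix Y Y k) ∈ Λ} {S : Matrix Y Y k} :
    S ∈ restrictAlg φ Λ he ↔ extend φ S ∈ Λ := Iff.rfl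

theorem extendOne_mem {φ : Y ↪o X} {Λ : Subalgebra k (Matrix X X k)}
    {he : extend φ (1 : Matrix Y Y k) ∈ Λ} {S : Matrix Y Y k} (hS : S ∈ restrictAlg φ Λ he) :
    extendOne φ S ∈ Λ := Λ.add_mem hS (Λ.sub_mem Λ.one_mem he)

section Commuting

variable {φ : Y ↪o X} {M : Matrix X X k} (hM : M * extend φ 1 = extend φ 1 * M)
include hM

/-- Commuting with the diagonal idempotent means that `M` splits into the selected principal
submatrix and its complement, so the inclusion is a morphism. -/
theorem incl_mul_eq : incl k φ * M = M.submatrix φ φ * incl k φ := by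
  have h1 : extend φ (1 : Matrix Y Y k) = (incl k φ)ᵀ * incl k φ := by
    rw [extend, Matrix.one_mul]
  calc incl k φ * M = incl k φ * (extend φ 1 * M) := by
        rw [h1, Matrix.mul_assoc, incl_mul_transpose_mul]
    _ = _ := by rw [← hM, h1, submatrix_eq_incl]; simp only [Matrix.mul_assoc]

theorem mul_incl_eq : M * (incl k φ)ᵀ = (incl k φ)ᵀ * M.submatrix φ φ := by
  have h1 : extend φ (1 : Matrix Y Y k) = (incl k φ)ᵀ * incl k φ := by
    rw [extend, Matrix.one_mul]
  calc M * (incl k φ)ᵀ = M * extend φ 1 * (incl k φ)ᵀ := by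
        rw [h1, Matrix.mul_assoc, Matrix.mul_assoc, incl_mul_transpose, Matrix.mul_one]
    _ = _ := by rw [hM, h1, submatrix_eq_incl]; simp only [Matrix.mul_assoc]

theorem extend_mul_eq (R : Matrix Y Y k) : extend φ R * M = extend φ (R * M.submatrix φ φ) := by
  unfold extend
  rw [Matrix.mul_assoc, Matrix.mul_assoc, incl_mul_eq hM]
  simp only [Matrix.mul_assoc]

theorem mul_extend_eq (R : Matrix Y Y k) : M * extend φ R = extend φ (M.submatrix φ φ * R) := by
  unfold extend
  rw [← Matrix.mul_assoc, mul_incl_eq hM]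
  simp only [Matrix.mul_assoc]

/-- The `(x, y)` entries of the two products are `M x y` times the diagonal entry of the idempotent
at `y` and at `x`. -/
theorem range_iff_of_ne_zero {x y : X} (h : M x y ≠ 0) :
    x ∈ Set.range φ ↔ y ∈ Set.range φ := by
  classical
  have h1 := congrFun (congrFun hM x) y
  rw [extend_one_eq_diagonal, mul_diagonal, diagonal_mul] at h1
  by_cases hx : x ∈ Set.range φ <;> by_cases hy : y ∈ Set.range φ <;>
    simp [hx, hy, h, h.symm] at h1 ⊢

end Commuting

variable {t : ℕ} {b : X → Fin t} {rel : Setoid (Fin t)} {Λ : Subalgebra k (Matrix X X k)}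
  {φ : Y ↪o X}

theorem Frame.range_iff (hF : Frame b rel Λ) (he : extend φ (1 : Matrix Y Y k) ∈ Λ) {u v : X}
    (h : Match b rel u v) : u ∈ Set.range φ ↔ v ∈ Set.range φ := by
  classical
  have h1 := hF.diag_eq _ he u u v v rfl rfl h h
  rw [extend_one_apply_self, extend_one_apply_self] at h1
  by_cases hx : u ∈ Set.range φ <;> by_cases hy : v ∈ Set.range φ <;> simp [hx, hy] at h1 ⊢

/-- The position `p` of the strip `i` belongs to the range of `φ`. -/
def Selected (b : X → Fin t) (φ : Y ↪o X) (i : Fin t) (p : ℕ) : Prop :=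
  ∃ x ∈ Set.range φ, b x = i ∧ pos b x = p

open Classical in
theorem card_restrict (b : X → Fin t) (φ : Y ↪o X) (i : Fin t) (n : ℕ) :
    (Finset.univ.filter fun z : Y => b (φ z) = i ∧ pos b (φ z) < n).card =
      Nat.count (Selected b φ i) n := by
  rw [Nat.count_eq_card_filter_range]
  refine Finset.card_bij (fun z _ => pos b (φ z)) ?_ ?_ ?_
  · intro z hz
    simp only [Finset.mem_filter, Finset.mem_univ, true_and, Finset.mem_range] at hz ⊢
    exact ⟨hz.2, φ z, ⟨z, rfl⟩, hz.1, rfl⟩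
  · intro z hz w hw h
    simp only [Finset.mem_filter, Finset.mem_univ, true_and] at hz hw
    exact φ.injective (pos_inj (hz.1.trans hw.1.symm) h)
  · intro p hp
    simp only [Finset.mem_filter, Finset.mem_range] at hp
    obtain ⟨hp, _, ⟨z, rfl⟩, hz, rfl⟩ := hp
    exact ⟨z, by simp [hz, hp], rfl⟩

theorem Frame.selected_eq (hF : Frame b rel Λ) (he : extend φ (1 : Matrix Y Y k) ∈ Λ)
    {i j : Fin t} (h : rel i j) : Selected b φ i = Selected b φ j := by
  have key : ∀ {i j : Fin t}, rel i j → ∀ p, Selected b φ i p → Selected b φ j p := by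
    rintro i j h p ⟨x, hx, rfl, rfl⟩
    obtain ⟨y, hy, hm⟩ := hF.exists_match h
    exact ⟨y, (hF.range_iff he hm).mp hx, hy, hm.2.symm⟩
  funext p
  exact propext ⟨key h p, key (rel.symm' h) p⟩

/-- The new position of an index is the number of selected positions before it. Equivalent strips
have the same selected positions, so the renumbering preserves and reflects matching. -/
theorem Frame.match_restrict (hF : Frame b rel Λ) (he : extend φ (1 : Matrix Y Y k) ∈ Λ)
    (x y : Y) : Match (b ∘ φ) rel x y ↔ Match b rel (φ x) (φ y) := by
  classical
  have hpos : ∀ x : Y, pos (b ∘ φ) x =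
      Nat.count (Selected b φ (b (φ x))) (pos b (φ x)) := by
    intro x
    rw [← card_restrict]
    unfold pos
    congr 1
    ext z
    simp only [Finset.mem_filter, Finset.mem_univ, true_and, Function.comp]
    refine and_congr_right fun hz => ?_
    rw [← φ.lt_iff_lt, ← pos_lt_pos_iff hz]
    rfl
  unfold Match
  refine and_congr_right fun h => ?_
  rw [hpos, hpos, hF.selected_eq he (show rel (b (φ x)) (b (φ y)) from h)]
  refine ⟨fun e => Nat.count_injective ?_ ?_ e, fun e => by rw [e]⟩
  · rw [← hF.selected_eq he (show rel (b (φ x)) (b (φ y)) from h)]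
    exact ⟨φ x, ⟨x, rfl⟩, rfl, rfl⟩
  · exact ⟨φ y, ⟨y, rfl⟩, rfl, rfl⟩

theorem Frame.stripSize_restrict (hF : Frame b rel Λ) (he : extend φ (1 : Matrix Y Y k) ∈ Λ)
    {i j : Fin t} (h : rel i j) : stripSize (b ∘ φ) i = stripSize (b ∘ φ) j := by
  classical
  have hsize : ∀ i, stripSize (b ∘ φ) i =
      Nat.count (Selected b φ i) (stripSize b i) := by
    intro i
    rw [← card_restrict]
    unfold stripSize
    congr 1
    ext z
    simp only [Finset.mem_filter, Finset.mem_univ, true_and, Function.comp]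
    refine ⟨fun hz => ⟨hz, ?_⟩, And.left⟩
    rw [← hz]
    exact pos_lt_stripSize b (φ z)
  rw [hsize, hsize, hF.selected_eq he h, hF.size_eq i j h]

/-- The coefficients of the system are kept. Selection is the same in equivalent strips, so each
equation at selected positions becomes an equation at the renumbered positions, and those at other
positions hold trivially for an extension by zero. -/
theorem IsReducedAlgebra.restrict (h : IsReducedAlgebra b rel Λ)
    (he : extend φ (1 : Matrix Y Y k) ∈ Λ) :
    IsReducedAlgebra (b ∘ φ) rel (restrictAlg φ Λ he) := by
  classical
  have hF := h.frame
  obtain ⟨q, c, hc⟩ := h.system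
  refine ⟨h.monotone.comp φ.monotone, fun i j hij => hF.stripSize_restrict he hij, q, c, ?_⟩
  intro S
  rw [mem_restrictAlg, hc]
  have hsum : ∀ (I J : Quotient rel) (l : Fin (q I J)) (p p' : ℕ) (x₀ y₀ : Y),
      Quotient.mk rel (b (φ x₀)) = I → Quotient.mk rel (b (φ y₀)) = J → pos b (φ x₀) = p →
      pos b (φ y₀) = p' →
      (∑ x with Quotient.mk rel (b x) = I ∧ pos b x = p,
        ∑ y with Quotient.mk rel (b y) = J ∧ pos b y = p' ∧ b x < b y,
          c I J l (b x) (b y) * extend φ S x y) =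
      ∑ x with Quotient.mk rel ((b ∘ φ) x) = I ∧ pos (b ∘ φ) x = pos (b ∘ φ) x₀,
        ∑ y with Quotient.mk rel ((b ∘ φ) y) = J ∧ pos (b ∘ φ) y = pos (b ∘ φ) y₀ ∧
          (b ∘ φ) x < (b ∘ φ) y, c I J l ((b ∘ φ) x) ((b ∘ φ) y) * S x y := by
    intro I J l p p' x₀ y₀ hI hJ hp hp'
    have hmatch : ∀ (K : Quotient rel) (z₀ z : Y), Quotient.mk rel (b (φ z₀)) = K →
        Quotient.mk rel (b (φ z)) = K →
        (pos b (φ z) = pos b (φ z₀) ↔ pos (b ∘ φ) z = pos (b ∘ φ) z₀) := by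
      intro K z₀ z h1 h2
      have h3 : rel (b (φ z)) (b (φ z₀)) := Quotient.exact (h2.trans h1.symm)
      have h4 := hF.match_restrict he z z₀
      unfold Match at h4
      exact ⟨fun e => (h4.mpr ⟨h3, e⟩).2, fun e => (h4.mp ⟨h3, e⟩).2⟩
    subst hp hp'
    symm
    rw [Finset.sum_filter, Finset.sum_filter]
    refine Fintype.sum_of_injective φ φ.injective _ _ ?_ ?_
    · intro u hu
      split_ifs
      · refine Finset.sum_eq_zero fun v _ => ?_
        rw [extend_apply_of_left φ S hu, mul_zero]
      · rfl
    · intro x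
      have hx : (Quotient.mk rel ((b ∘ φ) x) = I ∧ pos (b ∘ φ) x = pos (b ∘ φ) x₀) ↔
          (Quotient.mk rel (b (φ x)) = I ∧ pos b (φ x) = pos b (φ x₀)) :=
        and_congr_right fun e => (hmatch I x₀ x hI e).symm
      refine if_congr hx ?_ rfl
      rw [Finset.sum_filter, Finset.sum_filter]
      refine Fintype.sum_of_injective φ φ.injective _ _ ?_ ?_
      · intro v hv
        rw [extend_apply_of_right φ S _ hv, mul_zero, ite_self]
      · intro y
        refine if_congr ?_ (by rw [extend_apply]; rfl) rfl
        exact and_congr_right fun e => and_congr_left fun _ => (hmatch J y₀ y hJ e).symm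
  refine and_congr ?_ (and_congr ?_ ?_)
  · constructor
    · intro h1 x y hxy
      rw [← extend_apply φ S x y]
      exact h1 _ _ hxy
    · intro h1 u v huv
      by_cases hu : u ∈ Set.range φ
      · by_cases hv : v ∈ Set.range φ
        · obtain ⟨x, rfl⟩ := hu
          obtain ⟨y, rfl⟩ := hv
          rw [extend_apply]
          exact h1 x y huv
        · exact extend_apply_of_right φ S u hv
      · exact extend_apply_of_left φ S hu v
  · constructor
    · intro h1 x y x' y' e1 e2 e3 e4 e5
      have e6 : rel (b (φ y)) (b (φ y')) := by
        have e1' : b (φ x) = b (φ y) := e1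
        have e2' : b (φ x') = b (φ y') := e2
        rw [← e1', ← e2']
        exact e3
      rw [← extend_apply φ S x y, ← extend_apply φ S x' y']
      exact h1 _ _ _ _ e1 e2 e3 ((hF.match_restrict he x x').mp ⟨e3, e4⟩).2
        ((hF.match_restrict he y y').mp ⟨e6, e5⟩).2
    · intro h1 u v u' v' e1 e2 e3 e4 e5
      have hu := hF.range_iff he (show Match b rel u u' from ⟨e3, e4⟩)
      have e6 : rel (b v) (b v') := by rwa [← e1, ← e2]
      have hv := hF.range_iff he (show Match b rel v v' from ⟨e6, e5⟩)
      by_cases hu' : u ∈ Set.range φ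
      · by_cases hv' : v ∈ Set.range φ
        · obtain ⟨x', rfl⟩ := hu.mp hu'
          obtain ⟨y', rfl⟩ := hv.mp hv'
          obtain ⟨x, rfl⟩ := hu'
          obtain ⟨y, rfl⟩ := hv'
          rw [extend_apply, extend_apply]
          exact h1 _ _ _ _ e1 e2 e3 ((hF.match_restrict he x x').mpr ⟨e3, e4⟩).2
            ((hF.match_restrict he y y').mpr ⟨e6, e5⟩).2
        · rw [extend_apply_of_right φ S u hv',
            extend_apply_of_right φ S u' fun e => hv' (hv.mpr e)]
      · rw [extend_apply_of_left φ S hu', extend_apply_of_left φ S fun e => hu' (hu.mpr e)]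
  · constructor
    · intro h1 I J l p p'
      -- A position that occurs in no restricted strip of the class gives an empty sum.
      by_cases hx : ∃ x₀ : Y, Quotient.mk rel (b (φ x₀)) = I ∧ pos (b ∘ φ) x₀ = p
      · obtain ⟨x₀, hI, rfl⟩ := hx
        by_cases hy : ∃ y₀ : Y, Quotient.mk rel (b (φ y₀)) = J ∧ pos (b ∘ φ) y₀ = p'
        · obtain ⟨y₀, hJ, rfl⟩ := hy
          rw [← hsum I J l _ _ x₀ y₀ hI hJ rfl rfl]
          exact h1 _ _ _ _ _
        · refine Finset.sum_eq_zero fun x _ => Finset.sum_eq_zero fun y hy' => ?_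
          simp only [Finset.mem_filter, Finset.mem_univ, true_and] at hy'
          exact absurd ⟨y, hy'.1, hy'.2.1⟩ hy
      · refine Finset.sum_eq_zero fun x hx' => ?_
        simp only [Finset.mem_filter, Finset.mem_univ, true_and] at hx'
        exact absurd ⟨x, hx'.1, hx'.2⟩ hx
    · intro h1 I J l p p'
      -- At an unselected position only zero entries of `extend φ S` enter the equation.
      by_cases hx : ∃ x₀ : Y, Quotient.mk rel (b (φ x₀)) = I ∧ pos b (φ x₀) = p
      · obtain ⟨x₀, hI, hp⟩ := hx
        by_cases hy : ∃ y₀ : Y, Quotient.mk rel (b (φ y₀)) = J ∧ pos b (φ y₀) = p'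
        · obtain ⟨y₀, hJ, hp'⟩ := hy
          rw [hsum I J l p p' x₀ y₀ hI hJ hp hp']
          exact h1 _ _ _ _ _
        · refine Finset.sum_eq_zero fun u _ => Finset.sum_eq_zero fun v hv => ?_
          simp only [Finset.mem_filter, Finset.mem_univ, true_and] at hv
          rw [extend_apply_of_right, mul_zero]
          rintro ⟨y, rfl⟩
          exact hy ⟨y, hv.1, hv.2.1⟩
      · refine Finset.sum_eq_zero fun u hu => Finset.sum_eq_zero fun v _ => ?_
        simp only [Finset.mem_filter, Finset.mem_univ, true_and] at hu
        rw [extend_apply_of_left, mul_zero]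
        rintro ⟨x, rfl⟩
        exact hx ⟨x, hu.1, hu.2⟩

theorem block_extend_iff {A B : Matrix Y Y k} {l r : Fin t} :
    block b (extend φ A) l r = block b (extend φ B) l r ↔
      block (b ∘ φ) A l r = block (b ∘ φ) B l r := by
  rw [block_eq_iff, block_eq_iff]
  constructor
  · intro h x y hx hy
    rw [← extend_apply φ A, ← extend_apply φ B]
    exact h _ _ hx hy
  · intro h u v hu hv
    by_cases hu' : u ∈ Set.range φ
    · by_cases hv' : v ∈ Set.range φ
      · obtain ⟨x, rfl⟩ := hu'
        obtain ⟨y, rfl⟩ := hv'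
        rw [extend_apply, extend_apply]
        exact h x y hu hv
      · rw [extend_apply_of_right φ A u hv', extend_apply_of_right φ B u hv']
    · rw [extend_apply_of_left φ A hu' v, extend_apply_of_left φ B hu' v]

theorem IsStable.restrict {M : Matrix X X k} {he : extend φ (1 : Matrix Y Y k) ∈ Λ} {i j : Fin t}
    (h : IsStable b Λ M i j) :
    IsStable (b ∘ φ) (restrictAlg φ Λ he) (M.submatrix φ φ) i j := by
  intro S hS hu
  rw [← submatrix_conj φ M hu, block_eq_iff]
  intro x y hx hy
  exact block_eq_iff.mp (h _ (extendOne_mem hS) (isUnit_extendOne φ hu)) (φ x) (φ y) hx hy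

theorem HasAddition.of_restrict {M : Matrix X X k} {he : extend φ (1 : Matrix Y Y k) ∈ Λ}
    {l r : Fin t} (h : HasAddition (b ∘ φ) (restrictAlg φ Λ he) (M.submatrix φ φ) l r) :
    HasAddition b Λ M l r := by
  obtain ⟨S, hS, x, y, hx, hy, hne⟩ := h
  refine ⟨extend φ S, hS, φ x, φ y, hx, hy, ?_⟩
  convert hne using 1
  · symm
    rw [Finset.sum_filter, Finset.sum_filter]
    refine Fintype.sum_of_injective φ φ.injective _ _ ?_ ?_
    · intro v hv
      rw [extend_apply_of_left φ S hv, mul_zero, ite_self]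
    · intro z
      rw [extend_apply]
      rfl
  · symm
    rw [Finset.sum_filter, Finset.sum_filter]
    refine Fintype.sum_of_injective φ φ.injective _ _ ?_ ?_
    · intro v hv
      rw [extend_apply_of_right φ S _ hv, zero_mul, ite_self]
    · intro z
      rw [extend_apply]
      rfl

variable [LinearOrder k]

/-- The earlier blocks remain stable after restriction. If the block `(l, r)` becomes stable too,
the condition defining `Λ'` holds automatically and the algebra does not change. Otherwise it is
still the first nonstable block, and its prescribed form passes to the submatrix. -/
theorem StepAt.restrict [Infinite k] {M : Matrix X X k} {Λ' : Subalgebra k (Matrix X X k)}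
    (h : StepAt M Λ Λ') (he : extend φ (1 : Matrix Y Y k) ∈ Λ)
    (he' : extend φ (1 : Matrix Y Y k) ∈ Λ') (hM : M * extend φ 1 = extend φ 1 * M) :
    restrictAlg φ Λ he = restrictAlg φ Λ' he' ∨
      StepAt (M.submatrix φ φ) (restrictAlg φ Λ he) (restrictAlg φ Λ' he') := by
  obtain ⟨t, b, rel, hred, l, r, hns, hst, hr, hR⟩ := h
  have hF := hred.frame
  have hred' := hred.restrict he
  have hF' := hred'.frame
  have hmem : ∀ R, R ∈ restrictAlg φ Λ' he' ↔ R ∈ restrictAlg φ Λ he ∧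
      block (b ∘ φ) (R * M.submatrix φ φ) l r = block (b ∘ φ) (M.submatrix φ φ * R) l r := by
    intro R
    rw [mem_restrictAlg, hR, mem_restrictAlg, extend_mul_eq hM, mul_extend_eq hM,
      block_extend_iff]
  have hst' : ∀ i j, BlockLT i j l r →
      IsStable (b ∘ φ) (restrictAlg φ Λ he) (M.submatrix φ φ) i j :=
    fun i j hij => (hst i j hij).restrict
  by_cases hns' : IsStable (b ∘ φ) (restrictAlg φ Λ he) (M.submatrix φ φ) l r
  · left
    ext R
    rw [hmem, iff_self_and]
    intro hRΛ
    -- Stability speaks of nonsingular elements only; a scalar shift makes `R` nonsingular, and the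
    -- scalar cancels from the commutation condition.
    obtain ⟨c, hc⟩ := exists_isUnit_add_smul R
    have hS : R + c • (1 : Matrix Y Y k) ∈ restrictAlg φ Λ he :=
      Subalgebra.add_mem _ hRΛ (Subalgebra.smul_mem _ (Subalgebra.one_mem _) c)
    have h1 := hns' _ hS hc
    have h2 := agreeBefore_of_stable hS hc hst'
    have h3 := (inv_mul_mul_eq_iff (M := M.submatrix φ φ) hc).mp rfl
    have h4 := h2.block_mul_left hF' hS h1
    rw [← h3, block_eq_iff] at h4
    rw [block_eq_iff]
    intro x y hx hy
    have h5 := h4 x y hx hy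
    rw [Matrix.mul_add, Matrix.add_mul, Matrix.mul_smul, Matrix.smul_mul, Matrix.mul_one,
      Matrix.one_mul, Matrix.add_apply, Matrix.add_apply] at h5
    exact (add_right_cancel h5).symm
  · right
    refine ⟨t, b ∘ φ, rel, hred', l, r, hns', hst', ?_, hmem⟩
    let u : {x : Y // (b ∘ φ) x = l} → {x : X // b x = l} := fun x => ⟨φ x, x.2⟩
    let v : {x : Y // (b ∘ φ) x = r} → {x : X // b x = r} := fun x => ⟨φ x, x.2⟩
    have hu : StrictMono u := fun x y hxy => φ.strictMono hxy
    have hv : StrictMono v := fun x y hxy => φ.strictMono hxy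
    have hru : ∀ x, x ∈ Set.range u ↔ (x : X) ∈ Set.range φ := by
      intro x
      constructor
      · rintro ⟨y, rfl⟩
        exact ⟨y, rfl⟩
      · rintro ⟨y, hy⟩
        exact ⟨⟨y, (congrArg b hy).trans x.2⟩, Subtype.ext hy⟩
    have hrv : ∀ x, x ∈ Set.range v ↔ (x : X) ∈ Set.range φ := by
      intro x
      constructor
      · rintro ⟨y, rfl⟩
        exact ⟨y, rfl⟩
      · rintro ⟨y, hy⟩
        exact ⟨⟨y, (congrArg b hy).trans x.2⟩, Subtype.ext hy⟩
    have huv : ∀ x y, block b M l r x y ≠ 0 → (x ∈ Set.range u ↔ y ∈ Set.range v) := by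
      intro x y hxy
      rw [hru, hrv]
      exact range_iff_of_ne_zero hM hxy
    have hblock : block (b ∘ φ) (M.submatrix φ φ) l r = (block b M l r).submatrix u v := rfl
    rcases hr with ⟨h1, h2⟩ | ⟨h1, h2, h3⟩ | ⟨h1, h2, h3⟩
    · have h0 : block (b ∘ φ) (M.submatrix φ φ) l r = 0 := by
        rw [hblock, h2]
        rfl
      by_cases hadd : HasAddition (b ∘ φ) (restrictAlg φ Λ he) (M.submatrix φ φ) l r
      · exact Or.inl ⟨hadd, h0⟩
      -- The restriction may destroy all additions, but then a zero block is transformed by diagonal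
      -- blocks only and would be stable.
      · refine absurd ?_ hns'
        intro S hS hSu
        have h3 := block_mul_block hF' hS ((inv_mul_mul_eq_iff hSu).mp rfl)
          (agreeBefore_of_stable hS hSu hst').symm hadd
        rw [h0, Matrix.zero_mul] at h3
        rw [h0]
        exact Matrix.mul_left_cancel_of_isUnit (isUnit_block hF' hS hSu l)
          (h3.trans (Matrix.mul_zero _).symm)
    · refine Or.inr (Or.inl ⟨fun h => h1 h.of_restrict, h2, ?_⟩)
      obtain ⟨U, W, hA⟩ := h3.coded
      exact (hA.submatrix hu hv huv).isZeroOneForm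
    · refine Or.inr (Or.inr ⟨fun h => h1 h.of_restrict, h2, ?_⟩)
      obtain ⟨g, h, hA⟩ := h3.coded
      obtain ⟨θ, hθ⟩ := hF.exists_orderIso h2
      have hgh := hA.mono_row.comp_orderIso hA.mono_col hA.range_eq θ
      -- A row and a column with equal codes correspond under `θ`, so they have matching indices and
      -- are selected together.
      obtain ⟨g', h', hA'⟩ := hA.submatrix hu hv (by
        intro x y hxy
        rw [← hgh] at hxy
        rw [← hA.mono_col.injective hxy, hru, hrv]
        exact hF.range_iff he (hθ x)) huv
      exact hA'.isWeyr

/-- Every element of the algebra becomes nonsingular after adding a scalar, which commutes with `M`.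
-/
theorem commute_of_fixed [Infinite k] {M : Matrix X X k}
    (h : ∀ S ∈ Λ, IsUnit S → M * S = S * M) {R : Matrix X X k} (hR : R ∈ Λ) :
    M * R = R * M := by
  obtain ⟨c, hc⟩ := exists_isUnit_add_smul R
  have h1 := h _ (Λ.add_mem hR (Λ.smul_mem Λ.one_mem c)) hc
  rw [Matrix.mul_add, Matrix.add_mul, Matrix.mul_smul, Matrix.smul_mul, Matrix.mul_one,
    Matrix.one_mul] at h1
  exact add_right_cancel h1

theorem le_of_run {M : Matrix X X k} {Λ₁ : Subalgebra k (Matrix X X k)}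
    (h : Relation.ReflTransGen (StepAt M) Λ Λ₁) : Λ₁ ≤ Λ := by
  induction h with
  | refl => exact le_rfl
  | tail _ h ih => exact h.le.trans ih

/-- The direct summand of a canonical matrix that is given by a diagonal idempotent is canonical. -/
theorem isCanonical_restrict [Infinite k] {M : Matrix X X k} {Λ₁ : Subalgebra k (Matrix X X k)}
    (h : Relation.ReflTransGen (StepAt M) Λ Λ₁) (hfix : ∀ S ∈ Λ₁, IsUnit S → M * S = S * M)
    (he₁ : extend φ (1 : Matrix Y Y k) ∈ Λ₁) (he : extend φ (1 : Matrix Y Y k) ∈ Λ) :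
    IsCanonical (restrictAlg φ Λ he) (M.submatrix φ φ) := by
  have hM := commute_of_fixed hfix he₁
  rw [isCanonical_iff]
  refine ⟨restrictAlg φ Λ₁ he₁, ?_, ?_⟩
  · induction h using Relation.ReflTransGen.head_induction_on with
    | refl => exact .refl
    | @head Λ Λ' h h' ih =>
      have he' := le_of_run h' he₁
      rcases h.restrict he he' hM with h1 | h1
      · rw [h1]
        exact ih he'
      · exact .head h1 (ih he')
  · intro S hS _
    have h1 := commute_of_fixed hfix hS
    rw [extend_mul_eq hM, mul_extend_eq hM] at h1
    ext x y
    rw [← extend_apply φ (M.submatrix φ φ * S), h1, extend_apply]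

end Restriction

/-! ### The stabilizer of a canonical matrix without diagonal idempotents -/

section Local

variable {k X : Type*} [Field k] [LinearOrder k] [Fintype X] [LinearOrder X] {t : ℕ}
  {b : X → Fin t} {rel : Setoid (Fin t)} {Λ Λ₁ : Subalgebra k (Matrix X X k)} {M : Matrix X X k}

/-- Each step only demands commutation with `M` at one block. With `commute_of_fixed` this
identifies the last algebra as the centralizer of `M` in `Λ`. -/
theorem mem_of_commute (h : Relation.ReflTransGen (StepAt M) Λ Λ₁) {R : Matrix X X k}
    (hR : R ∈ Λ) (hc : M * R = R * M) : R ∈ Λ₁ := by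
  induction h with
  | refl => exact hR
  | tail _ h ih =>
    obtain ⟨t, b, rel, _, l, r, _, _, _, hR'⟩ := h
    exact (hR' R).mpr ⟨ih, by rw [hc]⟩

/-- All diagonal idempotents in `Λ` are trivial. -/
def NoDiagonalIdempotents (Λ : Subalgebra k (Matrix X X k)) : Prop :=
  ∀ d : X → k, (∀ x, d x = 0 ∨ d x = 1) → diagonal d ∈ Λ → ∀ x y, d x = d y

/-- The indicator of a level set of an `E`-invariant function is a diagonal idempotent of `Λ₁`,
hence trivial; in effect `E` connects all indices. -/
theorem NoDiagonalIdempotents.eq_of_invariant (hno : NoDiagonalIdempotents Λ₁) {E : X → X → Prop}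
    (hE : ∀ d : X → k, (∀ x y, E x y → d x = d y) → diagonal d ∈ Λ₁) {τ : Type*} (F : X → τ)
    (hF : ∀ x y, E x y → F x = F y) (x y : X) : F x = F y := by
  classical
  have h := hno (fun z => if F z = F x then 1 else 0) (fun z => by
    split_ifs
    · exact Or.inr rfl
    · exact Or.inl rfl) (hE _ fun u v huv => by
      rw [hF u v huv]) x y
  by_contra hne
  simp [Ne.symm hne] at h

/-- All elements of `Λ` are upper triangular matrices with equal diagonal entries. -/
def IsTriangular (Λ : Subalgebra k (Matrix X X k)) : Prop :=
  ∀ R ∈ Λ, (∀ x y, y < x → R x y = 0) ∧ ∀ x y, R x x = R y y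

/-- The label `F` is invariant, hence constant, yet it separates the rows of a strip. So every strip
has at most one row, and block-triangular means triangular. The diagonal entries of `R` are
themselves an invariant function. -/
theorem Frame.isTriangular_of_labels (hF : Frame b rel Λ) (hle : Λ₁ ≤ Λ)
    (hno : NoDiagonalIdempotents Λ₁) {E : X → X → Prop}
    (hE : ∀ d : X → k, (∀ x y, E x y → d x = d y) → diagonal d ∈ Λ₁)
    (hdiag : ∀ R ∈ Λ₁, ∀ x y, E x y → R x x = R y y) {τ : Type*} (F : X → τ)
    (hFE : ∀ x y, E x y → F x = F y) (hinj : ∀ x y, b x = b y → F x = F y → x = y) :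
    IsTriangular Λ₁ := by
  intro R hR
  refine ⟨fun x y hxy => ?_, hno.eq_of_invariant hE _ (hdiag R hR)⟩
  rcases (hF.monotone hxy.le).lt_or_eq with h | h
  · exact hF.upper R (hle hR) x y h
  · exact absurd (hinj y x h (hno.eq_of_invariant hE F hFE y x)) hxy.ne

theorem Frame.isTriangular_self (hF : Frame b rel Λ) (hno : NoDiagonalIdempotents Λ) :
    IsTriangular Λ :=
  hF.isTriangular_of_labels le_rfl hno (E := Match b rel) (fun _ hd => hF.diagonal_mem hd)
    (fun R hR x y hxy => hF.diag_eq R hR x x y y rfl rfl hxy hxy) (pos b) (fun _ _ h => h.2)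
    (fun _ _ => pos_inj)

/-- For a zero block or [0 I; 0 0] the connections made by the step respect a labelling that is
injective on strips. For a Weyr block they respect the pair (eigenvalue, chain number); its
constancy leaves one Jordan block, whose centralizer is triangular. -/
theorem StepAt.isTriangular (h : StepAt M Λ Λ₁) (hcomm : ∀ R ∈ Λ₁, M * R = R * M)
    (hno : NoDiagonalIdempotents Λ₁) : IsTriangular Λ₁ := by
  have hle := h.le
  obtain ⟨t, b, rel, hred, l, r, hns, hst, hr, hmem⟩ := h
  have hF := hred.frame
  -- Indices are joined if they match in `Λ`, or if they are the row and the column of a nonzero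
  -- entry of the reduced block; a diagonal matrix constant along `E` satisfies the condition that
  -- defines `Λ₁`.
  let E : X → X → Prop := fun x y => Match b rel x y ∨ (b x = l ∧ b y = r ∧ M x y ≠ 0)
  have hE : ∀ d : X → k, (∀ x y, E x y → d x = d y) → diagonal d ∈ Λ₁ := by
    intro d hd
    rw [hmem, block_eq_iff]
    refine ⟨hF.diagonal_mem fun x y hxy => hd x y (Or.inl hxy), fun x y hx hy => ?_⟩
    rw [diagonal_mul, mul_diagonal]
    by_cases h0 : M x y = 0
    · rw [h0, mul_zero, zero_mul]
    · rw [hd x y (Or.inr ⟨hx, hy, h0⟩), mul_comm]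
  have hdiag₁ : ∀ R ∈ Λ₁, ∀ x y, Match b rel x y → R x x = R y y := fun R hR x y hxy =>
    hF.diag_eq R (hle hR) x x y y rfl rfl hxy hxy
  have hPQ : ¬ HasAddition b Λ M l r → ∀ R ∈ Λ₁,
      block b R l l * block b M l r = block b M l r * block b R r r := fun hadd R hR =>
    block_mul_block hF (hle hR) (hcomm R hR) (fun _ _ _ => rfl) hadd
  have hm : ∀ z j, rel (b z) j → ∃ y : {y // b y = j}, Match b rel z y := by
    intro z j hz
    obtain ⟨y, hy, hm⟩ := hF.exists_match hz
    exact ⟨⟨y, hy⟩, hm⟩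
  -- `m z j` is the index of the strip `j` that matches `z`; it carries labels from the strips `l`
  -- and `r` to all equivalent ones.
  choose m hm using hm
  have hm_eq : ∀ {z w j} (hz : rel (b z) j) (hw : rel (b w) j), Match b rel z w →
      m z j hz = m w j hw := by
    intro z w j hz hw h
    refine Subtype.ext (((hm z j hz).symm.trans (h.trans (hm w j hw))).eq ?_)
    rw [(m z j hz).2, (m w j hw).2]
  have hm_self : ∀ {z j} (hz : b z = j) (h : rel (b z) j), m z j h = ⟨z, hz⟩ := by
    intro z j hz h
    refine Subtype.ext ((hm z j h).symm.eq ?_)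
    rw [(m z j h).2, hz]
  have hm_inj : ∀ {z w j} (hz : rel (b z) j) (hw : rel (b w) j), b z = b w →
      m z j hz = m w j hw → z = w := by
    intro z w j hz hw h e
    refine ((hm z j hz).trans ?_).eq h
    rw [e]
    exact (hm w j hw).symm
  rcases hr with ⟨_, h0⟩ | ⟨hadd, hrel, hA⟩ | ⟨hadd, hrel, hA⟩
  · have hE0 : ∀ x y, E x y → Match b rel x y := by
      rintro x y (h | ⟨hx, hy, h⟩)
      · exact h
      · exact absurd (congrFun (congrFun h0 ⟨x, hx⟩) ⟨y, hy⟩) h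
    exact hF.isTriangular_of_labels hle hno hE (fun R hR x y h => hdiag₁ R hR x y (hE0 x y h))
      (pos b) (fun x y h => (hE0 x y h).2) (fun _ _ => pos_inj)
  · classical
    obtain ⟨U, W, hC⟩ := hA.coded
    obtain ⟨F₁, F₂, hF₁, hF₂, hF₁₂⟩ := hA.exists_labels
    -- The classes of `l` and `r` differ, so row labels and column labels can be used on them
    -- independently. All other strips are labelled by position.
    let F : X → ℤ := fun z => if h : rel (b z) l then F₁ (m z l h)
      else if h' : rel (b z) r then F₂ (m z r h') else pos b z
    refine hF.isTriangular_of_labels hle hno hE ?_ F ?_ ?_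
    · rintro R hR x y (h | ⟨rfl, rfl, h⟩)
      · exact hdiag₁ R hR x y h
      · exact hC.diag_eq (hPQ hadd R hR) (x := ⟨x, rfl⟩) (y := ⟨y, rfl⟩) h
    · rintro x y (h | ⟨hx, hy, h⟩)
      · by_cases hx : rel (b x) l
        · have hy : rel (b y) l := rel.trans' (rel.symm' h.1) hx
          simp only [F, dif_pos hx, dif_pos hy, hm_eq hx hy h]
        · have hy : ¬ rel (b y) l := fun e => hx (rel.trans' h.1 e)
          by_cases hx' : rel (b x) r
          · have hy' : rel (b y) r := rel.trans' (rel.symm' h.1) hx'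
            simp only [F, dif_neg hx, dif_neg hy, dif_pos hx', dif_pos hy', hm_eq hx' hy' h]
          · have hy' : ¬ rel (b y) r := fun e => hx' (rel.trans' h.1 e)
            simp only [F, dif_neg hx, dif_neg hy, dif_neg hx', dif_neg hy', h.2]
      · have hxl : rel (b x) l := hx ▸ rel.refl' _
        have hyr : rel (b y) r := hy ▸ rel.refl' _
        have hyl : ¬ rel (b y) l := fun e => hrel (rel.trans' (rel.symm' e) hyr)
        simp only [F, dif_pos hxl, dif_neg hyl, dif_pos hyr]
        rw [hm_self hx hxl, hm_self hy hyr]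
        exact hF₁₂ _ _ h
    · intro x y hxy h
      by_cases hx : rel (b x) l
      · have hy : rel (b y) l := hxy ▸ hx
        simp only [F, dif_pos hx, dif_pos hy] at h
        exact hm_inj hx hy hxy (hF₁ h)
      · have hy : ¬ rel (b y) l := hxy ▸ hx
        by_cases hx' : rel (b x) r
        · have hy' : rel (b y) r := hxy ▸ hx'
          simp only [F, dif_neg hx, dif_neg hy, dif_pos hx', dif_pos hy'] at h
          exact hm_inj hx' hy' hxy (hF₂ h)
        · have hy' : ¬ rel (b y) r := hxy ▸ hx'
          simp only [F, dif_neg hx, dif_neg hy, dif_neg hx', dif_neg hy', Nat.cast_inj] at h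
          exact pos_inj hxy h
  · classical
    obtain ⟨g, h, hC⟩ := hA.coded
    obtain ⟨θ, hθ⟩ := hF.exists_orderIso hrel
    have hgh := congrFun (hC.mono_row.comp_orderIso hC.mono_col hC.range_eq θ)
    have hC' := hC.submatrix_iso θ
    have hcomm' : ∀ R ∈ Λ₁, block b R l l * (block b M l r).submatrix id θ =
        (block b M l r).submatrix id θ * block b R l l := by
      intro R hR
      have h1 := congrArg (fun A => A.submatrix id θ) (hPQ hadd R hR)
      have h2 : block b R l l = (block b R r r).submatrix θ θ := by
        ext x y
        exact hF.diag_eq R (hle hR) x y (θ x) (θ y) (x.2.trans y.2.symm)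
          ((θ x).2.trans (θ y).2.symm) (hθ x) (hθ y)
      ext x y
      have h3 := congrFun (congrFun h1 x) y
      simp only [submatrix_apply, id, mul_apply] at h3 ⊢
      rw [h3, ← Equiv.sum_comp θ.toEquiv]
      refine Finset.sum_congr rfl fun z _ => ?_
      rw [h2]
      rfl
    -- The strip number `j` is dropped from the code because it changes along a Jordan chain; `none`
    -- marks the strips outside the class of `l`.
    let F : X → Option (k × ℕ) := fun z => if h : rel (b z) l then
      some ((ofLex (g (m z l h))).1, (ofLex (ofLex (g (m z l h))).2).2) else none
    have hF_pos : ∀ {z} (hz : rel (b z) l), F z =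
        some ((ofLex (g (m z l hz))).1, (ofLex (ofLex (g (m z l hz))).2).2) :=
      fun hz => dif_pos hz
    have hFE : ∀ x y, E x y → F x = F y := by
      rintro x y (h' | ⟨hx, hy, h'⟩)
      · by_cases hx : rel (b x) l
        · have hy : rel (b y) l := rel.trans' (rel.symm' h'.1) hx
          rw [hF_pos hx, hF_pos hy, hm_eq hx hy h']
        · have hy : ¬ rel (b y) l := fun e => hx (rel.trans' h'.1 e)
          simp only [F, dif_neg hx, dif_neg hy]
      · have hxl : rel (b x) l := hx ▸ rel.refl' _
        have hyl : rel (b y) l := by rw [hy]; exact rel.symm' hrel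
        have hθm : θ (m y l hyl) = ⟨y, hy⟩ := by
          refine Subtype.ext (((hθ _).symm.trans (hm y l hyl).symm).eq ?_)
          rw [(θ _).2, hy]
        rw [hF_pos hxl, hF_pos hyl, hm_self hx hxl]
        have h1 : g (m y l hyl) = h ⟨y, hy⟩ := by rw [← hgh, Function.comp, hθm]
        rw [h1]
        rcases hC.entry_ne_zero (x := ⟨x, hx⟩) (y := ⟨y, hy⟩) h' with e | ⟨a, j, p, e, e'⟩
        · rw [e]
        · rw [e, e']
          rfl
    obtain ⟨x₀, y₀, hx₀, hy₀⟩ := exists_of_not_isStable hns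
    have hx₀l : rel (b x₀) l := hx₀ ▸ rel.refl' _
    have hconst := hno.eq_of_invariant hE F hFE
    -- The nonstable block has a row `x₀`, labelled by a `some`. Labels are constant, so no index is
    -- labelled `none`.
    have hall : ∀ z, rel (b z) l := by
      intro z
      by_contra hz
      have h1 := hconst z x₀
      rw [hF_pos hx₀l] at h1
      simp only [F, dif_neg hz] at h1
      exact Option.some_ne_none _ h1.symm
    intro R hR
    refine ⟨fun x y hxy => ?_, hno.eq_of_invariant hE _ ?_⟩
    · rcases (hF.monotone hxy.le).lt_or_eq with h' | h'
      · exact hF.upper R (hle hR) x y h'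
      · have hxm := hm x l (hall x)
        have hym := hm y l (hall y)
        -- The entry is carried over to the diagonal block of the strip `l`, which commutes with a
        -- single Jordan block.
        rw [hF.diag_eq R (hle hR) x y _ _ h'.symm
          ((m x l (hall x)).2.trans (m y l (hall y)).2.symm) hxm hym]
        refine hC'.upper (hcomm' R hR) (a := (ofLex (g (m x₀ l hx₀l))).1)
          (p := (ofLex (ofLex (g (m x₀ l hx₀l))).2).2) ?_ (x := m x l (hall x))
          (y := m y l (hall y)) ?_
        · intro z
          have h1 := hconst z x₀
          rw [hF_pos (hall z), hF_pos hx₀l, hm_self z.2 (hall z)] at h1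
          have h2 := Prod.mk.inj (Option.some.inj h1)
          refine ⟨(ofLex (ofLex (g z)).2).1, ?_⟩
          rw [← h2.1, ← h2.2]
          rfl
        · have h1 := (m y l (hall y)).2.trans (m x l (hall x)).2.symm
          change (m y l (hall y)).1 < (m x l (hall x)).1
          rw [← pos_lt_pos_iff h1, ← hxm.2, ← hym.2]
          exact pos_lt_pos h' hxy
    · rintro x y (h' | ⟨rfl, rfl, h'⟩)
      · exact hdiag₁ R hR x y h'
      · obtain ⟨y', hy'⟩ := θ.surjective ⟨y, rfl⟩
        have h1 := hC'.diag_eq (hcomm' R hR) (x := ⟨x, rfl⟩) (y := y') (by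
          rw [submatrix_apply, hy']
          exact h')
        have h2 := hdiag₁ R hR y' (θ y') (hθ y')
        rw [hy'] at h2
        exact h1.trans h2

/-- Only the last step matters, since the assumption on idempotents concerns the last algebra; for
an empty run the positions serve as labels. -/
theorem isTriangular_of_run (h : Relation.ReflTransGen (StepAt M) Λ Λ₁) (hF : Frame b rel Λ)
    (hcomm : ∀ R ∈ Λ₁, M * R = R * M) (hno : NoDiagonalIdempotents Λ₁) : IsTriangular Λ₁ := by
  rcases h.cases_tail with rfl | ⟨Λ', _, h'⟩
  · exact hF.isTriangular_self hno
  · exact h'.isTriangular hcomm hno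

/-- The characteristic polynomial is a power of `X - c` for the common diagonal entry `c`, and
Cayley–Hamilton applies. -/
theorem IsTriangular.isNilpotent_sub (h : IsTriangular Λ) {R : Matrix X X k} (hR : R ∈ Λ) :
    ∃ c : k, IsNilpotent (R - c • (1 : Matrix X X k)) := by
  obtain ⟨h1, h2⟩ := h R hR
  rcases isEmpty_or_nonempty X with hX | ⟨⟨x₀⟩⟩
  · exact ⟨0, 1, Subsingleton.elim _ _⟩
  · refine ⟨R x₀ x₀, Fintype.card X, ?_⟩
    have h3 : R.charpoly = (Polynomial.X - Polynomial.C (R x₀ x₀)) ^ Fintype.card X := by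
      rw [charpoly_of_isUpperTriangular R fun x y hxy => h1 x y hxy,
        Finset.prod_congr rfl fun x _ => by rw [h2 x x₀]]
      simp
    have h4 := aeval_self_charpoly R
    rw [h3] at h4
    simpa [Algebra.algebraMap_eq_smul_one] using h4

/-- If the diagonal entry is zero, the idempotent is nilpotent, hence 0; otherwise it is invertible,
hence 1. -/
theorem IsTriangular.eq_zero_or_one (h : IsTriangular Λ) {R : Matrix X X k} (hR : R ∈ Λ)
    (hi : R * R = R) : R = 0 ∨ R = 1 := by
  obtain ⟨c, hc⟩ := h.isNilpotent_sub hR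
  by_cases h0 : c = 0
  · left
    rw [h0, zero_smul, sub_zero] at hc
    obtain ⟨n, hn⟩ := hc
    have h1 : R ^ (n + 1) = R := IsIdempotentElem.pow_succ_eq n hi
    rw [← h1, pow_succ, hn, Matrix.zero_mul]
  · right
    have hu : IsUnit (c • (1 : Matrix X X k)) := by
      rw [← Algebra.algebraMap_eq_smul_one]
      exact (isUnit_iff_ne_zero.mpr h0).map (algebraMap k (Matrix X X k))
    have h1 : IsUnit (c • (1 : Matrix X X k) + (R - c • (1 : Matrix X X k))) := by
      refine IsNilpotent.isUnit_add_left_of_commute hc hu ?_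
      rw [← Algebra.algebraMap_eq_smul_one]
      exact (Algebra.commutes c _).symm
    rw [add_sub_cancel] at h1
    exact h1.mul_left_cancel (by rw [hi, Matrix.mul_one])

end Local

/-! ### Rectangular block matrices -/

namespace Idx

variable {t : ℕ} {n : Fin t → ℕ}

theorem sum_eq {R : Type*} [AddCommMonoid R] (g : Idx n → R) :
    ∑ x, g x = ∑ i, ∑ s : Fin (n i), g (mk i s) :=
  Fintype.sum_sigma (fun x : Σ i : Fin t, Fin (n i) => g (toLex x))

theorem exists_mk (x : Idx n) : ∃ i p, x = mk i p := ⟨x.strip, x.row, rfl⟩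

theorem mk_inj {i : Fin t} {p q : Fin (n i)} : mk i p = mk i q ↔ p = q := by
  constructor
  · intro h
    ext
    exact congrArg (fun z : Idx n => (z.row : ℕ)) h
  · rintro rfl
    rfl

theorem mk_eq_mk {i j : Fin t} {p : Fin (n i)} {q : Fin (n j)} :
    mk i p = mk j q ↔ i = j ∧ (p : ℕ) = q := by
  constructor
  · intro h
    exact ⟨congrArg (fun z : Idx n => z.strip) h, congrArg (fun z : Idx n => (z.row : ℕ)) h⟩
  · rintro ⟨rfl, h⟩
    rw [Fin.ext h]

theorem mk_lt_mk {i j : Fin t} {p : Fin (n i)} {q : Fin (n j)} :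
    mk i p < mk j q ↔ i < j ∨ (i = j ∧ (p : ℕ) < q) := by
  constructor
  · intro h
    rcases h with ⟨_, _, h⟩ | ⟨_, _, h⟩
    · exact Or.inl h
    · exact Or.inr ⟨rfl, h⟩
  · rintro (h | ⟨rfl, h⟩)
    · exact Sigma.Lex.left _ _ h
    · exact Sigma.Lex.right _ _ h

theorem strip_mono : Monotone (strip : Idx n → Fin t) := by
  intro x y h
  rcases h.lt_or_eq with h | rfl
  · obtain ⟨i, p, rfl⟩ := exists_mk x
    obtain ⟨j, q, rfl⟩ := exists_mk y
    rcases mk_lt_mk.mp h with h | h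
    · exact h.le
    · exact h.1.le
  · exact le_rfl

end Idx

section Rect

variable {k : Type*} [Field k] {t : ℕ} {l m n : Fin t → ℕ}

/-- The entry in row `p` and column `q` of the block with number `(i, j)` of a rectangular
block matrix. -/
def rentry (N : Matrix (Idx m) (Idx n) k) (i j : Fin t) (p q : ℕ) : k :=
  if h : p < m i ∧ q < n j then N (Idx.mk i ⟨p, h.1⟩) (Idx.mk j ⟨q, h.2⟩) else 0

theorem rentry_of_lt (N : Matrix (Idx m) (Idx n) k) {i j : Fin t} {p q : ℕ} (hp : p < m i)
    (hq : q < n j) : rentry N i j p q = N (Idx.mk i ⟨p, hp⟩) (Idx.mk j ⟨q, hq⟩) :=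
  dif_pos ⟨hp, hq⟩

theorem rentry_apply (N : Matrix (Idx m) (Idx n) k) (x : Idx m) (y : Idx n) :
    rentry N x.strip y.strip x.row y.row = N x y :=
  dif_pos ⟨x.row.2, y.row.2⟩

theorem rentry_of_not_left (N : Matrix (Idx m) (Idx n) k) {i j : Fin t} {p q : ℕ}
    (h : ¬ p < m i) : rentry N i j p q = 0 := dif_neg fun e => h e.1

theorem rentry_of_not_right (N : Matrix (Idx m) (Idx n) k) {i j : Fin t} {p q : ℕ}
    (h : ¬ q < n j) : rentry N i j p q = 0 := dif_neg fun e => h e.2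

theorem rentry_ext {M N : Matrix (Idx m) (Idx n) k}
    (h : ∀ i j p q, p < m i → q < n j → rentry M i j p q = rentry N i j p q) : M = N := by
  ext x y
  rw [← rentry_apply M, ← rentry_apply N]
  exact h _ _ _ _ x.row.2 y.row.2

theorem rentry_add (M N : Matrix (Idx m) (Idx n) k) (i j : Fin t) (p q : ℕ) :
    rentry (M + N) i j p q = rentry M i j p q + rentry N i j p q := by
  unfold rentry
  split_ifs <;> simp

theorem rentry_smul (c : k) (N : Matrix (Idx m) (Idx n) k) (i j : Fin t) (p q : ℕ) :
    rentry (c • N) i j p q = c * rentry N i j p q := by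
  unfold rentry
  split_ifs <;> simp

theorem rentry_mul (M : Matrix (Idx l) (Idx m) k) (N : Matrix (Idx m) (Idx n) k) (i j : Fin t)
    (p q : ℕ) : rentry (M * N) i j p q =
      ∑ c, ∑ s ∈ Finset.range (∑ i, m i), rentry M i c p s * rentry N c j s q := by
  by_cases h : p < l i ∧ q < n j
  · rw [rentry_of_lt _ h.1 h.2, mul_apply, Idx.sum_eq]
    refine Finset.sum_congr rfl fun c _ => ?_
    have hm : m c ≤ ∑ i, m i :=
      Finset.single_le_sum (fun _ _ => Nat.zero_le _) (Finset.mem_univ c)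
    rw [← Finset.sum_subset (Finset.range_subset_range.mpr hm)]
    · rw [Finset.sum_range]
      refine Finset.sum_congr rfl fun s _ => ?_
      rw [rentry_of_lt M h.1 s.2, rentry_of_lt N s.2 h.2]
    · intro s _ hs
      rw [rentry_of_not_right M (by simpa using hs), zero_mul]
  · have e1 : rentry (M * N) i j p q = 0 := dif_neg h
    rw [e1]
    symm
    refine Finset.sum_eq_zero fun c _ => Finset.sum_eq_zero fun s _ => ?_
    by_cases hp : p < l i
    · rw [rentry_of_not_right N fun hq => h ⟨hp, hq⟩, mul_zero]
    · rw [rentry_of_not_left M hp, zero_mul]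

/-- The block matrix with given entries of the blocks. -/
def ofEntry (f : Fin t → Fin t → ℕ → ℕ → k) : Matrix (Idx m) (Idx n) k :=
  Matrix.of fun x y => f x.strip y.strip x.row y.row

theorem ofEntry_mk (f : Fin t → Fin t → ℕ → ℕ → k) (i j : Fin t) (p : Fin (m i))
    (q : Fin (n j)) : (ofEntry f : Matrix (Idx m) (Idx n) k) (Idx.mk i p) (Idx.mk j q) =
      f i j p q := rfl

theorem rentry_ofEntry (f : Fin t → Fin t → ℕ → ℕ → k) (i j : Fin t) (p q : ℕ) :
    rentry (ofEntry f : Matrix (Idx m) (Idx n) k) i j p q =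
      if p < m i ∧ q < n j then f i j p q else 0 := by
  unfold rentry
  split_ifs <;> rfl

/-- The diagonal block with number `i`. -/
def diagBlock (S : Matrix (Idx m) (Idx n) k) (i : Fin t) : Matrix (Fin (m i)) (Fin (n i)) k :=
  Matrix.of fun p q => S (Idx.mk i p) (Idx.mk i q)

/-- The matrix is upper block-triangular. -/
def IsBlockUpper (S : Matrix (Idx m) (Idx n) k) : Prop :=
  ∀ x y, y.strip < x.strip → S x y = 0

theorem diagBlock_mul {S : Matrix (Idx l) (Idx m) k} {T : Matrix (Idx m) (Idx n) k}
    (hS : IsBlockUpper S) (hT : IsBlockUpper T) (i : Fin t) :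
    diagBlock (S * T) i = diagBlock S i * diagBlock T i := by
  ext p q
  simp only [diagBlock, of_apply, mul_apply]
  rw [Idx.sum_eq, Finset.sum_eq_single i]
  · intro c _ hc
    refine Finset.sum_eq_zero fun s _ => ?_
    rcases lt_or_gt_of_ne hc with h | h
    · rw [hS _ _ (by exact h), zero_mul]
    · rw [hT _ _ (by exact h), mul_zero]
  · simp

theorem diagBlock_one (i : Fin t) : diagBlock (1 : Matrix (Idx n) (Idx n) k) i = 1 := by
  ext p q
  simp only [diagBlock, of_apply, one_apply, Idx.mk_inj]

theorem isUnit_of_diagBlock {S : Matrix (Idx n) (Idx n) k} (hS : IsBlockUpper S)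
    (h : ∀ i, diagBlock S i = 1) : IsUnit S := by
  have hd : ∀ i (p q : Fin (n i)), S (Idx.mk i p) (Idx.mk i q) =
      (1 : Matrix (Fin (n i)) (Fin (n i)) k) p q := fun i p q => congrFun (congrFun (h i) p) q
  rw [Matrix.isUnit_iff_isUnit_det, Matrix.det_of_isUpperTriangular, Finset.prod_eq_one]
  · exact isUnit_one
  · intro x _
    obtain ⟨i, p, rfl⟩ := Idx.exists_mk x
    rw [hd, one_apply_eq]
  · intro x y hxy
    change y < x at hxy
    rcases (Idx.strip_mono hxy.le).lt_or_eq with h' | h'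
    · exact hS x y h'
    · obtain ⟨i, p, rfl⟩ := Idx.exists_mk x
      obtain ⟨j, q, rfl⟩ := Idx.exists_mk y
      obtain rfl : j = i := h'
      rw [hd, one_apply_ne]
      rintro rfl
      exact lt_irrefl _ hxy

/-- An idempotent matrix is the product of matrices `U` and `V` with `VU = 1`. -/
theorem exists_split_idempotent {N : ℕ} {E : Matrix (Fin N) (Fin N) k} (hE : E * E = E) :
    ∃ (r : ℕ) (U : Matrix (Fin N) (Fin r) k) (V : Matrix (Fin r) (Fin N) k),
      U * V = E ∧ V * U = 1 := by
  let f := Matrix.toLin' E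
  have hf : f ∘ₗ f = f := by
    rw [← Matrix.toLin'_mul, hE]
  let W := LinearMap.range f
  -- In coordinates of the image of `E`, the factor `U` is the inclusion of the image and `V` is the
  -- corestriction of `E`.
  let β : Module.Basis (Fin (Module.finrank k W)) k W := Module.finBasis k W
  let u : (Fin (Module.finrank k W) → k) →ₗ[k] (Fin N → k) :=
    W.subtype ∘ₗ β.equivFun.symm.toLinearMap
  let v : (Fin N → k) →ₗ[k] (Fin (Module.finrank k W) → k) :=
    β.equivFun.toLinearMap ∘ₗ f.rangeRestrict
  have huv : u ∘ₗ v = f := by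
    ext x
    simp [u, v]
  have hvu : v ∘ₗ u = LinearMap.id := by
    have h1 : f.rangeRestrict ∘ₗ W.subtype = LinearMap.id := by
      refine LinearMap.ext fun w => Subtype.ext ?_
      obtain ⟨w, x, rfl⟩ := w
      exact LinearMap.congr_fun hf x
    refine LinearMap.ext fun x => ?_
    have h2 := LinearMap.congr_fun h1 (β.equivFun.symm x)
    simp only [LinearMap.comp_apply, LinearMap.id_apply, Submodule.subtype_apply] at h2
    simp only [u, v, LinearMap.comp_apply, Submodule.subtype_apply, LinearEquiv.coe_coe, h2,
      LinearEquiv.apply_symm_apply, LinearMap.id_apply]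
  refine ⟨_, LinearMap.toMatrix' u, LinearMap.toMatrix' v, ?_, ?_⟩
  · rw [← LinearMap.toMatrix'_comp, huv]
    exact LinearMap.toMatrix'_toLin' E
  · rw [← LinearMap.toMatrix'_comp, hvu, LinearMap.toMatrix'_id]

namespace Problem

variable (P : Problem k t)

open Classical in
/-- The matrix formed by the `(p, q)` entries of the blocks `N_{ij}` with `i` equivalent to `a`
and `j` equivalent to `b`. -/
noncomputable def rslice (N : Matrix (Idx m) (Idx n) k) (a b : Fin t) (p q : ℕ) :
    Matrix (Fin t) (Fin t) k :=
  Matrix.of fun i j => if P.rel a i ∧ P.rel b j then rentry N i j p q else 0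

/-- The space `W_{m × n}` of rectangular block matrices. -/
noncomputable def rect (W : Submodule k (Matrix (Fin t) (Fin t) k)) (m n : Fin t → ℕ) :
    Submodule k (Matrix (Idx m) (Idx n) k) where
  carrier := {N | ∀ a b p q, P.rslice N a b p q ∈ W}
  zero_mem' := by
    intro a b p q
    have : P.rslice (0 : Matrix (Idx m) (Idx n) k) a b p q = 0 := by
      ext i j
      simp [rslice, rentry]
    rw [this]
    exact W.zero_mem
  add_mem' := by
    intro M N hM hN a b p q
    have : P.rslice (M + N) a b p q = P.rslice M a b p q + P.rslice N a b p q := by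
      ext i j
      simp only [rslice, of_apply, Matrix.add_apply, rentry_add]
      split_ifs <;> simp
    rw [this]
    exact W.add_mem (hM a b p q) (hN a b p q)
  smul_mem' := by
    intro c N hN a b p q
    have : P.rslice (c • N) a b p q = c • P.rslice N a b p q := by
      ext i j
      simp only [rslice, of_apply, Matrix.smul_apply, rentry_smul]
      split_ifs <;> simp
    rw [this]
    exact W.smul_mem c (hN a b p q)

/-- The space `Γ_{m × n}`. -/
noncomputable abbrev gammaRect (m n : Fin t → ℕ) : Submodule k (Matrix (Idx m) (Idx n) k) :=
  P.rect (Subalgebra.toSubmodule P.Γ) m n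

variable {P}

theorem mem_gammaRect_iff {S : Matrix (Idx n) (Idx n) k} :
    S ∈ P.gammaRect n n ↔ S ∈ P.gammaSpace n := (mem_blowUp_iff gamma_sandwich).symm

theorem mem_rect_V_iff {S : Matrix (Idx n) (Idx n) k} :
    S ∈ P.rect P.V n n ↔ S ∈ P.blowUp P.V n :=
  (mem_blowUp_iff fun A hA B hB C hC => P.mul_right B hB _ (P.mul_left A hA C hC)).symm

theorem mem_gammaAlg_iff {hn : P.IsStepSequence n} {S : Matrix (Idx n) (Idx n) k} :
    S ∈ P.gammaAlg n hn ↔ S ∈ P.gammaRect n n := mem_gammaRect_iff.symm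

open Classical in
-- The sum over the middle strips is grouped by equivalence classes; inside a class it is a product
-- of slices. This reduces products of block matrices to products of `t × t` matrices.
theorem rslice_mul (M : Matrix (Idx l) (Idx m) k) (N : Matrix (Idx m) (Idx n) k) (a b : Fin t)
    (p q : ℕ) : P.rslice (M * N) a b p q = ∑ c : Quotient P.rel,
      ∑ s ∈ Finset.range (∑ i, m i), P.rslice M a c.out p s * P.rslice N c.out b s q := by
  ext i j
  have hout : ∀ (c : Quotient P.rel) (m : Fin t), P.rel c.out m ↔ Quotient.mk P.rel m = c := by
    intro c m
    constructor
    · intro h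
      rw [← Quotient.out_eq c]
      exact (Quotient.sound h).symm
    · rintro rfl
      exact Quotient.mk_out (s := P.rel) m
  simp only [Matrix.sum_apply, mul_apply]
  by_cases h : P.rel a i ∧ P.rel b j
  · have h1 : ∀ (c : Quotient P.rel) (s : ℕ) (m : Fin t),
        P.rslice M a c.out p s i m * P.rslice N c.out b s q m j =
          if Quotient.mk P.rel m = c then rentry M i m p s * rentry N m j s q else 0 := by
      intro c s m
      by_cases hc : Quotient.mk P.rel m = c
      · simp [rslice, h, hout, hc]
      · simp [rslice, h, hout, hc]
    simp only [h1]
    have h2 : P.rslice (M * N) a b p q i j = rentry (M * N) i j p q := by simp [rslice, h]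
    rw [h2, rentry_mul, Finset.sum_comm]
    conv_rhs => rw [Finset.sum_comm]
    refine Finset.sum_congr rfl fun s _ => ?_
    rw [Finset.sum_comm]
    refine Finset.sum_congr rfl fun m _ => ?_
    simp
  · have h2 : P.rslice (M * N) a b p q i j = 0 := by simp only [rslice, of_apply, if_neg h]
    rw [h2]
    symm
    refine Finset.sum_eq_zero fun c _ => Finset.sum_eq_zero fun s _ =>
      Finset.sum_eq_zero fun m _ => ?_
    by_cases hi : P.rel a i
    · have hj : ¬ P.rel b j := fun hj => h ⟨hi, hj⟩
      simp [rslice, hj]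
    · simp [rslice, hi]

theorem rect_mul {W₁ W₂ W₃ : Submodule k (Matrix (Fin t) (Fin t) k)}
    (hW : ∀ A ∈ W₁, ∀ B ∈ W₂, A * B ∈ W₃) {M : Matrix (Idx l) (Idx m) k}
    {N : Matrix (Idx m) (Idx n) k} (hM : M ∈ P.rect W₁ l m) (hN : N ∈ P.rect W₂ m n) :
    M * N ∈ P.rect W₃ l n := by
  intro a b p q
  rw [rslice_mul]
  exact Submodule.sum_mem _ fun c _ => Submodule.sum_mem _ fun s _ => hW _ (hM _ _ _ _) _
    (hN _ _ _ _)

theorem gammaRect_mul {M : Matrix (Idx l) (Idx m) k} {N : Matrix (Idx m) (Idx n) k}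
    (hM : M ∈ P.gammaRect l m) (hN : N ∈ P.gammaRect m n) : M * N ∈ P.gammaRect l n :=
  rect_mul (fun _ hA _ hB => P.Γ.mul_mem hA hB) hM hN

theorem rect_V_mul {r : Fin t → ℕ} {S : Matrix (Idx l) (Idx m) k} {N : Matrix (Idx m) (Idx n) k}
    {T : Matrix (Idx n) (Idx r) k} (hS : S ∈ P.gammaRect l m) (hN : N ∈ P.rect P.V m n)
    (hT : T ∈ P.gammaRect n r) : S * N * T ∈ P.rect P.V l r :=
  rect_mul (fun A hA B hB => P.mul_right B hB A hA)
    (rect_mul (fun A hA B hB => P.mul_left A hA B hB) hS hN) hT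

theorem one_mem_gammaRect (hn : P.IsStepSequence n) : 1 ∈ P.gammaRect n n :=
  mem_gammaAlg_iff.mp (P.gammaAlg n hn).one_mem

theorem inv_mem_gammaRect (hn : P.IsStepSequence n) {S : Matrix (Idx n) (Idx n) k}
    (hS : S ∈ P.gammaRect n n) (hu : IsUnit S) : S⁻¹ ∈ P.gammaRect n n :=
  mem_gammaAlg_iff.mp (inv_mem_of_isUnit (P.gammaAlg n hn) (mem_gammaAlg_iff.mpr hS) hu)

/-- A block-diagonal matrix whose blocks in equivalent strips are equal belongs to `Γ_{m × n}`. -/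
theorem blockDiag_mem (hm : P.IsStepSequence m) (hn : P.IsStepSequence n)
    {f : Fin t → ℕ → ℕ → k} (hf : ∀ i j, P.rel i j → f i = f j) :
    (ofEntry fun i j p q => if i = j then f i p q else 0) ∈ P.gammaRect m n := by
  classical
  intro a b p q
  -- Each slice is a scalar multiple of the diagonal idempotent of the class of `a`.
  have h : P.rslice (ofEntry fun i j p q => if i = j then f i p q else 0 :
      Matrix (Idx m) (Idx n) k) a b p q =
      (if P.rel a b ∧ p < m a ∧ q < n a then f a p q else 0) •
        diagonal (fun i => if P.rel a i then (1 : k) else 0) := by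
    ext i j
    simp only [rslice, of_apply, rentry_ofEntry, Matrix.smul_apply, smul_eq_mul, diagonal_apply]
    by_cases hij : i = j
    · subst hij
      by_cases hi : P.rel a i
      · have e1 : P.rel b i ↔ P.rel a b :=
          ⟨fun e => P.rel.trans' hi (P.rel.symm' e), fun e => P.rel.trans' (P.rel.symm' e) hi⟩
        simp only [hi, e1, true_and, ← hm a i hi, ← hn a i hi, ← hf a i hi, if_true, mul_one]
        split_ifs <;> tauto
      · simp [hi]
    · simp [hij]
  rw [h]
  exact P.Γ.smul_mem (idem_mem a) _

theorem isBlockUpper {S : Matrix (Idx m) (Idx n) k} (hS : S ∈ P.gammaRect m n) :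
    IsBlockUpper S := by
  intro x y hxy
  have h := P.upper _ (hS x.strip y.strip x.row y.row) x.strip y.strip hxy
  simp only [rslice, of_apply, P.rel.refl' _, true_and, if_true] at h
  rwa [rentry_apply] at h

theorem rentry_diag_eq {S : Matrix (Idx m) (Idx n) k} (hS : S ∈ P.gammaRect m n) {i j : Fin t}
    (h : P.rel i j) (p q : ℕ) : rentry S i i p q = rentry S j j p q := by
  have h1 := h _ (hS i i p q)
  simpa [rslice, h, P.rel.refl' i] using h1

/-- Idempotents in `Γ_{n × n}` split. -/
theorem exists_split (hn : P.IsStepSequence n) {e : Matrix (Idx n) (Idx n) k}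
    (he : e ∈ P.gammaRect n n) (hi : e * e = e) :
    ∃ (r : Fin t → ℕ) (x : Matrix (Idx n) (Idx r) k) (y : Matrix (Idx r) (Idx n) k),
      P.IsStepSequence r ∧ x ∈ P.gammaRect n r ∧ y ∈ P.gammaRect r n ∧ x * y = e ∧ y * x = 1 := by
  have hup := isBlockUpper he
  have hdi : ∀ i, diagBlock e i * diagBlock e i = diagBlock e i := fun i => by
    rw [← diagBlock_mul hup hup, hi]
  choose r₀ U V hUV hVU using fun i => exists_split_idempotent (hdi i)
  -- One splitting is chosen per class and copied to all its strips, so that the block-diagonal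
  -- matrices built from it belong to the rectangular Γ-spaces.
  let rep : Fin t → Fin t := fun i => (Quotient.mk P.rel i).out
  have hrep : ∀ i, P.rel (rep i) i := fun i => Quotient.mk_out (s := P.rel) i
  have hrep_eq : ∀ i j, P.rel i j → rep i = rep j := fun i j h =>
    congrArg Quotient.out (Quotient.sound (s := P.rel) h)
  let r : Fin t → ℕ := fun i => r₀ (rep i)
  have hr : P.IsStepSequence r := fun i j h => by simp only [r, hrep_eq i j h]
  let gU : Fin t → ℕ → ℕ → k := fun a p q =>
    if h : p < n a ∧ q < r₀ a then U a ⟨p, h.1⟩ ⟨q, h.2⟩ else 0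
  let gV : Fin t → ℕ → ℕ → k := fun a p q =>
    if h : p < r₀ a ∧ q < n a then V a ⟨p, h.1⟩ ⟨q, h.2⟩ else 0
  let fU : Fin t → ℕ → ℕ → k := fun i => gU (rep i)
  let fV : Fin t → ℕ → ℕ → k := fun i => gV (rep i)
  let u : Matrix (Idx n) (Idx r) k := ofEntry fun i j p q => if i = j then fU i p q else 0
  let v : Matrix (Idx r) (Idx n) k := ofEntry fun i j p q => if i = j then fV i p q else 0
  have hu : u ∈ P.gammaRect n r := blockDiag_mem hn hr fun i j h =>
    congrArg gU (hrep_eq i j h)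
  have hv : v ∈ P.gammaRect r n := blockDiag_mem hr hn fun i j h =>
    congrArg gV (hrep_eq i j h)
  have hn' : ∀ i, n (rep i) = n i := fun i => hn _ _ (hrep i)
  have hdu : ∀ i, diagBlock u i = (U (rep i)).submatrix (Fin.cast (hn' i).symm) id := by
    intro i
    ext p q
    simp only [diagBlock, of_apply, u, ofEntry_mk, if_true, submatrix_apply, id, fU, gU]
    rw [dif_pos ⟨by rw [hn']; exact p.2, q.2⟩]
    rfl
  have hdv : ∀ i, diagBlock v i = (V (rep i)).submatrix id (Fin.cast (hn' i).symm) := by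
    intro i
    ext p q
    simp only [diagBlock, of_apply, v, ofEntry_mk, if_true, submatrix_apply, id, fV, gV]
    rw [dif_pos ⟨p.2, by rw [hn']; exact q.2⟩]
    rfl
  have hde : ∀ i, diagBlock e i =
      (diagBlock e (rep i)).submatrix (Fin.cast (hn' i).symm) (Fin.cast (hn' i).symm) := by
    intro i
    ext p q
    have h1 := rentry_diag_eq he (hrep i) p q
    rw [rentry_of_lt e (by rw [hn']; exact p.2) (by rw [hn']; exact q.2),
      rentry_of_lt e p.2 q.2] at h1
    exact h1.symm
  have huv : ∀ i, diagBlock u i * diagBlock v i = diagBlock e i := by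
    intro i
    rw [hdu, hdv, hde, ← hUV]
    rfl
  have hvu : ∀ i, diagBlock v i * diagBlock u i = 1 := by
    intro i
    rw [hdu, hdv]
    have := Matrix.submatrix_mul_equiv (V (rep i)) (U (rep i)) id
      (finCongr (hn' i).symm) (id : Fin (r i) → Fin (r i))
    rw [hVU] at this
    exact this.trans (by simp)
  -- `u` and `v` split only the diagonal blocks of `e`. So `v * e * u` has identity diagonal blocks
  -- rather than being 1; it is invertible, and its inverse corrects the splitting.
  have hw : v * e * u ∈ P.gammaRect r r := gammaRect_mul (gammaRect_mul hv he) hu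
  have hdw : ∀ i, diagBlock (v * e * u) i = 1 := by
    intro i
    rw [diagBlock_mul (isBlockUpper (gammaRect_mul hv he)) (isBlockUpper hu),
      diagBlock_mul (isBlockUpper hv) hup, ← huv]
    calc _ = diagBlock v i * diagBlock u i * (diagBlock v i * diagBlock u i) := by
          simp only [Matrix.mul_assoc]
      _ = 1 := by rw [hvu, Matrix.one_mul]
  have hwu := isUnit_of_diagBlock (isBlockUpper hw) hdw
  have hwd := (Matrix.isUnit_iff_isUnit_det _).mp hwu
  have hw' := inv_mem_gammaRect hr hw hwu
  have hdw' : ∀ i, diagBlock (v * e * u)⁻¹ i = 1 := by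
    intro i
    have h1 := diagBlock_mul (isBlockUpper hw) (isBlockUpper hw') i
    rwa [Matrix.mul_nonsing_inv _ hwd, diagBlock_one, hdw, Matrix.one_mul, eq_comm] at h1
  have hx : e * u * (v * e * u)⁻¹ ∈ P.gammaRect n r := gammaRect_mul (gammaRect_mul he hu) hw'
  have hy : v * e ∈ P.gammaRect r n := gammaRect_mul hv he
  have hyx : v * e * (e * u * (v * e * u)⁻¹) = 1 := by
    calc _ = v * (e * e) * u * (v * e * u)⁻¹ := by simp only [Matrix.mul_assoc]
      _ = 1 := by rw [hi, Matrix.mul_nonsing_inv _ hwd]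
  refine ⟨r, e * u * (v * e * u)⁻¹, v * e, hr, hx, hy, ?_, hyx⟩
  set x := e * u * (v * e * u)⁻¹ with hxdef
  set y := v * e with hydef
  have hex : e * x = x := by
    rw [hxdef, ← Matrix.mul_assoc, ← Matrix.mul_assoc, hi]
  have hye : y * e = y := by rw [hydef, Matrix.mul_assoc, hi]
  have hxy : x * y * (x * y) = x * y := by
    calc _ = x * (y * x) * y := by simp only [Matrix.mul_assoc]
      _ = _ := by rw [hyx, Matrix.mul_one]
  have hf : (e - x * y) * (e - x * y) = e - x * y := by
    rw [Matrix.sub_mul, Matrix.mul_sub, Matrix.mul_sub, hi, hxy, ← Matrix.mul_assoc, hex,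
      Matrix.mul_assoc x y e, hye, sub_self, sub_zero]
  -- The idempotent `e - x * y` has zero diagonal blocks, so 1 minus it is invertible; as that
  -- matrix annihilates the idempotent, the idempotent vanishes.
  have hdf : ∀ i, diagBlock (1 - (e - x * y)) i = 1 := by
    intro i
    have h1 : diagBlock (x * y) i = diagBlock e i := by
      rw [diagBlock_mul (isBlockUpper hx) (isBlockUpper hy), hxdef, hydef,
        diagBlock_mul (isBlockUpper (gammaRect_mul he hu)) (isBlockUpper hw'), hdw',
        diagBlock_mul hup (isBlockUpper hu), diagBlock_mul (isBlockUpper hv) hup,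
        Matrix.mul_one]
      calc _ = diagBlock e i * (diagBlock u i * diagBlock v i) * diagBlock e i := by
            simp only [Matrix.mul_assoc]
        _ = _ := by rw [huv, hdi, hdi]
    have h2 : diagBlock (1 - (e - x * y)) i =
        diagBlock 1 i - (diagBlock e i - diagBlock (x * y) i) := rfl
    rw [h2, h1, sub_self, sub_zero, diagBlock_one]
  have hfu := isUnit_of_diagBlock (isBlockUpper ((P.gammaRect n n).sub_mem (one_mem_gammaRect hn)
    ((P.gammaRect n n).sub_mem he (gammaRect_mul hx hy)))) hdf
  have hf0 : e - x * y = 0 := by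
    refine hfu.mul_left_cancel ?_
    rw [Matrix.sub_mul, Matrix.one_mul, hf, sub_self, Matrix.mul_zero]
  exact (sub_eq_zero.mp hf0).symm

end Problem
end Rect

/-! ### Block-direct sums -/

namespace Idx

variable {t : ℕ} {m n : Fin t → ℕ}

@[simp] theorem strip_mk (i : Fin t) (p : Fin (m i)) : (mk i p).strip = i := rfl

@[simp] theorem row_mk (i : Fin t) (p : Fin (m i)) : (mk i p).row = p := rfl

theorem eq_iff {x y : Idx m} : x = y ↔ x.strip = y.strip ∧ (x.row : ℕ) = y.row := by
  obtain ⟨i, p, rfl⟩ := exists_mk x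
  obtain ⟨j, q, rfl⟩ := exists_mk y
  exact mk_eq_mk

theorem isEmpty (h : n = 0) : IsEmpty (Idx n) := ⟨fun x => by
  have := x.row.2
  simp [h] at this⟩

theorem nonempty_of_ne (h : n ≠ 0) : Nonempty (Idx n) := by
  obtain ⟨i, hi⟩ := Function.ne_iff.mp h
  exact ⟨mk i ⟨0, Nat.pos_of_ne_zero hi⟩⟩

end Idx

namespace BlockMatrix

variable {k : Type*} [Field k] {t : ℕ}

section
variable (A B : BlockMatrix k t)

/-- The indices of the first summand of a block-direct sum. -/
def inl (x : Idx A.size) : Idx (A.blockSum B).size := Idx.mk x.strip (Fin.castAdd _ x.row)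

/-- The indices of the second summand of a block-direct sum. -/
def inr (x : Idx B.size) : Idx (A.blockSum B).size := Idx.mk x.strip (Fin.natAdd _ x.row)

@[simp] theorem strip_inl (x : Idx A.size) : (inl A B x).strip = x.strip := rfl

@[simp] theorem strip_inr (x : Idx B.size) : (inr A B x).strip = x.strip := rfl

@[simp] theorem row_inl (x : Idx A.size) : ((inl A B x).row : ℕ) = x.row := rfl

@[simp] theorem row_inr (x : Idx B.size) : ((inr A B x).row : ℕ) = A.size x.strip + x.row := rfl

theorem inl_injective : Function.Injective (inl A B) :=
  fun _ _ h => Idx.eq_iff.mpr (Idx.eq_iff (x := inl A B _).mp h)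

theorem inr_injective : Function.Injective (inr A B) := by
  intro x y h
  obtain ⟨h1, h2⟩ := Idx.eq_iff.mp h
  simp only [strip_inr] at h1
  simp only [row_inr, h1] at h2
  exact Idx.eq_iff.mpr ⟨h1, Nat.add_left_cancel h2⟩

theorem inl_ne_inr (x : Idx A.size) (y : Idx B.size) : inl A B x ≠ inr A B y := by
  intro h
  obtain ⟨h1, h2⟩ := Idx.eq_iff.mp h
  simp only [strip_inl, strip_inr] at h1
  have := x.row.2
  simp only [row_inl, row_inr, ← h1] at h2
  omega

theorem exists_inl_or_inr (z : Idx (A.blockSum B).size) :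
    (∃ x, z = inl A B x) ∨ ∃ y, z = inr A B y := by
  obtain ⟨i, p, rfl⟩ := Idx.exists_mk z
  change Fin (A.size i + B.size i) at p
  induction p using Fin.addCases with
  | left p => exact Or.inl ⟨Idx.mk i p, rfl⟩
  | right p => exact Or.inr ⟨Idx.mk i p, rfl⟩

/-- The indices of a block-direct sum. -/
noncomputable def sumEquiv : Idx A.size ⊕ Idx B.size ≃ Idx (A.blockSum B).size :=
  Equiv.ofBijective (Sum.elim (inl A B) (inr A B)) ⟨by
    rintro (x | x) (y | y) h
    · exact congrArg Sum.inl (inl_injective A B h)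
    · exact absurd h (inl_ne_inr A B _ _)
    · exact absurd h.symm (inl_ne_inr A B _ _)
    · exact congrArg Sum.inr (inr_injective A B h), fun z => by
    rcases exists_inl_or_inr A B z with ⟨x, rfl⟩ | ⟨y, rfl⟩
    · exact ⟨Sum.inl x, rfl⟩
    · exact ⟨Sum.inr y, rfl⟩⟩

@[simp] theorem sumEquiv_inl (x : Idx A.size) : sumEquiv A B (Sum.inl x) = inl A B x := rfl

@[simp] theorem sumEquiv_inr (x : Idx B.size) : sumEquiv A B (Sum.inr x) = inr A B x := rfl

theorem sumEquiv_symm_inl (x : Idx A.size) : (sumEquiv A B).symm (inl A B x) = Sum.inl x :=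
  (Equiv.symm_apply_eq _).mpr rfl

theorem sumEquiv_symm_inr (x : Idx B.size) : (sumEquiv A B).symm (inr A B x) = Sum.inr x :=
  (Equiv.symm_apply_eq _).mpr rfl

@[simp] theorem blockSum_inl_inl (x y : Idx A.size) :
    (A.blockSum B).mat (inl A B x) (inl A B y) = A.mat x y := by
  change fromBlocks _ _ _ _ (finSumFinEquiv.symm (Fin.castAdd _ x.row))
    (finSumFinEquiv.symm (Fin.castAdd _ y.row)) = _
  rw [finSumFinEquiv_symm_apply_castAdd, finSumFinEquiv_symm_apply_castAdd]
  rfl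

@[simp] theorem blockSum_inl_inr (x : Idx A.size) (y : Idx B.size) :
    (A.blockSum B).mat (inl A B x) (inr A B y) = 0 := by
  change fromBlocks _ _ _ _ (finSumFinEquiv.symm (Fin.castAdd _ x.row))
    (finSumFinEquiv.symm (Fin.natAdd _ y.row)) = _
  rw [finSumFinEquiv_symm_apply_castAdd, finSumFinEquiv_symm_apply_natAdd]
  rfl

@[simp] theorem blockSum_inr_inl (x : Idx B.size) (y : Idx A.size) :
    (A.blockSum B).mat (inr A B x) (inl A B y) = 0 := by
  change fromBlocks _ _ _ _ (finSumFinEquiv.symm (Fin.natAdd _ x.row))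
    (finSumFinEquiv.symm (Fin.castAdd _ y.row)) = _
  rw [finSumFinEquiv_symm_apply_castAdd, finSumFinEquiv_symm_apply_natAdd]
  rfl

@[simp] theorem blockSum_inr_inr (x y : Idx B.size) :
    (A.blockSum B).mat (inr A B x) (inr A B y) = B.mat x y := by
  change fromBlocks _ _ _ _ (finSumFinEquiv.symm (Fin.natAdd _ x.row))
    (finSumFinEquiv.symm (Fin.natAdd _ y.row)) = _
  rw [finSumFinEquiv_symm_apply_natAdd, finSumFinEquiv_symm_apply_natAdd]
  rfl

/-- Entries addressed by natural numbers can be compared across sizes that are equal but not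
definitionally so, as in associativity of the sum. -/
theorem rentry_blockSum (i j : Fin t) (p q : ℕ) : rentry (A.blockSum B).mat i j p q =
    rentry A.mat i j p q + if A.size i ≤ p ∧ A.size j ≤ q then
      rentry B.mat i j (p - A.size i) (q - A.size j) else 0 := by
  by_cases hp : p < A.size i + B.size i
  swap
  · rw [rentry_of_not_left _ hp, rentry_of_not_left _ (by omega), rentry_of_not_left _ (by omega)]
    simp
  by_cases hq : q < A.size j + B.size j
  swap
  · rw [rentry_of_not_right _ hq, rentry_of_not_right _ (by omega),
      rentry_of_not_right _ (by omega)]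
    simp
  rw [rentry_of_lt _ hp hq]
  by_cases hp' : p < A.size i
  · have e : (Idx.mk i ⟨p, hp⟩ : Idx (A.blockSum B).size) = inl A B (Idx.mk i ⟨p, hp'⟩) := rfl
    rw [e, if_neg (by omega), add_zero]
    by_cases hq' : q < A.size j
    · have e : (Idx.mk j ⟨q, hq⟩ : Idx (A.blockSum B).size) = inl A B (Idx.mk j ⟨q, hq'⟩) := rfl
      rw [e, blockSum_inl_inl, rentry_of_lt _ hp' hq']
    · have e : (Idx.mk j ⟨q, hq⟩ : Idx (A.blockSum B).size) =
          inr A B (Idx.mk j ⟨q - A.size j, by omega⟩) := by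
        refine Idx.eq_iff.mpr ⟨rfl, ?_⟩
        change q = A.size j + (q - A.size j)
        omega
      rw [e, blockSum_inl_inr, rentry_of_not_right _ hq']
  · have e : (Idx.mk i ⟨p, hp⟩ : Idx (A.blockSum B).size) =
        inr A B (Idx.mk i ⟨p - A.size i, by omega⟩) := by
      refine Idx.eq_iff.mpr ⟨rfl, ?_⟩
      change p = A.size i + (p - A.size i)
      omega
    rw [e, rentry_of_not_left _ hp', zero_add]
    by_cases hq' : q < A.size j
    · have e : (Idx.mk j ⟨q, hq⟩ : Idx (A.blockSum B).size) = inl A B (Idx.mk j ⟨q, hq'⟩) := rfl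
      rw [e, blockSum_inr_inl, if_neg (by omega)]
    · have e : (Idx.mk j ⟨q, hq⟩ : Idx (A.blockSum B).size) =
          inr A B (Idx.mk j ⟨q - A.size j, by omega⟩) := by
        refine Idx.eq_iff.mpr ⟨rfl, ?_⟩
        change q = A.size j + (q - A.size j)
        omega
      rw [e, blockSum_inr_inr, if_pos (by omega), rentry_of_lt]

end

theorem ext_rentry {A B : BlockMatrix k t} (h : A.size = B.size)
    (h' : ∀ i j p q, rentry A.mat i j p q = rentry B.mat i j p q) : A = B := by
  obtain ⟨m, M⟩ := A
  obtain ⟨n, N⟩ := B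
  obtain rfl : m = n := h
  congr
  exact rentry_ext fun i j p q _ _ => h' i j p q

theorem blockSum_assoc (A B C : BlockMatrix k t) :
    (A.blockSum B).blockSum C = A.blockSum (B.blockSum C) := by
  refine ext_rentry (funext fun i => Nat.add_assoc _ _ _) fun i j p q => ?_
  simp only [rentry_blockSum]
  rw [add_assoc]
  congr 1
  by_cases h : A.size i ≤ p ∧ A.size j ≤ q
  · rw [if_pos h, if_pos h]
    congr 1
    change (if A.size i + B.size i ≤ p ∧ A.size j + B.size j ≤ q then
      rentry C.mat i j (p - (A.size i + B.size i)) (q - (A.size j + B.size j)) else 0) = _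
    rw [Nat.sub_sub, Nat.sub_sub]
    congr 1
    simp only [eq_iff_iff]
    omega
  · rw [if_neg h, if_neg h, zero_add, if_neg]
    change ¬ (A.size i + B.size i ≤ p ∧ A.size j + B.size j ≤ q)
    omega

theorem blockSum_empty (A : BlockMatrix k t) : A.blockSum empty = A := by
  refine ext_rentry (funext fun i => Nat.add_zero _) fun i j p q => ?_
  rw [rentry_blockSum, rentry_of_not_left (m := (empty : BlockMatrix k t).size) _
    (by simp [empty])]
  simp

theorem empty_blockSum (A : BlockMatrix k t) : empty.blockSum A = A := by
  refine ext_rentry (funext fun i => Nat.zero_add _) fun i j p q => ?_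
  rw [rentry_blockSum, rentry_of_not_left (m := (empty : BlockMatrix k t).size) _
    (by simp [empty])]
  simp [empty]

theorem listSum_append (L L' : List (BlockMatrix k t)) :
    listSum (L ++ L') = (listSum L).blockSum (listSum L') := by
  induction L with
  | nil => exact (empty_blockSum _).symm
  | cons A L ih =>
    change A.blockSum (listSum (L ++ L')) = (A.blockSum (listSum L)).blockSum _
    rw [ih, blockSum_assoc]

theorem listSum_singleton (A : BlockMatrix k t) : listSum [A] = A := blockSum_empty A

end BlockMatrix

/-! ### Homomorphisms -/

section Structure

variable {k : Type*} [Field k] {t : ℕ}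

namespace BlockMatrix

variable (A B : BlockMatrix k t) {Z : Type*}

/-- The embedding of the first summand. -/
def ιl : Matrix (Idx A.size) (Idx (A.blockSum B).size) k := submatrix 1 (inl A B) id

/-- The embedding of the second summand. -/
def ιr : Matrix (Idx B.size) (Idx (A.blockSum B).size) k := submatrix 1 (inr A B) id

/-- The projection onto the first summand. -/
def πl : Matrix (Idx (A.blockSum B).size) (Idx A.size) k := submatrix 1 id (inl A B)

/-- The projection onto the second summand. -/
def πr : Matrix (Idx (A.blockSum B).size) (Idx B.size) k := submatrix 1 id (inr A B)

theorem ιl_mul (N : Matrix (Idx (A.blockSum B).size) Z k) :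
    ιl A B * N = N.submatrix (inl A B) id :=
  Matrix.one_submatrix_mul _ (Equiv.refl _) N

theorem ιr_mul (N : Matrix (Idx (A.blockSum B).size) Z k) :
    ιr A B * N = N.submatrix (inr A B) id :=
  Matrix.one_submatrix_mul _ (Equiv.refl _) N

theorem mul_πl (N : Matrix Z (Idx (A.blockSum B).size) k) :
    N * πl A B = N.submatrix id (inl A B) :=
  Matrix.mul_submatrix_one (Equiv.refl _) (inl A B) N

theorem mul_πr (N : Matrix Z (Idx (A.blockSum B).size) k) :
    N * πr A B = N.submatrix id (inr A B) :=
  Matrix.mul_submatrix_one (Equiv.refl _) (inr A B) N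

theorem ιl_mul_πl : ιl A B * πl A B = 1 := by
  rw [ιl_mul]
  exact Matrix.submatrix_one (inl A B) (inl_injective A B)

theorem ιr_mul_πr : ιr A B * πr A B = 1 := by
  rw [ιr_mul]
  exact Matrix.submatrix_one (inr A B) (inr_injective A B)

theorem ιl_mul_πr : ιl A B * πr A B = 0 := by
  rw [ιl_mul]
  ext x y
  exact one_apply_ne (inl_ne_inr A B x y)

theorem ιr_mul_πl : ιr A B * πl A B = 0 := by
  rw [ιr_mul]
  ext x y
  exact one_apply_ne (inl_ne_inr A B y x).symm

theorem πl_mul_ιl_add : πl A B * ιl A B + πr A B * ιr A B = 1 := by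
  ext x y
  rw [Matrix.add_apply, mul_apply, mul_apply]
  have h := congrFun (congrFun (Matrix.one_mul (1 : Matrix (Idx (A.blockSum B).size) _ k)) x) y
  rw [mul_apply, ← Equiv.sum_comp (sumEquiv A B), Fintype.sum_sum_type] at h
  exact h

end BlockMatrix

namespace Problem

open BlockMatrix

variable {P : Problem k t} {A B C : BlockMatrix k t}

theorem IsStepSequence.blockSum (hA : P.IsStepSequence A.size) (hB : P.IsStepSequence B.size) :
    P.IsStepSequence (A.blockSum B).size :=
  fun i j h => congrArg₂ (· + ·) (hA i j h) (hB i j h)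

theorem ιl_mem (hA : P.IsStepSequence A.size) (hB : P.IsStepSequence B.size) :
    ιl A B ∈ P.gammaRect A.size (A.blockSum B).size := by
  convert blockDiag_mem (k := k) hA (hA.blockSum hB) (f := fun _ p q => if p = q then 1 else 0)
    fun _ _ _ => rfl
  ext x y
  simp only [ιl, submatrix_apply, id, one_apply, ofEntry, of_apply, Idx.eq_iff, strip_inl,
    row_inl, ite_and]

/-- The shift of rows by `A.size i` is the same in equivalent strips, since `A.size` is a
step-sequence. -/
theorem ιr_mem (hA : P.IsStepSequence A.size) (hB : P.IsStepSequence B.size) :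
    ιr A B ∈ P.gammaRect B.size (A.blockSum B).size := by
  convert blockDiag_mem (k := k) hB (hA.blockSum hB)
    (f := fun i p q => if A.size i + p = q then 1 else 0) fun i j h => by rw [hA i j h]
  ext x y
  simp only [ιr, submatrix_apply, id, one_apply, ofEntry, of_apply, Idx.eq_iff, strip_inr,
    row_inr, ite_and]

theorem πl_mem (hA : P.IsStepSequence A.size) (hB : P.IsStepSequence B.size) :
    πl A B ∈ P.gammaRect (A.blockSum B).size A.size := by
  convert blockDiag_mem (k := k) (hA.blockSum hB) hA (f := fun _ p q => if p = q then 1 else 0)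
    fun _ _ _ => rfl
  ext x y
  simp only [πl, submatrix_apply, id, one_apply, ofEntry, of_apply, Idx.eq_iff, strip_inl,
    row_inl, ite_and]

theorem πr_mem (hA : P.IsStepSequence A.size) (hB : P.IsStepSequence B.size) :
    πr A B ∈ P.gammaRect (A.blockSum B).size B.size := by
  convert blockDiag_mem (k := k) (hA.blockSum hB) hB
    (f := fun i p q => if p = A.size i + q then 1 else 0) fun i j h => by rw [hA i j h]
  ext x y
  simp only [πr, submatrix_apply, id, one_apply, ofEntry, of_apply, Idx.eq_iff, strip_inr,
    row_inr, ite_and]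
  by_cases h : x.strip = y.strip
  · simp only [h]
  · rw [if_neg h, if_neg h]

variable (P) in
/-- The homomorphisms of matrices of the linear matrix problem: the solutions `S ∈ Γ_{m × n}` of the
equation `A S = S B`. -/
noncomputable def homs (A B : BlockMatrix k t) : Submodule k (Matrix (Idx A.size) (Idx B.size) k) where
  carrier := {S | S ∈ P.gammaRect A.size B.size ∧ A.mat * S = S * B.mat}
  zero_mem' := ⟨Submodule.zero_mem _, by rw [Matrix.mul_zero, Matrix.zero_mul]⟩
  add_mem' := fun h h' => ⟨Submodule.add_mem _ h.1 h'.1, by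
    rw [Matrix.mul_add, Matrix.add_mul, h.2, h'.2]⟩
  smul_mem' := fun c _ h => ⟨Submodule.smul_mem _ c h.1, by
    rw [Matrix.mul_smul, Matrix.smul_mul, h.2]⟩

theorem homs_mul {S : Matrix (Idx A.size) (Idx B.size) k} {T : Matrix (Idx B.size) (Idx C.size) k}
    (hS : S ∈ P.homs A B) (hT : T ∈ P.homs B C) : S * T ∈ P.homs A C :=
  ⟨gammaRect_mul hS.1 hT.1, by
    rw [← Matrix.mul_assoc, hS.2, Matrix.mul_assoc, hT.2, Matrix.mul_assoc]⟩

theorem one_mem_homs (hA : P.IsStepSequence A.size) : 1 ∈ P.homs A A :=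
  ⟨one_mem_gammaRect hA, by rw [Matrix.mul_one, Matrix.one_mul]⟩

theorem ιl_mem_homs (hA : P.IsStepSequence A.size) (hB : P.IsStepSequence B.size) :
    (ιl A B) ∈ P.homs A (A.blockSum B) := by
  refine ⟨ιl_mem hA hB, ?_⟩
  refine Eq.trans ?_ (ιl_mul A B (A.blockSum B).mat).symm
  ext x y
  rw [mul_apply, submatrix_apply]
  rcases exists_inl_or_inr A B y with ⟨y, rfl⟩ | ⟨y, rfl⟩
  · simp [ιl, one_apply, (inl_injective A B).eq_iff]
  · simp [ιl, one_apply, inl_ne_inr]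

theorem ιr_mem_homs (hA : P.IsStepSequence A.size) (hB : P.IsStepSequence B.size) :
    (ιr A B) ∈ P.homs B (A.blockSum B) := by
  refine ⟨ιr_mem hA hB, ?_⟩
  refine Eq.trans ?_ (ιr_mul A B (A.blockSum B).mat).symm
  ext x y
  rw [mul_apply, submatrix_apply]
  rcases exists_inl_or_inr A B y with ⟨y, rfl⟩ | ⟨y, rfl⟩
  · simp [ιr, one_apply, (inl_ne_inr A B _ _).symm]
  · simp [ιr, one_apply, (inr_injective A B).eq_iff]

theorem πl_mem_homs (hA : P.IsStepSequence A.size) (hB : P.IsStepSequence B.size) :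
    (πl A B) ∈ P.homs (A.blockSum B) A := by
  refine ⟨πl_mem hA hB, ?_⟩
  refine (mul_πl A B (A.blockSum B).mat).trans ?_
  ext x y
  rw [mul_apply, submatrix_apply]
  rcases exists_inl_or_inr A B x with ⟨x, rfl⟩ | ⟨x, rfl⟩
  · simp [πl, one_apply, (inl_injective A B).eq_iff]
  · simp [πl, one_apply, (inl_ne_inr A B _ _).symm]

theorem πr_mem_homs (hA : P.IsStepSequence A.size) (hB : P.IsStepSequence B.size) :
    (πr A B) ∈ P.homs (A.blockSum B) B := by
  refine ⟨πr_mem hA hB, ?_⟩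
  refine (mul_πr A B (A.blockSum B).mat).trans ?_
  ext x y
  rw [mul_apply, submatrix_apply]
  rcases exists_inl_or_inr A B x with ⟨x, rfl⟩ | ⟨x, rfl⟩
  · simp [πr, one_apply, inl_ne_inr]
  · simp [πr, one_apply, (inr_injective A B).eq_iff]

theorem mem_iff : P.Mem A ↔ P.IsStepSequence A.size ∧ A.mat ∈ P.rect P.V A.size A.size :=
  and_congr_right fun _ => mem_rect_V_iff.symm

/-- The sum equals `πl A ιl + πr B ιr`, and the spaces `V_{m × n}` absorb rectangular Γ-matrices on
both sides. -/
theorem Mem.blockSum (hA : P.Mem A) (hB : P.Mem B) : P.Mem (A.blockSum B) := by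
  rw [mem_iff] at hA hB ⊢
  refine ⟨fun i j h => congrArg₂ (· + ·) (hA.1 i j h) (hB.1 i j h), ?_⟩
  have h : (A.blockSum B).mat = (πl A B) * A.mat * (ιl A B) + (πr A B) * B.mat * (ιr A B) := by
    calc (A.blockSum B).mat = (A.blockSum B).mat * ((πl A B) * (ιl A B) + (πr A B) * (ιr A B)) := by
          rw [πl_mul_ιl_add A B]
          exact (Matrix.mul_one _).symm
      _ = (A.blockSum B).mat * (πl A B) * (ιl A B) + (A.blockSum B).mat * (πr A B) * (ιr A B) := by
          rw [Matrix.mul_add, ← Matrix.mul_assoc, ← Matrix.mul_assoc]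
      _ = _ := by rw [(πl_mem_homs hA.1 hB.1).2, (πr_mem_homs hA.1 hB.1).2]
  rw [h]
  exact Submodule.add_mem _ (rect_V_mul (πl_mem hA.1 hB.1) hA.2 (ιl_mem hA.1 hB.1))
    (rect_V_mul (πr_mem hA.1 hB.1) hB.2 (ιr_mem hA.1 hB.1))

theorem mem_empty : P.Mem BlockMatrix.empty := by
  refine mem_iff.mpr ⟨fun _ _ _ => rfl, ?_⟩
  exact Submodule.zero_mem _

theorem mem_listSum {L : List (BlockMatrix k t)} (h : ∀ A ∈ L, P.Mem A) :
    P.Mem (BlockMatrix.listSum L) := by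
  induction L with
  | nil => exact mem_empty
  | cons A L ih =>
    exact Mem.blockSum (h A List.mem_cons_self) (ih fun B hB => h B (List.mem_cons_of_mem _ hB))

/-! ### Isomorphisms -/

variable (P) in
/-- The matrices are isomorphic, that is, equivalent. -/
def Iso (A B : BlockMatrix k t) : Prop :=
  ∃ S ∈ P.homs A B, ∃ T ∈ P.homs B A, S * T = 1 ∧ T * S = 1

theorem Iso.refl (hA : P.IsStepSequence A.size) : P.Iso A A :=
  ⟨1, one_mem_homs hA, 1, one_mem_homs hA, Matrix.one_mul _, Matrix.one_mul _⟩

theorem Iso.symm : P.Iso A B → P.Iso B A :=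
  fun ⟨S, hS, T, hT, h, h'⟩ => ⟨T, hT, S, hS, h', h⟩

theorem Iso.trans : P.Iso A B → P.Iso B C → P.Iso A C := by
  rintro ⟨S, hS, T, hT, h, h'⟩ ⟨S', hS', T', hT', g, g'⟩
  refine ⟨S * S', homs_mul hS hS', T' * T, homs_mul hT' hT, ?_, ?_⟩
  · rw [Matrix.mul_assoc, ← Matrix.mul_assoc S', g, Matrix.one_mul, h]
  · rw [Matrix.mul_assoc, ← Matrix.mul_assoc T, h', Matrix.one_mul, g']

/-- Morphisms are upper block-triangular, so the diagonal blocks of `S` and `T` are inverse to each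
other and hence square. -/
theorem Iso.size_eq : P.Iso A B → A.size = B.size := by
  rintro ⟨S, hS, T, hT, h, h'⟩
  funext i
  have h1 := diagBlock_mul (isBlockUpper hS.1) (isBlockUpper hT.1) i
  have h2 := diagBlock_mul (isBlockUpper hT.1) (isBlockUpper hS.1) i
  rw [h, diagBlock_one] at h1
  rw [h', diagBlock_one] at h2
  simpa using Matrix.square_of_invertible _ _ h1.symm h2.symm

theorem Iso.equivalent (h : P.Iso A B) : P.Equivalent A B := by
  have hs := h.size_eq
  obtain ⟨n, M⟩ := A
  obtain ⟨n', N⟩ := B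
  obtain rfl : n = n' := hs
  obtain ⟨S, hS, T, hT, h, h'⟩ := h
  have hu : IsUnit S := ⟨⟨S, T, h, h'⟩, rfl⟩
  refine ⟨S, mem_gammaRect_iff.mp hS.1, hu, ?_⟩
  unfold BlockMatrix.conj
  congr 1
  exact (inv_mul_mul_eq_iff hu).mpr hS.2

theorem Equivalent.iso (hA : P.IsStepSequence A.size) (h : P.Equivalent A B) : P.Iso A B := by
  obtain ⟨S, hS, hu, rfl⟩ := h
  have hS := mem_gammaRect_iff.mpr hS
  have hd := (Matrix.isUnit_iff_isUnit_det _).mp hu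
  have e1 : A.mat * S = S * (S⁻¹ * A.mat * S) := by
    rw [Matrix.mul_assoc, Matrix.mul_nonsing_inv_cancel_left _ _ hd]
  have e2 : S⁻¹ * A.mat * S * S⁻¹ = S⁻¹ * A.mat := Matrix.mul_nonsing_inv_cancel_right _ _ hd
  refine ⟨S, ⟨hS, ?_⟩, (S⁻¹ : Matrix (Idx A.size) (Idx A.size) k), ⟨inv_mem_gammaRect hA hS hu, ?_⟩, Matrix.mul_nonsing_inv _ hd,
    Matrix.nonsing_inv_mul _ hd⟩
  · exact e1
  · exact e2

theorem Equivalent.size_eq (h : P.Equivalent A B) : A.size = B.size := by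
  obtain ⟨S, _, _, rfl⟩ := h
  rfl

/-- A matrix that has complementary direct summands `B` and `C` is isomorphic to `B ⊎ C`. -/
theorem Iso.of_summands (hB : P.IsStepSequence B.size) (hC : P.IsStepSequence C.size)
    {x : Matrix (Idx A.size) (Idx B.size) k} {y : Matrix (Idx B.size) (Idx A.size) k}
    {x' : Matrix (Idx A.size) (Idx C.size) k} {y' : Matrix (Idx C.size) (Idx A.size) k}
    (hx : x ∈ P.homs A B) (hy : y ∈ P.homs B A) (hx' : x' ∈ P.homs A C) (hy' : y' ∈ P.homs C A)
    (h : x * y + x' * y' = 1) (hyx : y * x = 1) (hyx' : y' * x' = 1) :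
    P.Iso A (B.blockSum C) := by
  -- Orthogonality is automatic: inserting the resolution of 1 gives `y * x' = y * x' + y * x'`.
  have h0 : y * x' = 0 := by
    suffices e : y * x' + 0 = y * x' + y * x' from (add_left_cancel e).symm
    rw [add_zero]
    calc y * x' = y * (x * y + x' * y') * x' := by rw [h, Matrix.mul_one]
      _ = (y * x) * (y * x') + (y * x') * (y' * x') := by
        simp only [Matrix.mul_add, Matrix.add_mul, Matrix.mul_assoc]
      _ = y * x' + y * x' := by rw [hyx, hyx', Matrix.one_mul, Matrix.mul_one]
  have h0' : y' * x = 0 := by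
    suffices e : y' * x + 0 = y' * x + y' * x from (add_left_cancel e).symm
    rw [add_zero]
    calc y' * x = y' * (x * y + x' * y') * x := by rw [h, Matrix.mul_one]
      _ = (y' * x) * (y * x) + (y' * x') * (y' * x) := by
        simp only [Matrix.mul_add, Matrix.add_mul, Matrix.mul_assoc]
      _ = y' * x + y' * x := by rw [hyx, hyx', Matrix.one_mul, Matrix.mul_one]
  refine ⟨x * (ιl B C) + x' * (ιr B C), Submodule.add_mem _ (homs_mul hx (ιl_mem_homs hB hC))
    (homs_mul hx' (ιr_mem_homs hB hC)), (πl B C) * y + (πr B C) * y',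
    Submodule.add_mem _ (homs_mul (πl_mem_homs hB hC) hy) (homs_mul (πr_mem_homs hB hC) hy'),
    ?_, ?_⟩
  · refine Eq.trans ?_ h
    calc _ = x * ((ιl B C) * (πl B C)) * y + x * ((ιl B C) * (πr B C)) * y' + (x' * ((ιr B C) * (πl B C)) * y + x' * ((ιr B C) * (πr B C)) * y') := by
          simp only [Matrix.mul_add, Matrix.add_mul, Matrix.mul_assoc]
          abel
      _ = _ := by
          rw [ιl_mul_πl B C, ιl_mul_πr B C, ιr_mul_πl B C, ιr_mul_πr B C]
          simp
  · refine Eq.trans ?_ (πl_mul_ιl_add B C)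
    calc _ = (πl B C) * (y * x) * (ιl B C) + (πl B C) * (y * x') * (ιr B C) + ((πr B C) * (y' * x) * (ιl B C) +
            (πr B C) * (y' * x') * (ιr B C)) := by
          simp only [Matrix.mul_add, Matrix.add_mul, Matrix.mul_assoc]
          abel
      _ = _ := by
          rw [h0, h0', hyx, hyx']
          simp

theorem Iso.blockSum {A' B' : BlockMatrix k t} (hA : P.Iso A A') (hB : P.Iso B B')
    (sA : P.IsStepSequence A.size) (sB : P.IsStepSequence B.size) :
    P.Iso (A.blockSum B) (A'.blockSum B') := by
  have sA' : P.IsStepSequence A'.size := hA.size_eq ▸ sA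
  have sB' : P.IsStepSequence B'.size := hB.size_eq ▸ sB
  obtain ⟨S, hS, T, hT, h, h'⟩ := hA
  obtain ⟨S', hS', T', hT', g, g'⟩ := hB
  refine Iso.of_summands sA' sB' (homs_mul (πl_mem_homs sA sB) hS)
    (homs_mul hT (ιl_mem_homs sA sB)) (homs_mul (πr_mem_homs sA sB) hS')
    (homs_mul hT' (ιr_mem_homs sA sB)) ?_ ?_ ?_
  · refine Eq.trans ?_ (πl_mul_ιl_add A B)
    calc _ = (πl A B) * (S * T) * (ιl A B) + (πr A B) * (S' * T') * (ιr A B) := by simp only [Matrix.mul_assoc]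
      _ = _ := by rw [h, g, Matrix.mul_one, Matrix.mul_one]
  · calc _ = T * (ιl A B * (πl A B)) * S := by simp only [Matrix.mul_assoc]
      _ = _ := by rw [ιl_mul_πl A B, Matrix.mul_one, h']
  · calc _ = T' * ((ιr A B) * (πr A B)) * S' := by simp only [Matrix.mul_assoc]
      _ = _ := by rw [ιr_mul_πr A B, Matrix.mul_one, g']

/-- An idempotent endomorphism of `A` gives a decomposition of `A`. -/
theorem exists_iso_blockSum (hA : P.Mem A) {e : Matrix (Idx A.size) (Idx A.size) k}
    (he : e ∈ P.homs A A) (hi : e * e = e) : ∃ B C : BlockMatrix k t, P.Mem B ∧ P.Mem C ∧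
      P.Iso A (B.blockSum C) ∧ (B.size = 0 → e = 0) ∧ (C.size = 0 → e = 1) := by
  have key : ∀ e ∈ P.homs A A, e * e = e → ∃ B : BlockMatrix k t, P.Mem B ∧
      ∃ x ∈ P.homs A B, ∃ y ∈ P.homs B A, x * y = e ∧ y * x = 1 := by
    intro e he hi
    obtain ⟨r, x, y, hr, hx, hy, hxy, hyx⟩ := exists_split hA.1 he.1 hi
    have hex : e * x = x := by rw [← hxy, Matrix.mul_assoc, hyx, Matrix.mul_one]
    have hye : y * e = y := by rw [← hxy, ← Matrix.mul_assoc, hyx, Matrix.one_mul]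
    -- The summand carries the matrix `y A x`; `x` and `y` are morphisms because `e = x * y`
    -- commutes with `A`.
    refine ⟨⟨r, y * A.mat * x⟩, mem_iff.mpr ⟨hr, rect_V_mul hy (mem_iff.mp hA).2 hx⟩, x, ⟨hx, ?_⟩, y,
      ⟨hy, ?_⟩, hxy, hyx⟩
    · calc A.mat * x = A.mat * e * x := by rw [Matrix.mul_assoc, hex]
        _ = x * (y * A.mat * x) := by rw [he.2, ← hxy]; simp only [Matrix.mul_assoc]
    · calc y * A.mat * x * y = y * (A.mat * e) := by rw [← hxy]; simp only [Matrix.mul_assoc]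
        _ = y * A.mat := by rw [he.2, ← Matrix.mul_assoc, hye]
  obtain ⟨B, hB, x, hx, y, hy, hxy, hyx⟩ := key e he hi
  obtain ⟨C, hC, x', hx', y', hy', hxy', hyx'⟩ := key (1 - e)
    (Submodule.sub_mem _ (one_mem_homs hA.1) he) (IsIdempotentElem.one_sub hi)
  have hzero : ∀ {r : Fin t → ℕ} (x : Matrix (Idx A.size) (Idx r) k)
      (y : Matrix (Idx r) (Idx A.size) k), r = 0 → x * y = 0 := by
    intro r x y h
    have := Idx.isEmpty h
    ext
    simp [mul_apply]
  refine ⟨B, C, hB, hC, Iso.of_summands hB.1 hC.1 hx hy hx' hy' ?_ hyx hyx', fun h => ?_, fun h => ?_⟩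
  · rw [hxy, hxy', add_sub_cancel]
  · rw [← hxy, hzero x y h]
  · have := hzero x' y' h
    rw [hxy', sub_eq_zero] at this
    exact this.symm

theorem IsIndecomposable.eq_zero_or_one (hA : P.IsIndecomposable A)
    {e : Matrix (Idx A.size) (Idx A.size) k} (he : e ∈ P.homs A A) (hi : e * e = e) :
    e = 0 ∨ e = 1 := by
  obtain ⟨B, C, hB, hC, h, h0, h1⟩ := exists_iso_blockSum hA.1 he hi
  exact (hA.2.2 B C hB hC h.equivalent).imp h0 h1

/-- A matrix without nontrivial idempotent endomorphisms is indecomposable. -/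
theorem isIndecomposable_of_idempotents (hA : P.Mem A) (h0 : A.size ≠ 0)
    (h : ∀ e ∈ P.homs A A, e * e = e → e = 0 ∨ e = 1) : P.IsIndecomposable A := by
  refine ⟨hA, h0, fun B C hB hC hBC => ?_⟩
  obtain ⟨S, hS, T, hT, hST, hTS⟩ := Equivalent.iso hA.1 hBC
  have hzero : ∀ {r : Fin t → ℕ}, (1 : Matrix (Idx r) (Idx r) k) = 0 → r = 0 := by
    intro r h
    by_contra hr
    obtain ⟨x⟩ := Idx.nonempty_of_ne hr
    exact one_ne_zero ((one_apply_eq x).symm.trans (congrFun (congrFun h x) x))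
  have e1 : ((ιl B C) * T) * (S * (πl B C)) = (1 : Matrix (Idx B.size) (Idx B.size) k) := by
    calc _ = (ιl B C) * (T * S) * (πl B C) := by simp only [Matrix.mul_assoc]
      _ = 1 := by
        rw [hTS]
        exact (congrArg (· * (πl B C)) (Matrix.mul_one (ιl B C))).trans (ιl_mul_πl B C)
  have e2 : ((ιr B C) * T) * (S * (πl B C)) = 0 := by
    calc _ = (ιr B C) * (T * S) * (πl B C) := by simp only [Matrix.mul_assoc]
      _ = 0 := by
        rw [hTS]
        exact (congrArg (· * (πl B C)) (Matrix.mul_one (ιr B C))).trans (ιr_mul_πl B C)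
  have e3 : ((ιr B C) * T) * (S * (πr B C)) = (1 : Matrix (Idx C.size) (Idx C.size) k) := by
    calc _ = (ιr B C) * (T * S) * (πr B C) := by simp only [Matrix.mul_assoc]
      _ = 1 := by
        rw [hTS]
        exact (congrArg (· * (πr B C)) (Matrix.mul_one (ιr B C))).trans (ιr_mul_πr B C)
  -- `x * y` is the projection of `A` onto the summand `B`. If it is 0, the identity of `B`
  -- vanishes; if it is 1, the identity of `C` does. A zero identity means size zero.
  set x := S * (πl B C) with hx
  set y := (ιl B C) * T with hy
  have hxh : x ∈ P.homs A B := homs_mul hS (πl_mem_homs hB.1 hC.1)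
  have hyh : y ∈ P.homs B A := homs_mul (ιl_mem_homs hB.1 hC.1) hT
  rcases h (x * y) (homs_mul hxh hyh) (by
    calc _ = x * (y * x) * y := by simp only [Matrix.mul_assoc]
      _ = _ := by rw [e1, Matrix.mul_one]) with h | h
  · left
    apply hzero
    calc 1 = (y * x) * (y * x) := by rw [e1, Matrix.one_mul]
      _ = y * (x * y) * x := by simp only [Matrix.mul_assoc]
      _ = 0 := by rw [h, Matrix.mul_zero, Matrix.zero_mul]
  · right
    apply hzero
    calc 1 = ((ιr B C) * T) * (x * y) * (S * (πr B C)) := by rw [h, Matrix.mul_one, e3]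
      _ = (((ιr B C) * T) * x) * (y * (S * (πr B C))) := by simp only [Matrix.mul_assoc]
      _ = 0 := by rw [e2, Matrix.zero_mul]

/-- Every matrix is isomorphic to a block-direct sum of indecomposable matrices. -/
theorem exists_iso_listSum (hA : P.Mem A) : ∃ L : List (BlockMatrix k t),
    (∀ B ∈ L, P.IsIndecomposable B) ∧ P.Iso A (BlockMatrix.listSum L) := by
  induction hn : ∑ i, A.size i using Nat.strong_induction_on generalizing A with
  | _ n ih =>
  by_cases h0 : A.size = 0
  · refine ⟨[], by simp, 0, Submodule.zero_mem _, 0, Submodule.zero_mem _, ?_, ?_⟩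
    · have := Idx.isEmpty h0
      exact Subsingleton.elim _ _
    · have : IsEmpty (Idx (BlockMatrix.listSum (k := k) (t := t) []).size) := Idx.isEmpty rfl
      exact Subsingleton.elim _ _
  by_cases hI : P.IsIndecomposable A
  · refine ⟨[A], by simpa using hI, ?_⟩
    rw [BlockMatrix.listSum_singleton]
    exact Iso.refl hA.1
  simp only [IsIndecomposable, not_and, not_forall, not_or] at hI
  obtain ⟨B, C, hB, hC, hBC, hB0, hC0⟩ := hI hA h0
  have hs : ∑ i, A.size i = ∑ i, B.size i + ∑ i, C.size i := by
    rw [hBC.size_eq, ← Finset.sum_add_distrib]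
    rfl
  have hpos : ∀ {r : Fin t → ℕ}, r ≠ 0 → 0 < ∑ i, r i := by
    intro r hr
    obtain ⟨i, hi⟩ := Function.ne_iff.mp hr
    exact Finset.sum_pos' (fun _ _ => Nat.zero_le _) ⟨i, Finset.mem_univ i, Nat.pos_of_ne_zero hi⟩
  have hB1 := hpos hB0
  have hC1 := hpos hC0
  obtain ⟨L, hL, hL'⟩ := ih _ (by omega) hB rfl
  obtain ⟨K, hK, hK'⟩ := ih _ (by omega) hC rfl
  refine ⟨L ++ K, fun D hD => (List.mem_append.mp hD).elim (hL D) (hK D), ?_⟩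
  rw [BlockMatrix.listSum_append]
  exact (Equivalent.iso hA.1 hBC).trans (Iso.blockSum hL' hK' hB.1 hC.1)

end Problem

end Structure


/-! ### Local algebras -/

section Local

open Polynomial in
/-- Fitting's lemma: in a finite-dimensional algebra without nontrivial idempotents over an
algebraically closed field each element is the sum of a scalar and a nilpotent element. -/
theorem exists_isNilpotent_sub {k E : Type*} [Field k] [IsAlgClosed k] [Ring E] [Algebra k E]
    [FiniteDimensional k E] [Nontrivial E] (h : ∀ e : E, e * e = e → e = 0 ∨ e = 1) (x : E) :
    ∃ c : k, IsNilpotent (x - algebraMap k E c) := by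
  obtain ⟨c, hc⟩ := spectrum.nonempty_of_isAlgClosed_of_finiteDimensional k x
  have hx : ¬ IsUnit (x - algebraMap k E c) := by
    rw [spectrum.mem_iff] at hc
    rwa [← neg_sub, IsUnit.neg_iff]
  have hp := minpoly.ne_zero (Algebra.IsIntegral.isIntegral (R := k) x)
  obtain ⟨q, hq, hdvd⟩ := Polynomial.exists_eq_pow_rootMultiplicity_mul_and_not_dvd
    (minpoly k x) hp c
  set n := (minpoly k x).rootMultiplicity c
  -- The exponent `n + 1` instead of the multiplicity `n` lets one factor `X - c` be split off below
  -- without proving `n > 0`.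
  have hcop : IsCoprime ((X - C c) ^ (n + 1)) q :=
    (((Polynomial.irreducible_X_sub_C c).coprime_iff_not_dvd).mpr hdvd).pow_left
  obtain ⟨u, v, huv⟩ := hcop
  have hX : aeval x (X - C c) = x - algebraMap k E c := by simp
  have h0 : aeval x ((X - C c) ^ (n + 1) * q) = 0 := by
    have e : (X - C c) ^ (n + 1) * q = (X - C c) * minpoly k x := by
      conv_rhs => rw [hq]
      ring
    rw [e, map_mul, minpoly.aeval, mul_zero]
  have h1 : aeval x (v * q) = 1 - aeval x (u * (X - C c) ^ (n + 1)) := by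
    rw [← map_one (aeval (R := k) x), ← huv, map_add, add_sub_cancel_left]
  -- This is the projection onto the generalized eigenspace of `c`. If it were 0, `x - c` would be
  -- invertible; so it is 1, and `x - c` is nilpotent.
  have he : aeval x (v * q) * aeval x (v * q) = aeval x (v * q) := by
    have e : v * q * (v * q) = v * q - u * v * ((X - C c) ^ (n + 1) * q) := by
      linear_combination (v * q) * huv
    rw [← map_mul, e, map_sub, map_mul _ (u * v), h0, mul_zero, sub_zero]
  refine ⟨c, n + 1, ?_⟩
  rw [← hX, ← map_pow]
  rcases h _ he with h2 | h2
  · refine absurd ?_ hx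
    have h3 : aeval x (u * (X - C c) ^ (n + 1)) = 1 := by
      rw [h2, eq_comm, sub_eq_zero] at h1
      exact h1.symm
    have e : (X - C c) * (u * (X - C c) ^ n) = u * (X - C c) ^ (n + 1) := by ring
    have h4 : aeval x (X - C c) * aeval x (u * (X - C c) ^ n) = 1 := by
      rw [← map_mul, e, h3]
    have h5 : aeval x (u * (X - C c) ^ n) * aeval x (X - C c) = 1 := by
      rw [← map_mul, mul_comm, e, h3]
    rw [← hX]
    exact ⟨⟨_, _, h4, h5⟩, rfl⟩
  · have e : (X - C c) ^ (n + 1) * (v * q) = v * ((X - C c) ^ (n + 1) * q) := by ring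
    have h3 := congrArg (aeval x) e
    rwa [map_mul, h2, mul_one, map_mul _ v, h0, mul_zero] at h3

variable {k E : Type*} [Field k] [Ring E] [Algebra k E]

theorem isUnit_of_isNilpotent_sub {x : E} {c : k} (hc : c ≠ 0)
    (h : IsNilpotent (x - algebraMap k E c)) : IsUnit x := by
  have h1 : IsUnit (algebraMap k E c) := (IsUnit.mk0 c hc).map _
  have h2 := h.isUnit_add_left_of_commute h1 (Algebra.commutes c _).symm
  rwa [add_sub_cancel] at h2

/-- An algebra in which each element is the sum of a scalar and a nilpotent element is local. -/
theorem exists_algHom_isNilpotent [Nontrivial E]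
    (h : ∀ x : E, ∃ c : k, IsNilpotent (x - algebraMap k E c)) :
    ∃ χ : E →ₐ[k] k, ∀ x, IsNilpotent (x - algebraMap k E (χ x)) := by
  have hunit : ∀ {x : E}, ¬ IsUnit x → IsNilpotent x := by
    intro x hx
    obtain ⟨c, hc⟩ := h x
    by_cases h0 : c = 0
    · simpa [h0] using hc
    · exact absurd (isUnit_of_isNilpotent_sub h0 hc) hx
  have hnu : ∀ {x : E}, IsNilpotent x → ¬ IsUnit x := fun hx hu => hx.not_isUnit hu
  -- If `x * y` were a unit, `x` would have a right inverse `z`; multiplying `x ^ n = 0` repeatedly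
  -- by `z` descends to `x ^ 0 = 0`, which is absurd.
  have hmul : ∀ {x : E} (y : E), IsNilpotent x → IsNilpotent (x * y) := by
    intro x y hx
    refine hunit fun hu => ?_
    obtain ⟨u, hu⟩ := hu
    have hr : x * (y * (↑u⁻¹ : E)) = 1 := by rw [← mul_assoc, ← hu, Units.mul_inv]
    set z := y * (↑u⁻¹ : E)
    obtain ⟨n, hn⟩ := hx
    have : ∀ j, x ^ (n - j) = 0 := by
      intro j
      induction j with
      | zero => exact hn
      | succ j ih =>
        by_cases hj : j < n
        · have e : n - j = (n - (j + 1)) + 1 := by omega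
          rw [e, pow_succ] at ih
          calc x ^ (n - (j + 1)) = x ^ (n - (j + 1)) * x * z := by rw [mul_assoc, hr, mul_one]
            _ = 0 := by rw [ih, zero_mul]
        · have e : n - (j + 1) = n - j := by omega
          rw [e, ih]
    have h1 := this n
    simp at h1
  -- If `x + y` were a unit `u`, then `y * u⁻¹ = 1 - x * u⁻¹` would be both nilpotent and a unit.
  have hadd : ∀ {x y : E}, IsNilpotent x → IsNilpotent y → IsNilpotent (x + y) := by
    intro x y hx hy
    refine hunit fun hu => ?_
    obtain ⟨u, hu⟩ := hu
    have h1 : x * (↑u⁻¹ : E) + y * (↑u⁻¹ : E) = 1 := by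
      rw [← add_mul, ← hu, Units.mul_inv]
    have h2 := (hmul (↑u⁻¹ : E) hx).isUnit_one_sub
    rw [← h1, add_sub_cancel_left] at h2
    exact hnu (hmul _ hy) h2
  have hsmul : ∀ {x : E} (c : k), IsNilpotent x → IsNilpotent (c • x) := by
    intro x c hx
    rw [Algebra.smul_def, Algebra.commutes]
    exact hmul _ hx
  have hscal : ∀ {c : k}, IsNilpotent (algebraMap k E c) → c = 0 := by
    intro c hc
    by_contra h0
    exact hnu hc ((IsUnit.mk0 c h0).map _)
  choose χ hχ using h
  -- The difference of two possible scalars is nilpotent, hence zero. This uniqueness makes `χ`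
  -- linear and multiplicative.
  have huniq : ∀ {x : E} {c : k}, IsNilpotent (x - algebraMap k E c) → χ x = c := by
    intro x c hc
    have h1 := hadd hc (hsmul (-1) (hχ x))
    have h2 : x - algebraMap k E c + (-1 : k) • (x - algebraMap k E (χ x)) =
        algebraMap k E (χ x - c) := by
      rw [neg_smul, one_smul, map_sub]
      abel
    rw [h2] at h1
    exact sub_eq_zero.mp (hscal h1)
  refine ⟨AlgHom.ofLinearMap
    { toFun := χ
      map_add' := fun x y => huniq (by
        have e : x + y - algebraMap k E (χ x + χ y) =
          (x - algebraMap k E (χ x)) + (y - algebraMap k E (χ y)) := by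
            rw [map_add]
            abel
        rw [e]
        exact hadd (hχ x) (hχ y))
      map_smul' := fun c x => huniq (by
        have e : c • x - algebraMap k E (c • χ x) = c • (x - algebraMap k E (χ x)) := by
          rw [smul_sub, smul_eq_mul, map_mul, Algebra.smul_def, Algebra.smul_def]
        rw [RingHom.id_apply, e]
        exact hsmul c (hχ x)) }
    (huniq (by simp)) (fun x y => huniq (by
      have e : x * y - algebraMap k E (χ x * χ y) =
          (x - algebraMap k E (χ x)) * y + χ x • (y - algebraMap k E (χ y)) := by
        rw [sub_mul, smul_sub, Algebra.smul_def, Algebra.smul_def, map_mul]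
        abel
      exact e ▸ hadd (hmul y (hχ x)) (hsmul _ (hχ y)))), hχ⟩

end Local

/-! ### The Krull–Schmidt theorem -/

section KrullSchmidt

variable {k : Type*} [Field k] {t : ℕ}

namespace Problem

open BlockMatrix

variable {P : Problem k t} {A B N : BlockMatrix k t}

variable (P) in
/-- The endomorphism algebra. -/
noncomputable def endAlg (A : BlockMatrix k t) (hA : P.IsStepSequence A.size) :
    Subalgebra k (Matrix (Idx A.size) (Idx A.size) k) :=
  (P.homs A A).toSubalgebra (one_mem_homs hA) fun _ _ => homs_mul

theorem mem_endAlg {hA : P.IsStepSequence A.size} {S : Matrix (Idx A.size) (Idx A.size) k} :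
    S ∈ P.endAlg A hA ↔ S ∈ P.homs A A := Iff.rfl

variable (P) in
/-- A linear form that on the endomorphism algebra of `N` is the homomorphism onto the residue
field. -/
structure IsResidue (N : BlockMatrix k t) (ε : Matrix (Idx N.size) (Idx N.size) k →ₗ[k] k) :
    Prop where
  step : P.IsStepSequence N.size
  map_one : ε 1 = 1
  map_mul : ∀ S ∈ P.homs N N, ∀ T ∈ P.homs N N, ε (S * T) = ε S * ε T
  isUnit : ∀ S ∈ P.homs N N, ε S ≠ 0 → IsUnit S

theorem IsIndecomposable.exists_isResidue [IsAlgClosed k] (hN : P.IsIndecomposable N) :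
    ∃ ε, P.IsResidue N ε := by
  have hs := hN.1.1
  have : Nonempty (Idx N.size) := Idx.nonempty_of_ne hN.2.1
  have hfd : FiniteDimensional k (P.endAlg N hs) :=
    inferInstanceAs (FiniteDimensional k (Subalgebra.toSubmodule (P.endAlg N hs)))
  obtain ⟨χ, hχ⟩ := exists_algHom_isNilpotent (k := k) (E := P.endAlg N hs)
    (exists_isNilpotent_sub fun e he => by
      have h := hN.eq_zero_or_one (mem_endAlg.mp e.2) (congrArg Subtype.val he)
      exact h.imp (fun h => Subtype.ext h) (fun h => Subtype.ext h))
  -- Extending the residue map to all matrices allows it to be applied to products without passing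
  -- to the subalgebra; it is multiplicative only on endomorphisms.
  obtain ⟨ε, hε⟩ := LinearMap.exists_extend
    (p := Subalgebra.toSubmodule (P.endAlg N hs)) χ.toLinearMap
  have hεχ : ∀ S : P.endAlg N hs, ε S = χ S := fun S => LinearMap.congr_fun hε S
  refine ⟨ε, hs, ?_, fun S hS T hT => ?_, fun S hS h0 => ?_⟩
  · exact (hεχ 1).trans (map_one χ)
  · exact (hεχ (⟨S, hS⟩ * ⟨T, hT⟩)).trans ((_root_.map_mul χ _ _).trans
      (congrArg₂ (· * ·) (hεχ ⟨S, hS⟩).symm (hεχ ⟨T, hT⟩).symm))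
  · have h1 := isUnit_of_isNilpotent_sub (fun h => h0 ((hεχ ⟨S, hS⟩).trans h)) (hχ ⟨S, hS⟩)
    exact h1.map (P.endAlg N hs).val

variable {ε : Matrix (Idx N.size) (Idx N.size) k →ₗ[k] k}

variable (P) in
/-- The multiplicity of `N` in `A` is `n`: the composition pairing between the homomorphisms
`N → A` and `A → N` with values in the residue field of `N` has rank `n`. -/
def HasMultiplicity (N : BlockMatrix k t) (ε : Matrix (Idx N.size) (Idx N.size) k →ₗ[k] k)
    (A : BlockMatrix k t) (n : ℕ) : Prop :=
  ∃ (ι : Type) (_ : Fintype ι) (_ : DecidableEq ι)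
    (s : ι → Matrix (Idx N.size) (Idx A.size) k) (r : ι → Matrix (Idx A.size) (Idx N.size) k),
    Fintype.card ι = n ∧ (∀ i, s i ∈ P.homs N A) ∧ (∀ i, r i ∈ P.homs A N) ∧
    (∀ i j, ε (s i * r j) = (1 : Matrix ι ι k) i j) ∧
    ∀ a ∈ P.homs N A, ∀ b ∈ P.homs A N, ε (a * b) = ∑ i, ε (a * r i) * ε (s i * b)

/-- Two pairs of dual families yield two rectangular transition matrices inverse to each other, so
they are square. -/
theorem HasMultiplicity.unique {m n : ℕ} (hm : P.HasMultiplicity N ε A m)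
    (hn : P.HasMultiplicity N ε A n) : m = n := by
  obtain ⟨ι, _, _, s, r, rfl, hs, hr, hsr, hab⟩ := hm
  obtain ⟨κ, _, _, s', r', rfl, hs', hr', hsr', hab'⟩ := hn
  refine Matrix.square_of_invertible (R := k) (Matrix.of fun i j => ε (s i * r' j))
    (Matrix.of fun j i => ε (s' j * r i)) ?_ ?_
  · ext i i'
    rw [mul_apply, ← hsr, hab' _ (hs i) _ (hr i')]
    rfl
  · ext j j'
    rw [mul_apply, ← hsr', hab _ (hs' j) _ (hr' j')]
    rfl

theorem HasMultiplicity.iso {n : ℕ} (h : P.HasMultiplicity N ε A n) (hAB : P.Iso A B) :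
    P.HasMultiplicity N ε B n := by
  obtain ⟨ι, _, _, s, r, hn, hs, hr, hsr, hab⟩ := h
  obtain ⟨S, hS, T, hT, hST, hTS⟩ := hAB
  refine ⟨ι, inferInstance, inferInstance, fun i => s i * S, fun i => T * r i, hn, fun i => homs_mul (hs i) hS,
    fun i => homs_mul hT (hr i), fun i j => ?_, fun a ha b hb => ?_⟩
  · rw [← hsr, Matrix.mul_assoc, ← Matrix.mul_assoc S, hST, Matrix.one_mul]
  · have h1 := hab _ (homs_mul ha hT) _ (homs_mul hS hb)
    rw [Matrix.mul_assoc, ← Matrix.mul_assoc T, hTS, Matrix.one_mul] at h1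
    simpa only [Matrix.mul_assoc] using h1

theorem hasMultiplicity_empty : P.HasMultiplicity N ε BlockMatrix.empty 0 := by
  refine ⟨Fin 0, inferInstance, inferInstance, Fin.elim0, Fin.elim0, rfl, (·.elim0), (·.elim0), (·.elim0), ?_⟩
  intro a _ b _
  have : a * b = 0 := by
    have := Idx.isEmpty (n := (BlockMatrix.empty : BlockMatrix k t).size) rfl
    ext
    simp [mul_apply]
  rw [this, _root_.map_zero, Finset.univ_eq_empty, Finset.sum_empty]

/-- A composite through `A ⊎ B` is the sum of the composites through `A` and `B`, so the pairing is
an orthogonal sum and the dual families are juxtaposed. -/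
theorem HasMultiplicity.blockSum {m n : ℕ} (hA : P.HasMultiplicity N ε A m)
    (hB : P.HasMultiplicity N ε B n) (sA : P.IsStepSequence A.size)
    (sB : P.IsStepSequence B.size) : P.HasMultiplicity N ε (A.blockSum B) (m + n) := by
  obtain ⟨ι, _, _, s, r, hm, hs, hr, hsr, hab⟩ := hA
  obtain ⟨κ, _, _, s', r', hn, hs', hr', hsr', hab'⟩ := hB
  refine ⟨ι ⊕ κ, inferInstance, inferInstance,
    Sum.elim (fun i => s i * ιl A B) (fun i => s' i * ιr A B),
    Sum.elim (fun i => πl A B * r i) (fun i => πr A B * r' i), by rw [Fintype.card_sum, hm, hn],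
    ?_, ?_, ?_, fun a ha b hb => ?_⟩
  · rintro (i | i)
    · exact homs_mul (hs i) (ιl_mem_homs sA sB)
    · exact homs_mul (hs' i) (ιr_mem_homs sA sB)
  · rintro (i | i)
    · exact homs_mul (πl_mem_homs sA sB) (hr i)
    · exact homs_mul (πr_mem_homs sA sB) (hr' i)
  · rintro (i | i) (j | j)
    · rw [Sum.elim_inl, Sum.elim_inl, Matrix.mul_assoc, ← Matrix.mul_assoc (ιl A B), ιl_mul_πl,
        Matrix.one_mul, hsr]
      simp [one_apply]
    · rw [Sum.elim_inl, Sum.elim_inr, Matrix.mul_assoc, ← Matrix.mul_assoc (ιl A B), ιl_mul_πr]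
      simp [one_apply]
    · rw [Sum.elim_inl, Sum.elim_inr, Matrix.mul_assoc, ← Matrix.mul_assoc (ιr A B), ιr_mul_πl]
      simp [one_apply]
    · rw [Sum.elim_inr, Sum.elim_inr, Matrix.mul_assoc, ← Matrix.mul_assoc (ιr A B), ιr_mul_πr,
        Matrix.one_mul, hsr']
      simp [one_apply]
  · have e : a * b = (a * πl A B) * (ιl A B * b) + (a * πr A B) * (ιr A B * b) := by
      calc a * b = a * (πl A B * ιl A B + πr A B * ιr A B) * b := by
            rw [πl_mul_ιl_add, Matrix.mul_one]
        _ = _ := by simp only [Matrix.mul_add, Matrix.add_mul, Matrix.mul_assoc]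
    rw [e, map_add, hab _ (homs_mul ha (πl_mem_homs sA sB)) _ (homs_mul (ιl_mem_homs sA sB) hb),
      hab' _ (homs_mul ha (πr_mem_homs sA sB)) _ (homs_mul (ιr_mem_homs sA sB) hb),
      Fintype.sum_sum_type]
    simp only [Sum.elim_inl, Sum.elim_inr, Matrix.mul_assoc]

theorem IsResidue.hasMultiplicity_self (hε : P.IsResidue N ε) : P.HasMultiplicity N ε N 1 := by
  refine ⟨Unit, inferInstance, inferInstance, fun _ => 1, fun _ => 1, rfl, fun _ => one_mem_homs hε.step,
    fun _ => one_mem_homs hε.step, fun _ _ => ?_, fun a ha b hb => ?_⟩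
  · rw [Matrix.one_mul, hε.map_one]
    rfl
  · simp [hε.map_mul a ha b hb]

/-- If `ε (a * b) ≠ 0`, then `a * b` is invertible, and `N` is a direct summand of `A`. Since `A` is
indecomposable, this summand is all of `A`, contrary to `h`. -/
theorem IsResidue.hasMultiplicity_zero (hε : P.IsResidue N ε) (hA : P.IsIndecomposable A)
    (h : ¬ P.Iso A N) : P.HasMultiplicity N ε A 0 := by
  refine ⟨Fin 0, inferInstance, inferInstance, Fin.elim0, Fin.elim0, rfl, (·.elim0), (·.elim0), (·.elim0), ?_⟩
  intro a ha b hb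
  rw [Finset.univ_eq_empty, Finset.sum_empty]
  by_contra h0
  have hu := hε.isUnit _ (homs_mul ha hb) h0
  have hinv : (a * b)⁻¹ ∈ P.homs N N :=
    mem_endAlg.mp (inv_mem_of_isUnit (P.endAlg N hε.step) (homs_mul ha hb) hu)
  have h1 : a * (b * (a * b)⁻¹) = 1 := by
    rw [← Matrix.mul_assoc, Matrix.mul_nonsing_inv _ ((Matrix.isUnit_iff_isUnit_det _).mp hu)]
  have hb' := homs_mul hb hinv
  set b' := b * (a * b)⁻¹
  rcases hA.eq_zero_or_one (homs_mul hb' ha) (by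
    calc b' * a * (b' * a) = b' * (a * b') * a := by simp only [Matrix.mul_assoc]
      _ = b' * a := by rw [h1, Matrix.mul_one]) with h2 | h2
  · have h3 : (1 : Matrix (Idx N.size) (Idx N.size) k) = 0 := by
      calc 1 = (a * b') * (a * b') := by rw [h1, Matrix.one_mul]
        _ = a * (b' * a) * b' := by simp only [Matrix.mul_assoc]
        _ = 0 := by rw [h2, Matrix.mul_zero, Matrix.zero_mul]
    have h4 := hε.map_one
    rw [h3, _root_.map_zero] at h4
    exact zero_ne_one h4
  · exact h ⟨b', hb', a, ha, h2, h1⟩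

open Classical in
theorem IsResidue.hasMultiplicity_listSum (hε : P.IsResidue N ε) {L : List (BlockMatrix k t)}
    (hL : ∀ A ∈ L, P.IsIndecomposable A) :
    P.HasMultiplicity N ε (listSum L) (L.countP fun A => P.Iso A N) := by
  induction L with
  | nil => exact hasMultiplicity_empty
  | cons A L ih =>
    have hA := hL A List.mem_cons_self
    have hL' : ∀ B ∈ L, P.IsIndecomposable B := fun B hB => hL B (List.mem_cons_of_mem _ hB)
    rw [List.countP_cons, add_comm]
    refine HasMultiplicity.blockSum ?_ (ih hL') hA.1.1 (mem_listSum fun B hB => (hL' B hB).1).1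
    by_cases h : P.Iso A N
    · simpa [h] using hε.hasMultiplicity_self.iso h.symm
    · simpa [h] using hε.hasMultiplicity_zero hA h

open Classical in
/-- The Krull–Schmidt theorem: isomorphic sums of indecomposable matrices have the same numbers of
summands of each isomorphism type. -/
theorem countP_iso_eq [IsAlgClosed k] {L K : List (BlockMatrix k t)}
    (hL : ∀ A ∈ L, P.IsIndecomposable A) (hK : ∀ A ∈ K, P.IsIndecomposable A)
    (h : P.Iso (listSum L) (listSum K)) (hN : P.IsIndecomposable N) :
    L.countP (fun A => P.Iso A N) = K.countP fun A => P.Iso A N := by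
  obtain ⟨ε, hε⟩ := hN.exists_isResidue
  exact ((hε.hasMultiplicity_listSum hL).iso h).unique (hε.hasMultiplicity_listSum hK)

/-- Two finite families with equally many members in each class of an equivalence relation
correspond to each other. -/
theorem exists_equiv_of_card_eq {α β γ : Type*} [Fintype α] [Fintype β] (f : α → γ) (g : β → γ)
    (h : ∀ c, Nat.card {a // f a = c} = Nat.card {b // g b = c}) :
    ∃ e : α ≃ β, ∀ a, g (e a) = f a := by
  let e : ∀ c, {a // f a = c} ≃ {b // g b = c} := fun c =>
    (Finite.equivFinOfCardEq (h c)).trans (Finite.equivFin _).symm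
  exact ⟨(Equiv.sigmaFiberEquiv f).symm.trans ((Equiv.sigmaCongrRight e).trans
    (Equiv.sigmaFiberEquiv g)), fun a => (e (f a) ⟨a, rfl⟩).2⟩

end Problem

end KrullSchmidt


/-! ### Lists with repetitions and permutation matrices -/

theorem List.countP_ofFn_eq_card {α : Type*} {n : ℕ} (f : Fin n → α) (p : α → Prop)
    [DecidablePred p] :
    (List.ofFn f).countP (fun a => p a) = Nat.card {i // p (f i)} := by
  have h : (List.ofFn f).countP (fun a => p a) = ∑ i, if p (f i) then 1 else 0 := by
    induction n with
    | zero => simp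
    | succ n ih =>
      rw [List.ofFn_succ, List.countP_cons, ih, Fin.sum_univ_succ, add_comm]
      simp
  rw [h, Nat.card_eq_fintype_card, Fintype.card_subtype, Finset.card_filter]

theorem List.count_flatten_replicate {α : Type*} [DecidableEq α] {n : ℕ} (f : Fin n → α)
    (q : Fin n → ℕ) (a : α) :
    (List.ofFn fun i => List.replicate (q i) (f i)).flatten.count a =
      ∑ i, if f i = a then q i else 0 := by
  induction n with
  | zero => simp
  | succ n ih =>
    rw [List.ofFn_succ, List.flatten_cons, List.count_append, ih, Fin.sum_univ_succ,
      List.count_replicate]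
    simp

/-- A list is a permutation of a list of repeated distinct elements. -/
theorem List.exists_perm_flatten_replicate {α : Type*} (L : List α) :
    ∃ (l : ℕ) (f : Fin l → α) (q : Fin l → ℕ), (∀ i, f i ∈ L) ∧ Function.Injective f ∧
      (∀ i, 0 < q i) ∧ (List.ofFn fun i => List.replicate (q i) (f i)).flatten.Perm L := by
  classical
  have hnd : Function.Injective L.dedup.get := List.nodup_iff_injective_get.mp L.nodup_dedup
  have hmem : ∀ i, L.dedup.get i ∈ L := fun i => List.mem_dedup.mp (List.get_mem _ _)
  refine ⟨L.dedup.length, L.dedup.get, fun i => L.count (L.dedup.get i), hmem, hnd,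
    fun i => List.count_pos_iff.mpr (hmem i), List.perm_iff_count.mpr fun a => ?_⟩
  rw [List.count_flatten_replicate]
  by_cases ha : a ∈ L
  · obtain ⟨i, rfl⟩ := List.mem_iff_get.mp (List.mem_dedup.mpr ha)
    rw [Finset.sum_eq_single i, if_pos rfl]
    · exact fun j _ hj => if_neg fun h => hj (hnd h)
    · exact fun h => absurd (Finset.mem_univ i) h
  · rw [List.count_eq_zero_of_not_mem ha]
    exact Finset.sum_eq_zero fun i _ => if_neg fun h : L.dedup.get i = a => ha (h ▸ hmem i)

theorem isUnit_permMatrix {k X : Type*} [Field k] [Fintype X] [DecidableEq X]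
    (σ : Equiv.Perm X) : IsUnit (σ.permMatrix k) := by
  rw [Matrix.isUnit_iff_isUnit_det, Matrix.det_permutation]
  exact (Equiv.Perm.sign σ).isUnit.map (Int.castRingHom k)

section Permutations

variable {k : Type*} [Field k] {t : ℕ} {m n : Fin t → ℕ}

namespace Problem

open BlockMatrix

variable {P : Problem k t} {A B C : BlockMatrix k t}

/-- Isomorphic sums of indecomposable matrices have the same summands up to isomorphism. -/
theorem exists_equiv_iso [IsAlgClosed k] {r s : ℕ} {B : Fin r → BlockMatrix k t}
    {C : Fin s → BlockMatrix k t} (hB : ∀ i, P.IsIndecomposable (B i))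
    (hC : ∀ i, P.IsIndecomposable (C i))
    (h : P.Iso (listSum (List.ofFn B)) (listSum (List.ofFn C))) :
    ∃ e : Fin r ≃ Fin s, ∀ i, P.Iso (B i) (C (e i)) := by
  classical
  have hL : ∀ {r : ℕ} {B : Fin r → BlockMatrix k t}, (∀ i, P.IsIndecomposable (B i)) →
      ∀ A ∈ List.ofFn B, P.IsIndecomposable A := by
    intro r B hB A hA
    obtain ⟨i, rfl⟩ := List.mem_ofFn.mp hA
    exact hB i
  -- `Iso` is reflexive only for step-sequences, so no setoid on all block matrices is available;
  -- the set of isomorphic matrices encodes the isomorphism type instead.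
  have hset : ∀ {A N : BlockMatrix k t}, P.IsIndecomposable A → P.IsIndecomposable N →
      ({D | P.Iso A D} = {D | P.Iso N D} ↔ P.Iso A N) := by
    intro A N hA hN
    refine ⟨fun h => ?_, fun h => ?_⟩
    · have : N ∈ {D | P.Iso A D} := h ▸ Iso.refl hN.1.1
      exact this
    · ext D
      exact ⟨fun h' => h.symm.trans h', fun h' => h.trans h'⟩
  have hcard : ∀ N, P.IsIndecomposable N →
      Nat.card {i // {D | P.Iso (B i) D} = {D | P.Iso N D}} =
        Nat.card {i // {D | P.Iso (C i) D} = {D | P.Iso N D}} := by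
    intro N hN
    have h1 := countP_iso_eq (hL hB) (hL hC) h hN
    rw [List.countP_ofFn_eq_card, List.countP_ofFn_eq_card] at h1
    simpa only [hset (hB _) hN, hset (hC _) hN] using h1
  obtain ⟨e, he⟩ := exists_equiv_of_card_eq (fun i => {D | P.Iso (B i) D})
    (fun i => {D | P.Iso (C i) D}) fun c => by
      by_cases h1 : ∃ i, {D | P.Iso (B i) D} = c
      · obtain ⟨i, rfl⟩ := h1
        exact hcard _ (hB i)
      · by_cases h2 : ∃ i, {D | P.Iso (C i) D} = c
        · obtain ⟨i, rfl⟩ := h2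
          exact hcard _ (hC i)
        · have e1 : IsEmpty {i // {D | P.Iso (B i) D} = c} := ⟨fun i => h1 ⟨i.1, i.2⟩⟩
          have e2 : IsEmpty {i // {D | P.Iso (C i) D} = c} := ⟨fun i => h2 ⟨i.1, i.2⟩⟩
          rw [Nat.card_of_isEmpty, Nat.card_of_isEmpty]
  refine ⟨e, fun i => (hset (hC (e i)) (hB i)).mp (he i) |>.symm⟩

/-! ### Permutations of rows -/

variable (P) in
/-- The map of indices permutes the rows inside the strips, in the same way in equivalent strips. -/
structure IsStripMap (φ : Idx m → Idx n) : Prop where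
  strip : ∀ x, (φ x).strip = x.strip
  row : ∀ x y, P.rel x.strip y.strip → (x.row : ℕ) = y.row → ((φ x).row : ℕ) = (φ y).row

theorem IsStripMap.submatrix_mem {φ : Idx m → Idx n} (hφ : P.IsStripMap φ)
    (hm : P.IsStepSequence m) (hn : P.IsStepSequence n) :
    (1 : Matrix (Idx n) (Idx n) k).submatrix φ id ∈ P.gammaRect m n := by
  convert blockDiag_mem (k := k) hm hn (f := fun i p q =>
    if h : p < m i then if ((φ (Idx.mk i ⟨p, h⟩)).row : ℕ) = q then 1 else 0 else 0)
    fun i j h => by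
      funext p q
      by_cases hp : p < m i
      · have hp' : p < m j := hm i j h ▸ hp
        rw [dif_pos hp, dif_pos hp', hφ.row (Idx.mk i ⟨p, hp⟩) (Idx.mk j ⟨p, hp'⟩) h rfl]
      · rw [dif_neg hp, dif_neg (hm i j h ▸ hp)]
  ext x y
  obtain ⟨i, p, rfl⟩ := Idx.exists_mk x
  simp only [submatrix_apply, id, one_apply, ofEntry, of_apply, Idx.eq_iff, hφ.strip, Idx.strip_mk,
    ite_and, Idx.row_mk, p.2, ↓reduceDIte, Fin.eta]
  congr

theorem IsStripMap.submatrix_mem' {φ : Idx m → Idx n} (hφ : P.IsStripMap φ)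
    (hm : P.IsStepSequence m) (hn : P.IsStepSequence n) :
    (1 : Matrix (Idx n) (Idx n) k).submatrix id φ ∈ P.gammaRect n m := by
  convert blockDiag_mem (k := k) hn hm (f := fun i p q =>
    if h : q < m i then if p = ((φ (Idx.mk i ⟨q, h⟩)).row : ℕ) then 1 else 0 else 0)
    fun i j h => by
      funext p q
      by_cases hq : q < m i
      · have hq' : q < m j := hm i j h ▸ hq
        rw [dif_pos hq, dif_pos hq', hφ.row (Idx.mk i ⟨q, hq⟩) (Idx.mk j ⟨q, hq'⟩) h rfl]
      · rw [dif_neg hq, dif_neg (hm i j h ▸ hq)]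
  ext y x
  obtain ⟨i, p, rfl⟩ := Idx.exists_mk x
  obtain ⟨j, q, rfl⟩ := Idx.exists_mk y
  simp only [submatrix_apply, id, one_apply, ofEntry, of_apply, Idx.eq_iff, hφ.strip, Idx.strip_mk,
    ite_and, Idx.row_mk]
  by_cases h : j = i
  · subst h
    simp only [if_true, p.2, ↓reduceDIte, Fin.eta]
    congr
  · simp only [h, if_false]

variable (P) in
/-- The matrix `B` is obtained from `A` by a permutation of rows and the same permutation of
columns inside the strips. -/
def PermIso (A B : BlockMatrix k t) : Prop :=
  ∃ σ : Idx B.size ≃ Idx A.size, P.IsStripMap σ ∧ B.mat = A.mat.submatrix σ σ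

theorem PermIso.refl (A : BlockMatrix k t) : P.PermIso A A :=
  ⟨Equiv.refl _, ⟨fun _ => rfl, fun _ _ _ h => h⟩, rfl⟩

theorem PermIso.trans : P.PermIso A B → P.PermIso B C → P.PermIso A C := by
  rintro ⟨σ, hσ, h⟩ ⟨τ, hτ, h'⟩
  refine ⟨τ.trans σ, ⟨fun x => (hσ.strip _).trans (hτ.strip x), fun x y hxy hr => ?_⟩, ?_⟩
  · exact hσ.row _ _ (by rwa [hτ.strip, hτ.strip]) (hτ.row x y hxy hr)
  · rw [h', h]
    rfl

theorem PermIso.size_eq (h : P.PermIso A B) : A.size = B.size := by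
  obtain ⟨σ, hσ, -⟩ := h
  have hcard : ∀ {n : Fin t → ℕ} (i : Fin t), Fintype.card {x : Idx n // x.strip = i} = n i := by
    intro n i
    rw [← Fintype.card_fin (n i)]
    exact (Fintype.card_congr ⟨fun p => ⟨Idx.mk i p, rfl⟩, fun x => x.2 ▸ x.1.row, fun _ => rfl,
      fun ⟨x, hx⟩ => by subst hx; rfl⟩).symm
  funext i
  rw [← hcard (n := A.size) i, ← hcard (n := B.size) i]
  exact (Fintype.card_congr (σ.subtypeEquiv fun x => by rw [hσ.strip])).symm

/-- A permutation of rows and columns is a similarity transformation with a permutation matrix. -/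
theorem PermIso.exists_permMatrix (h : P.PermIso A B) (hA : P.IsStepSequence A.size) :
    ∃ σ : Equiv.Perm (Idx A.size), σ.permMatrix k ∈ P.gammaSpace A.size ∧
      A.conj (σ.permMatrix k) = B := by
  have hs := h.size_eq
  obtain ⟨σ, hσ, h⟩ := h
  obtain ⟨n, M⟩ := A
  obtain ⟨n', N⟩ := B
  obtain rfl : n = n' := hs
  change N = M.submatrix σ σ at h
  -- `permMatrix` places its ones at `(x, σ x)`, so renumbering the columns by `σ` corresponds to
  -- the inverse permutation.
  have e : Equiv.Perm.permMatrix k σ.symm = (1 : Matrix (Idx n) (Idx n) k).submatrix id σ := by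
    ext x y
    rw [Equiv.Perm.permMatrix, PEquiv.toMatrix_toPEquiv_apply, submatrix_apply, id, Pi.single_apply,
      one_apply]
    simp only [Equiv.eq_symm_apply, eq_comm]
  refine ⟨σ.symm, mem_gammaRect_iff.mp (e ▸ hσ.submatrix_mem' hA hA), ?_⟩
  have hu : IsUnit (Equiv.Perm.permMatrix k σ.symm) := isUnit_permMatrix _
  unfold BlockMatrix.conj
  congr 1
  refine (inv_mul_mul_eq_iff hu).mpr ?_
  rw [h, Equiv.Perm.permMatrix, PEquiv.mul_toMatrix_toPEquiv, PEquiv.toMatrix_toPEquiv_mul]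
  ext x y
  simp

/-- In equivalent strips the first summand occupies equally many rows, so equal row numbers fall
into the same summand. -/
theorem exists_inl_inl_or_inr_inr (hA : P.IsStepSequence A.size) {x y : Idx (A.blockSum B).size}
    (h : P.rel x.strip y.strip) (hr : (x.row : ℕ) = y.row) :
    (∃ x' y', x = inl A B x' ∧ y = inl A B y' ∧ P.rel x'.strip y'.strip ∧
      (x'.row : ℕ) = y'.row) ∨
    ∃ x' y', x = inr A B x' ∧ y = inr A B y' ∧ P.rel x'.strip y'.strip ∧
      (x'.row : ℕ) = y'.row := by
  rcases exists_inl_or_inr A B x with ⟨x, rfl⟩ | ⟨x, rfl⟩ <;>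
    rcases exists_inl_or_inr A B y with ⟨y, rfl⟩ | ⟨y, rfl⟩
  · exact Or.inl ⟨x, y, rfl, rfl, h, hr⟩
  · have h1 := hA _ _ h
    have := x.row.2
    simp only [strip_inl, strip_inr, row_inl, row_inr] at hr h1
    omega
  · have h1 := hA _ _ h
    have := y.row.2
    simp only [strip_inl, strip_inr, row_inl, row_inr] at hr h1
    omega
  · have h1 := hA _ _ h
    simp only [strip_inr, row_inr] at hr h1
    exact Or.inr ⟨x, y, rfl, rfl, h, by omega⟩

theorem PermIso.blockSum {A' B' : BlockMatrix k t} (h : P.PermIso A A') (h' : P.PermIso B B')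
    (hA : P.IsStepSequence A.size) : P.PermIso (A.blockSum B) (A'.blockSum B') := by
  have hA' : P.IsStepSequence A'.size := h.size_eq ▸ hA
  obtain ⟨σ, hσ, h⟩ := h
  obtain ⟨τ, hτ, h'⟩ := h'
  let ρ := (sumEquiv A' B').symm.trans ((Equiv.sumCongr σ τ).trans (sumEquiv A B))
  have hl : ∀ x, ρ (inl A' B' x) = inl A B (σ x) := fun x => by
    simp [ρ, sumEquiv_symm_inl]
  have hr : ∀ x, ρ (inr A' B' x) = inr A B (τ x) := fun x => by
    simp [ρ, sumEquiv_symm_inr]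
  refine ⟨ρ, ⟨fun x => ?_, fun x y hxy hrow => ?_⟩, ?_⟩
  · rcases exists_inl_or_inr A' B' x with ⟨x, rfl⟩ | ⟨x, rfl⟩
    · rw [hl]
      exact hσ.strip x
    · rw [hr]
      exact hτ.strip x
  · rcases exists_inl_inl_or_inr_inr hA' hxy hrow with ⟨x, y, rfl, rfl, hxy, hrow⟩ |
      ⟨x, y, rfl, rfl, hxy, hrow⟩
    · rw [hl, hl, row_inl, row_inl]
      exact hσ.row x y hxy hrow
    · have h1 := hA (τ x).strip (τ y).strip (by rwa [hτ.strip, hτ.strip])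
      rw [hr, hr, row_inr, row_inr, h1, hτ.row x y hxy hrow]
  · ext x y
    rw [submatrix_apply]
    rcases exists_inl_or_inr A' B' x with ⟨x, rfl⟩ | ⟨x, rfl⟩ <;>
      rcases exists_inl_or_inr A' B' y with ⟨y, rfl⟩ | ⟨y, rfl⟩ <;> simp [hl, hr, h, h']

theorem PermIso.blockSum_comm (hA : P.IsStepSequence A.size) (hB : P.IsStepSequence B.size) :
    P.PermIso (A.blockSum B) (B.blockSum A) := by
  let ρ := (sumEquiv B A).symm.trans ((Equiv.sumComm _ _).trans (sumEquiv A B))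
  have hl : ∀ x, ρ (inl B A x) = inr A B x := fun x => by
    simp [ρ, sumEquiv_symm_inl]
  have hr : ∀ x, ρ (inr B A x) = inl A B x := fun x => by
    simp [ρ, sumEquiv_symm_inr]
  refine ⟨ρ, ⟨fun x => ?_, fun x y hxy hrow => ?_⟩, ?_⟩
  · rcases exists_inl_or_inr B A x with ⟨x, rfl⟩ | ⟨x, rfl⟩
    · rw [hl]
      rfl
    · rw [hr]
      rfl
  · rcases exists_inl_inl_or_inr_inr hB hxy hrow with ⟨x, y, rfl, rfl, hxy, hrow⟩ |
      ⟨x, y, rfl, rfl, hxy, hrow⟩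
    · rw [hl, hl, row_inr, row_inr, hA _ _ hxy, hrow]
    · rw [hr, hr, row_inl, row_inl, hrow]
  · ext x y
    rw [submatrix_apply]
    rcases exists_inl_or_inr B A x with ⟨x, rfl⟩ | ⟨x, rfl⟩ <;>
      rcases exists_inl_or_inr B A y with ⟨y, rfl⟩ | ⟨y, rfl⟩ <;> simp [hl, hr]

theorem PermIso.listSum {L K : List (BlockMatrix k t)} (h : L.Perm K)
    (hL : ∀ A ∈ L, P.IsStepSequence A.size) :
    P.PermIso (BlockMatrix.listSum L) (BlockMatrix.listSum K) := by
  induction h with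
  | nil => exact PermIso.refl _
  | cons A _ ih =>
    exact PermIso.blockSum (PermIso.refl A) (ih fun B hB => hL B (List.mem_cons_of_mem _ hB))
      (hL A List.mem_cons_self)
  | swap A B L =>
    have hA := hL A (by simp)
    have hB := hL B (by simp)
    change P.PermIso (B.blockSum (A.blockSum _)) (A.blockSum (B.blockSum _))
    rw [← blockSum_assoc, ← blockSum_assoc]
    exact PermIso.blockSum (PermIso.blockSum_comm hB hA) (PermIso.refl _) (hB.blockSum hA)
  | trans h₁ _ ih₁ ih₂ =>
    exact (ih₁ hL).trans (ih₂ fun A hA => hL A (h₁.mem_iff.mpr hA))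

end Problem

end Permutations


/-! ### Decomposition of canonical matrices -/

section Canonical

variable {k : Type*} [Field k] {t : ℕ} {m n : Fin t → ℕ}

theorem Idx.pos_strip (x : Idx n) : pos Idx.strip x = x.row := by
  classical
  obtain ⟨i, p, rfl⟩ := Idx.exists_mk x
  have h : pos Idx.strip (Idx.mk i p) =
      ((Finset.univ.filter fun s : Fin (n i) => s < p).map
        ⟨Idx.mk i, fun _ _ => Idx.mk_inj.mp⟩).card := by
    unfold pos
    refine congrArg Finset.card (Finset.ext fun y => ?_)
    obtain ⟨j, q, rfl⟩ := Idx.exists_mk y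
    rw [Finset.mem_filter, Finset.mem_map]
    simp only [Finset.mem_filter, Finset.mem_univ, true_and, Idx.strip_mk, Idx.mk_lt_mk]
    constructor
    · rintro ⟨rfl, h | h⟩
      · exact absurd h (lt_irrefl _)
      · exact ⟨q, h.2, rfl⟩
    · rintro ⟨s, hs, h⟩
      obtain ⟨rfl, h⟩ := Idx.mk_eq_mk.mp h
      exact ⟨rfl, Or.inr ⟨rfl, h ▸ hs⟩⟩
  rw [h, Finset.card_map, Idx.row_mk, ← Fin.card_Iio]
  congr 1
  ext s
  simp

theorem Idx.stripSize_strip (i : Fin t) : stripSize (Idx.strip : Idx n → Fin t) i = n i := by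
  classical
  have h : stripSize (Idx.strip : Idx n → Fin t) i =
      ((Finset.univ : Finset (Fin (n i))).map ⟨Idx.mk i, fun _ _ => Idx.mk_inj.mp⟩).card := by
    unfold stripSize
    refine congrArg Finset.card (Finset.ext fun y => ?_)
    obtain ⟨j, q, rfl⟩ := Idx.exists_mk y
    simp only [Finset.mem_filter, Finset.mem_univ, true_and, Idx.strip_mk, Finset.mem_map]
    constructor
    · rintro rfl
      exact ⟨q, rfl⟩
    · rintro ⟨_, h⟩
      exact (Idx.mk_eq_mk.mp h).1.symm
  rw [h, Finset.card_map, Finset.card_univ, Fintype.card_fin]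

namespace Problem

open BlockMatrix

variable {P : Problem k t} {A B C : BlockMatrix k t}

theorem rentry_diag_apply {S : Matrix (Idx m) (Idx n) k} (x : Idx m) (y : Idx n) {i : Fin t}
    (hx : x.strip = i) (hy : y.strip = i) : rentry S i i x.row y.row = S x y := by
  subst hx
  have h := rentry_apply S x y
  simp only [hy] at h
  exact h

/-- The algebra `Γ_{n × n}` with its strips. -/
theorem frame_gammaAlg (hn : P.IsStepSequence n) : Frame Idx.strip P.rel (P.gammaAlg n hn) where
  monotone := Idx.strip_mono
  size_eq i j h := by rw [Idx.stripSize_strip, Idx.stripSize_strip, hn i j h]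
  upper S hS := isBlockUpper (mem_gammaAlg_iff.mp hS)
  diag_eq S hS x y x' y' h h' hx hy := by
    have h1 := rentry_diag_eq (mem_gammaAlg_iff.mp hS) hx.1 x.row y.row
    have hx2 := hx.2
    have hy2 := hy.2
    rw [Idx.pos_strip, Idx.pos_strip] at hx2 hy2
    rw [rentry_diag_apply x y rfl h.symm, hx2, hy2, rentry_diag_apply x' y' rfl h'.symm] at h1
    exact h1
  mem S hS hS' := by
    rw [mem_gammaAlg_iff]
    convert blockDiag_mem (k := k) hn hn (f := fun i p q => rentry S i i p q) fun i j h => by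
      funext p q
      by_cases hp : p < n i
      · by_cases hq : q < n i
        · rw [rentry_of_lt S hp hq, rentry_of_lt S (hn i j h ▸ hp) (hn i j h ▸ hq)]
          refine hS' _ _ _ _ rfl rfl ⟨h, ?_⟩ ⟨h, ?_⟩ <;> simp [Idx.pos_strip]
        · rw [rentry_of_not_right S hq, rentry_of_not_right S (hn i j h ▸ hq)]
      · rw [rentry_of_not_left S hp, rentry_of_not_left S (hn i j h ▸ hp)]
    ext x y
    simp only [ofEntry, of_apply]
    by_cases h : x.strip = y.strip
    · rw [if_pos h, rentry_diag_apply x y rfl h.symm]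
    · rw [if_neg h, hS x y h]

/-- The selection of some rows in each strip, the same rows in equivalent strips. -/
theorem exists_selection (hn : P.IsStepSequence n) (D : Fin t → ℕ → Prop)
    (hD : ∀ i j, P.rel i j → D i = D j) :
    ∃ (m : Fin t → ℕ) (φ : Idx m ↪o Idx n), P.IsStepSequence m ∧ P.IsStripMap φ ∧
      ∀ u, u ∈ Set.range φ ↔ D u.strip u.row := by
  classical
  -- Cutting at `n i` makes the set finite; its elements are enumerated by `Nat.nth`, only below
  -- their number, where no default values occur.
  let D' : Fin t → ℕ → Prop := fun i p => p < n i ∧ D i p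
  have hD' : ∀ i j, P.rel i j → D' i = D' j := fun i j h => by
    funext p
    simp only [D', hn i j h, hD i j h]
  let m : Fin t → ℕ := fun i => Nat.count (D' i) (n i)
  have hlt : ∀ {i p}, p < m i → Nat.nth (D' i) p < n i := fun h => Nat.nth_lt_of_lt_count h
  have hcard : ∀ {i p}, p < m i →
      ∀ hf : (Set.ofPred (D' i)).Finite, p < hf.toFinset.card := fun {i p} h hf =>
    h.trans_le (by
      change Nat.count _ _ ≤ _
      rw [Nat.count_eq_card_filter_range]
      refine Finset.card_le_card fun x hx => ?_
      simpa using (Finset.mem_filter.mp hx).2)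
  let f : Idx m → Idx n := fun x => Idx.mk x.strip ⟨Nat.nth (D' x.strip) x.row, hlt x.row.2⟩
  have hf : StrictMono f := by
    intro x y h
    obtain ⟨i, p, rfl⟩ := Idx.exists_mk x
    obtain ⟨j, q, rfl⟩ := Idx.exists_mk y
    rcases Idx.mk_lt_mk.mp h with h | ⟨rfl, h⟩
    · exact Idx.mk_lt_mk.mpr (Or.inl h)
    · exact Idx.mk_lt_mk.mpr (Or.inr ⟨rfl, Nat.nth_lt_nth' h (hcard q.2)⟩)
  refine ⟨m, OrderEmbedding.ofStrictMono f hf, fun i j h => ?_, ⟨fun _ => rfl, fun x y h hr => ?_⟩,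
    fun u => ⟨?_, fun hu => ?_⟩⟩
  · simp only [m, hn i j h]
    congr 1
    exact hD' i j h
  · change Nat.nth (D' x.strip) x.row = Nat.nth (D' y.strip) y.row
    rw [hD' _ _ h, hr]
  · rintro ⟨x, rfl⟩
    exact (Nat.nth_mem _ (hcard x.row.2)).2
  · have h : D' u.strip u.row := ⟨u.row.2, hu⟩
    refine ⟨Idx.mk u.strip ⟨Nat.count (D' u.strip) u.row, Nat.count_strict_mono h u.row.2⟩, ?_⟩
    exact Idx.eq_iff.mpr ⟨rfl, Nat.nth_count h⟩

theorem incl_mem {φ : Idx m ↪o Idx n} (hφ : P.IsStripMap φ) (hm : P.IsStepSequence m)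
    (hn : P.IsStepSequence n) : incl k φ ∈ P.gammaRect m n :=
  hφ.submatrix_mem hm hn

theorem incl_transpose_mem {φ : Idx m ↪o Idx n} (hφ : P.IsStripMap φ) (hm : P.IsStepSequence m)
    (hn : P.IsStepSequence n) : (incl k φ)ᵀ ∈ P.gammaRect n m := by
  have h : (incl k φ)ᵀ = (1 : Matrix (Idx n) (Idx n) k).submatrix id φ := by
    rw [incl, transpose_submatrix, transpose_one]
  exact h ▸ hφ.submatrix_mem' hm hn

/-- The inclusion matrix and its transpose lie in Γ-spaces; multiplying by them on both sides
extends by zero, and the reverse multiplication restricts. -/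
theorem extend_mem_iff {φ : Idx m ↪o Idx n} (hφ : P.IsStripMap φ) (hm : P.IsStepSequence m)
    (hn : P.IsStepSequence n) {S : Matrix (Idx m) (Idx m) k} :
    extend φ S ∈ P.gammaRect n n ↔ S ∈ P.gammaRect m m := by
  have h1 := incl_mem hφ hm hn
  have h2 := incl_transpose_mem hφ hm hn
  refine ⟨fun h => ?_, fun h => gammaRect_mul h2 (gammaRect_mul h h1)⟩
  have h3 := gammaRect_mul (gammaRect_mul h1 h) h2
  rwa [extend, incl_mul_transpose_mul, Matrix.mul_assoc, incl_mul_transpose, Matrix.mul_one] at h3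

section Order

variable [LinearOrder k]

theorem IsCanonicalMatrix.eq_of_iso (hA : P.IsCanonicalMatrix A) (hB : P.IsCanonicalMatrix B)
    (h : P.Iso A B) : A = B := by
  have hs := h.size_eq
  obtain ⟨n, M⟩ := A
  obtain ⟨n', N⟩ := B
  obtain rfl : n = n' := hs
  obtain ⟨S, hS, T, hT, h, h'⟩ := h
  obtain ⟨-, hn, hM⟩ := hA
  obtain ⟨-, _, hN⟩ := hB
  congr
  exact hM.eq_of_similar hN (mem_gammaAlg_iff.mpr hS.1) ⟨⟨S, T, h, h'⟩, rfl⟩ hS.2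

/-- The direct summand of a canonical matrix that is given by a selection of rows. -/
theorem isCanonicalMatrix_restrict [Infinite k] (hA : P.Mem A)
    {Λ₁ : Subalgebra k (Matrix (Idx A.size) (Idx A.size) k)}
    (hrun : Relation.ReflTransGen (StepAt A.mat) (P.gammaAlg A.size hA.1) Λ₁)
    (hfix : ∀ S ∈ Λ₁, IsUnit S → A.mat * S = S * A.mat) {φ : Idx m ↪o Idx A.size}
    (hφ : P.IsStripMap φ) (hm : P.IsStepSequence m)
    (he : extend φ (1 : Matrix (Idx m) (Idx m) k) ∈ Λ₁) :
    P.IsCanonicalMatrix ⟨m, A.mat.submatrix φ φ⟩ := by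
  refine ⟨mem_iff.mpr ⟨hm, ?_⟩, hm, ?_⟩
  · rw [submatrix_eq_incl]
    have := rect_V_mul (incl_mem hφ hm hA.1) (mem_iff.mp hA).2 (incl_transpose_mem hφ hm hA.1)
    exact this
  · have he' := le_of_run hrun he
    have h := isCanonical_restrict hrun hfix he he'
    -- The restriction of Γ_{n×n} is Γ_{m×m}, so being canonical for the restricted algebra is being
    -- canonical for the matrix problem.
    have e : restrictAlg φ (P.gammaAlg A.size hA.1) he' = P.gammaAlg m hm := by
      ext S
      rw [mem_restrictAlg, mem_gammaAlg_iff, mem_gammaAlg_iff]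
      exact extend_mem_iff hφ hm hA.1
    rwa [e] at h

/-- A matrix that commutes with a diagonal idempotent splits after a permutation of its rows. -/
theorem permIso_of_selections {m' : Fin t → ℕ} {φ : Idx m ↪o Idx A.size} {ψ : Idx m' ↪o Idx A.size}
    (hφ : P.IsStripMap φ) (hψ : P.IsStripMap ψ) (hm : P.IsStepSequence m)
    (h : ∀ u, u ∈ Set.range ψ ↔ u ∉ Set.range φ)
    (hcomm : A.mat * extend φ 1 = extend φ 1 * A.mat) :
    P.PermIso A (BlockMatrix.blockSum ⟨m, A.mat.submatrix φ φ⟩ ⟨m', A.mat.submatrix ψ ψ⟩) := by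
  set B : BlockMatrix k t := ⟨m, A.mat.submatrix φ φ⟩ with hBdef
  set C : BlockMatrix k t := ⟨m', A.mat.submatrix ψ ψ⟩ with hCdef
  have hdis : ∀ (x : Idx m) (y : Idx m'), φ x ≠ ψ y := fun x y e =>
    (h (ψ y)).mp ⟨y, rfl⟩ ⟨x, e⟩
  let τ : Idx m ⊕ Idx m' ≃ Idx A.size := Equiv.ofBijective (Sum.elim φ ψ) ⟨by
    rintro (x | x) (y | y) e
    · exact congrArg Sum.inl (φ.injective e)
    · exact absurd e (hdis _ _)
    · exact absurd e.symm (hdis _ _)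
    · exact congrArg Sum.inr (ψ.injective e), fun u => by
    by_cases hu : u ∈ Set.range φ
    · obtain ⟨x, rfl⟩ := hu
      exact ⟨Sum.inl x, rfl⟩
    · obtain ⟨x, rfl⟩ := (h u).mpr hu
      exact ⟨Sum.inr x, rfl⟩⟩
  let ρ : Idx (B.blockSum C).size ≃ Idx A.size := (sumEquiv B C).symm.trans τ
  have hl : ∀ x : Idx m, ρ (inl B C x) = φ x := fun x => by
    simp only [ρ, Equiv.trans_apply]
    rw [sumEquiv_symm_inl]
    rfl
  have hr : ∀ x : Idx m', ρ (inr B C x) = ψ x := fun x => by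
    simp only [ρ, Equiv.trans_apply]
    rw [sumEquiv_symm_inr]
    rfl
  refine ⟨ρ, ⟨fun x => ?_, fun x y hxy hrow => ?_⟩, ?_⟩
  · rcases exists_inl_or_inr B C x with ⟨x, rfl⟩ | ⟨x, rfl⟩
    · rw [hl]
      exact hφ.strip x
    · rw [hr]
      exact hψ.strip x
  · rcases exists_inl_inl_or_inr_inr (A := B) hm hxy hrow with ⟨x, y, rfl, rfl, hxy, hrow⟩ |
      ⟨x, y, rfl, rfl, hxy, hrow⟩
    · rw [hl, hl]
      exact hφ.row x y hxy hrow
    · rw [hr, hr]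
      exact hψ.row x y hxy hrow
  · ext x y
    rw [submatrix_apply]
    rcases exists_inl_or_inr B C x with ⟨x, rfl⟩ | ⟨x, rfl⟩ <;>
      rcases exists_inl_or_inr B C y with ⟨y, rfl⟩ | ⟨y, rfl⟩
    · rw [hl, hl, blockSum_inl_inl]
      rfl
    · rw [hl, hr, blockSum_inl_inr, eq_comm]
      by_contra h0
      exact (h _).mp ⟨y, rfl⟩ ((range_iff_of_ne_zero hcomm h0).mp ⟨x, rfl⟩)
    · rw [hl, hr, blockSum_inr_inl, eq_comm]
      by_contra h0
      exact (h _).mp ⟨x, rfl⟩ ((range_iff_of_ne_zero hcomm h0).mpr ⟨y, rfl⟩)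
    · rw [hr, hr, blockSum_inr_inr]
      rfl

/-- A canonical matrix is, up to a permutation of its rows and columns, a block-direct sum of
indecomposable canonical matrices. -/
theorem IsCanonicalMatrix.exists_permIso_listSum [Infinite k] (hA : P.IsCanonicalMatrix A) :
    ∃ L : List (BlockMatrix k t), (∀ B ∈ L, P.IsIndecomposable B ∧ P.IsCanonicalMatrix B) ∧
      P.PermIso A (BlockMatrix.listSum L) := by
  classical
  induction hN : ∑ i, A.size i using Nat.strong_induction_on generalizing A with
  | _ N ih =>
  by_cases h0 : A.size = 0
  · refine ⟨[], by simp, ?_⟩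
    have e : A = BlockMatrix.listSum [] := ext_rentry h0 fun i j p q => by
      rw [rentry_of_not_left A.mat (by simp [h0]), rentry_of_not_left
        (m := (BlockMatrix.listSum (k := k) (t := t) []).size) _
        (by simp [BlockMatrix.listSum, BlockMatrix.empty])]
    exact e ▸ PermIso.refl A
  obtain ⟨hmem, _, hcan⟩ := id hA
  obtain ⟨Λ₁, hrun, hfix⟩ := isCanonical_iff.mp hcan
  have hcomm : ∀ R ∈ Λ₁, A.mat * R = R * A.mat := fun R hR => commute_of_fixed hfix hR
  have hle := le_of_run hrun
  -- In this case every endomorphism of `A` lies in `Λ₁`, which is triangular with constant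
  -- diagonal; so its idempotents are trivial and `A` is indecomposable.
  by_cases hno : NoDiagonalIdempotents Λ₁
  · refine ⟨[A], ?_, ?_⟩
    · intro B hB
      rw [List.mem_singleton.mp hB]
      refine ⟨isIndecomposable_of_idempotents hmem h0 fun e he hi => ?_, hA⟩
      exact (isTriangular_of_run hrun (frame_gammaAlg hmem.1) hcomm hno).eq_zero_or_one
        (mem_of_commute hrun (mem_gammaAlg_iff.mpr he.1) he.2) hi
    · rw [listSum_singleton]
      exact PermIso.refl A
  simp only [NoDiagonalIdempotents, not_forall] at hno
  obtain ⟨d, hd, hdΛ, x, y, hxy⟩ := hno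
  -- The support of the idempotent is described by strip and row number, which makes it comparable
  -- between equivalent strips.
  let D : Fin t → ℕ → Prop := fun i p => rentry (diagonal d) i i p p = 1
  have hD : ∀ i j, P.rel i j → D i = D j := fun i j h => by
    funext p
    simp only [D, rentry_diag_eq (mem_gammaAlg_iff.mp (hle hdΛ)) h]
  have hDd : ∀ u : Idx A.size, D u.strip u.row ↔ d u = 1 := fun u => by
    simp only [D, rentry_apply, diagonal_apply_eq]
  obtain ⟨m, φ, hm, hφ, hφr⟩ := exists_selection hmem.1 D hD
  obtain ⟨m', ψ, hm', hψ, hψr⟩ := exists_selection hmem.1 (fun i p => ¬ D i p)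
    fun i j h => by rw [hD i j h]
  have hφψ : ∀ u, u ∈ Set.range ψ ↔ u ∉ Set.range φ := fun u => by rw [hφr, hψr]
  have hφe : extend φ (1 : Matrix (Idx m) (Idx m) k) = diagonal d := by
    rw [extend_one_eq_diagonal]
    congr 1
    funext u
    by_cases hu : d u = 1
    · rw [if_pos ((hφr u).mpr ((hDd u).mpr hu)), hu]
    · rw [if_neg fun h => hu ((hDd u).mp ((hφr u).mp h)), (hd u).resolve_right hu]
  have hψe : extend ψ (1 : Matrix (Idx m') (Idx m') k) = 1 - diagonal d := by
    rw [← hφe, extend_one_eq_diagonal, extend_one_eq_diagonal, ← diagonal_one, diagonal_sub]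
    congr 1
    funext u
    by_cases hu : u ∈ Set.range φ
    · rw [if_pos hu, if_neg fun h => (hφψ u).mp h hu, sub_self]
    · rw [if_neg hu, if_pos ((hφψ u).mpr hu), sub_zero]
  have hφΛ : extend φ (1 : Matrix (Idx m) (Idx m) k) ∈ Λ₁ := hφe ▸ hdΛ
  have hψΛ : extend ψ (1 : Matrix (Idx m') (Idx m') k) ∈ Λ₁ :=
    hψe ▸ Λ₁.sub_mem Λ₁.one_mem hdΛ
  have hsplit := permIso_of_selections hφ hψ hm hφψ (hcomm _ hφΛ)
  have hs : ∑ i, A.size i = ∑ i, m i + ∑ i, m' i := by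
    rw [hsplit.size_eq, ← Finset.sum_add_distrib]
    rfl
  have hpos : ∀ {r : Fin t → ℕ}, Nonempty (Idx r) → 0 < ∑ i, r i := by
    rintro r ⟨x⟩
    exact Finset.sum_pos' (fun _ _ => Nat.zero_le _) ⟨x.strip, Finset.mem_univ _, x.row.pos⟩
  -- A nonconstant 0-1 function takes both values, so both summands are nonempty and strictly
  -- smaller than `A`.
  have hne : (∃ u, d u = 1) ∧ ∃ u, d u ≠ 1 := by
    by_cases hx : d x = 1
    · exact ⟨⟨x, hx⟩, y, fun hy => hxy (hx.trans hy.symm)⟩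
    · refine ⟨⟨y, ?_⟩, x, hx⟩
      exact (hd y).resolve_left fun hy => hxy (((hd x).resolve_right hx).trans hy.symm)
  obtain ⟨⟨u, hu⟩, v, hv⟩ := hne
  obtain ⟨u', -⟩ := (hφr u).mpr ((hDd u).mpr hu)
  obtain ⟨v', -⟩ := (hψr v).mpr fun h => hv ((hDd v).mp h)
  have hpu := hpos ⟨u'⟩
  have hpv := hpos ⟨v'⟩
  have hB := isCanonicalMatrix_restrict hmem hrun hfix hφ hm hφΛ
  have hC := isCanonicalMatrix_restrict hmem hrun hfix hψ hm' hψΛ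
  obtain ⟨L, hL, hL'⟩ := ih (∑ i, m i) (by omega) hB rfl
  obtain ⟨K, hK, hK'⟩ := ih (∑ i, m' i) (by omega) hC rfl
  refine ⟨L ++ K, fun D hD => (List.mem_append.mp hD).elim (hL D) (hK D), ?_⟩
  rw [listSum_append]
  exact hsplit.trans (PermIso.blockSum hL' hK' hm)

theorem IsCanonicalMatrix.exists_decomposition [Infinite k] (hA : P.IsCanonicalMatrix A) :
    ∃ (l : ℕ) (C : Fin l → BlockMatrix k t) (q : Fin l → ℕ), P.IsCanonicalDecomposition A C q := by
  obtain ⟨L, hL, hAL⟩ := hA.exists_permIso_listSum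
  obtain ⟨l, C, q, hC, hinj, hq, hperm⟩ := List.exists_perm_flatten_replicate L
  have h := PermIso.listSum (P := P) hperm.symm fun B hB => (hL B hB).1.1.1
  exact ⟨l, C, q, fun i => hL _ (hC i), hinj, hq, (hAL.trans h).exists_permMatrix hA.1.1⟩

/-- Isomorphic canonical matrices are equal, so the number of summands isomorphic to `C i` is the
number of copies of `C i` itself; by Krull–Schmidt it is the same in both decompositions. -/
theorem IsCanonicalDecomposition.exists_eq [IsAlgClosed k] (hA : P.IsStepSequence A.size) {l l' : ℕ}
    {C : Fin l → BlockMatrix k t} {q : Fin l → ℕ} {C' : Fin l' → BlockMatrix k t}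
    {q' : Fin l' → ℕ} (h : P.IsCanonicalDecomposition A C q)
    (h' : P.IsCanonicalDecomposition A C' q') (i : Fin l) : ∃ j, C' j = C i ∧ q' j = q i := by
  classical
  have key : ∀ {l : ℕ} {C : Fin l → BlockMatrix k t} {q : Fin l → ℕ},
      P.IsCanonicalDecomposition A C q →
      P.Iso A (BlockMatrix.listSum (List.ofFn fun i => List.replicate (q i) (C i)).flatten) ∧
      (∀ B ∈ (List.ofFn fun i => List.replicate (q i) (C i)).flatten, ∃ i, B = C i) ∧
      ∀ i, (List.ofFn fun i => List.replicate (q i) (C i)).flatten.count (C i) = q i := by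
    rintro l C q ⟨-, hinj, -, σ, hσ, h⟩
    refine ⟨Equivalent.iso hA ⟨_, hσ, isUnit_permMatrix _, h⟩, fun B hB => ?_, fun i => ?_⟩
    · obtain ⟨K, hK, hB⟩ := List.mem_flatten.mp hB
      obtain ⟨i, rfl⟩ := List.mem_ofFn.mp hK
      exact ⟨i, List.eq_of_mem_replicate hB⟩
    · rw [List.count_flatten_replicate, Finset.sum_eq_single i, if_pos rfl]
      · exact fun j _ hj => if_neg fun e => hj (hinj e)
      · exact fun h => absurd (Finset.mem_univ i) h
  obtain ⟨e, hL, hc⟩ := key h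
  obtain ⟨e', hL', hc'⟩ := key h'
  have hcount : ∀ {K : List (BlockMatrix k t)}, (∀ B ∈ K, P.IsIndecomposable B ∧
      P.IsCanonicalMatrix B) → K.countP (fun B => P.Iso B (C i)) = K.count (C i) := by
    intro K hK
    rw [List.count]
    refine List.countP_congr fun B hB => ?_
    simp only [decide_eq_true_eq, beq_iff_eq]
    refine ⟨(hK B hB).2.eq_of_iso (h.1 i).2, ?_⟩
    intro e
    exact e ▸ Iso.refl (hK B hB).1.1.1
  have hLi : ∀ B ∈ (List.ofFn fun i => List.replicate (q i) (C i)).flatten,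
      P.IsIndecomposable B ∧ P.IsCanonicalMatrix B := fun B hB => by
    obtain ⟨i, rfl⟩ := hL B hB
    exact h.1 i
  have hLi' : ∀ B ∈ (List.ofFn fun i => List.replicate (q' i) (C' i)).flatten,
      P.IsIndecomposable B ∧ P.IsCanonicalMatrix B := fun B hB => by
    obtain ⟨i, rfl⟩ := hL' B hB
    exact h'.1 i
  have h1 := countP_iso_eq (fun B hB => (hLi B hB).1) (fun B hB => (hLi' B hB).1)
    (e.symm.trans e') (h.1 i).1
  rw [hcount hLi, hcount hLi', hc] at h1
  have h2 : C i ∈ (List.ofFn fun i => List.replicate (q' i) (C' i)).flatten :=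
    List.count_pos_iff.mp (h1 ▸ h.2.2.1 i)
  obtain ⟨j, hj⟩ := hL' _ h2
  exact ⟨j, hj.symm, by rw [h1, hj, hc']⟩

theorem IsCanonicalDecomposition.unique [IsAlgClosed k] (hA : P.IsStepSequence A.size) {l l' : ℕ}
    {C : Fin l → BlockMatrix k t} {q : Fin l → ℕ} {C' : Fin l' → BlockMatrix k t}
    {q' : Fin l' → ℕ} (h : P.IsCanonicalDecomposition A C q)
    (h' : P.IsCanonicalDecomposition A C' q') :
    ∃ e : Fin l ≃ Fin l', ∀ i, C' (e i) = C i ∧ q' (e i) = q i := by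
  choose f hf using h.exists_eq hA h'
  choose g hg using h'.exists_eq hA h
  -- The two choices of indices are mutually inverse because each family consists of distinct
  -- matrices.
  refine ⟨⟨f, g, fun i => h.2.1 ?_, fun j => h'.2.1 ?_⟩, hf⟩
  · rw [(hg _).1, (hf _).1]
  · rw [(hf _).1, (hg _).1]

end Order

end Problem

end Canonical

end Belitskii

theorem theorem2p2 {k : Type*} [Field k] [IsAlgClosed k] [LinearOrder k] {t : ℕ}
    (P : Belitskii.Problem k t) :
    -- decomposition of canonical matrices
    (∀ A : Belitskii.BlockMatrix k t, P.IsCanonicalMatrix A →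
      (∃ (l : ℕ) (C : Fin l → Belitskii.BlockMatrix k t) (q : Fin l → ℕ),
        P.IsCanonicalDecomposition A C q) ∧
      (∀ (l l' : ℕ) (C : Fin l → Belitskii.BlockMatrix k t) (q : Fin l → ℕ)
        (C' : Fin l' → Belitskii.BlockMatrix k t) (q' : Fin l' → ℕ),
        P.IsCanonicalDecomposition A C q → P.IsCanonicalDecomposition A C' q' →
          ∃ e : Fin l ≃ Fin l', ∀ i, C' (e i) = C i ∧ q' (e i) = q i)) ∧
    -- decomposition of arbitrary matrices
    (∀ A : Belitskii.BlockMatrix k t, P.Mem A →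
      (∃ (r : ℕ) (B : Fin r → Belitskii.BlockMatrix k t), (∀ i, P.IsIndecomposable (B i)) ∧
        P.Equivalent A (Belitskii.BlockMatrix.listSum (List.ofFn B))) ∧
      (∀ (r s : ℕ) (B : Fin r → Belitskii.BlockMatrix k t)
        (C : Fin s → Belitskii.BlockMatrix k t),
        (∀ i, P.IsIndecomposable (B i)) → (∀ i, P.IsIndecomposable (C i)) →
        P.Equivalent A (Belitskii.BlockMatrix.listSum (List.ofFn B)) →
        P.Equivalent A (Belitskii.BlockMatrix.listSum (List.ofFn C)) →
          r = s ∧ ∃ e : Fin r ≃ Fin s, ∀ i, P.Equivalent (B i) (C (e i)))) := by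
  have : Infinite k := IsAlgClosed.instInfinite
  refine ⟨fun A hA => ⟨hA.exists_decomposition, fun _ _ _ _ _ _ h h' => h.unique hA.1.1 h'⟩,
    fun A hA => ⟨?_, fun r s B C hB hC h h' => ?_⟩⟩
  · obtain ⟨L, hL, h⟩ := Belitskii.Problem.exists_iso_listSum hA
    refine ⟨L.length, L.get, fun i => hL _ (List.get_mem _ _), ?_⟩
    rw [List.ofFn_get]
    exact h.equivalent
  · obtain ⟨e, he⟩ := Belitskii.Problem.exists_equiv_iso hB hC
      ((Belitskii.Problem.Equivalent.iso hA.1 h).symm.trans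
        (Belitskii.Problem.Equivalent.iso hA.1 h'))
    exact ⟨Fin.equiv_iff_eq.mp ⟨e⟩, e, fun i => (he i).equivalent⟩
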